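/- Let $E\to M$ be a smooth real vector bundle of finite rank over a smooth manifold, equipped with a Lie algebroid structure (anchor $\rho:E\to TM$, bracket $[\cdot,\cdot]$ on the smooth sections $\mathrm{Sec}(E)$) and a Riemannian metric $G$, regarded also as a fibrewise quadratic function $G(e)=\langle e|e\rangle$ on $E$. Let $(\Sigma,g)$ be a non-empty Riemannian manifold without boundary, $\dim\Sigma\ge 1$. For a section $u$ let $d_T(u)$ be its tangent lift, the vector field on $E$ with $d_T(u)_{v(x)}=T_xv(\rho(u)_x)-[u,v](x)^{\mathrm{vert}}$ for every section $v$ and $x\in M$; put $\mathcal L_uq=d_T(u)[q]$ for functions $q$ on $E$, and call $u$ Killing if $\mathcal L_uG=0$. The sigma model has as fields the Lie algebroid morphisms $\Phi:T\Sigma\to E$ and the action $S[\Phi]=\int_\Sigma \mathrm{Tr}(g^{-1}\Phi^*G)\,d\mathrm{Vol}_g$; write $S_D$ for the same integral over a region $D\subseteq\Sigma$. For any smooth bundle map $\Phi:T\Sigma\to E$ the section $u$ induces the infinitesimal field redefinition $\delta_u\Phi=d_T(u)\circ\Phi$; the corresponding first variation of a functional is its derivative at $t=0$ along every smooth one-parameter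 family $\Phi_t$ of bundle maps with $\Phi_0=\Phi$ and $\partial_t|_{t=0}\Phi_t=d_T(u)\circ\Phi$. **Proposition.** 1. For every section $u$ and every bundle map $\Phi$, the first variation of the Lagrangian density $\mathrm{Tr}(g^{-1}\Phi^*G)$ is $\mathrm{Tr}(g^{-1}\Phi^*\mathcal L_uG)$ at each point of $\Sigma$, and the first variation of $S_D$ is $\int_D\mathrm{Tr}(g^{-1}\Phi^*\mathcal L_uG)\,d\mathrm{Vol}_g$ for every compact $D\subseteq\Sigma$. At Lie algebroid morphisms, $\delta_u$ satisfies the linearised morphism condition. 2. Call $u$ an internal symmetry if $\delta_u$ satisfies the linearised morphism condition at Lie algebroid morphisms and leaves the action invariant, i.e. the first variation of $S_D$ vanishes at every Lie algebroid morphism, for every measurable $D$ and all families that vanish on $D\setminus C$ for some compact $C$ (so that the integrals converge). Then $u$ is an internal symmetry if and only if $u$ is Killing. It already suffices for being Killing that the total action $S$ ($D=\Sigma$) is invariant in this sense. 3. The Killing sections form a Lie subalgebra $\mathrm{iso}(E,G)$ of $\mathrm{Sec}(E)$. The map $\delta:u\mapsto d_T(u)$ is a homomorphism of Lie algebras into the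 vector fields on $E$, and the field redefinitions close off-shell: $[\delta_u,\delta_v]=\delta_{[u,v]}$ on all local functionals $\Phi\mapsto f(\Phi(p))$, $f\in C^\infty(E)$, $p\in T\Sigma$, at arbitrary bundle maps $\Phi$ (no field equation is used). The Lie algebra of the redefinitions induced by internal symmetries is $\delta(\mathrm{iso}(E,G))$, and $\delta_u=0$ (as a vector field on $E$) exactly for the central sections, $[u,v]=0$ for all $v\in\mathrm{Sec}(E)$. -/

import Mathlib

open Bundle MeasureTheory Set
open scoped Manifold ContDiff Topology

noncomputable section

/-- The derivative `X f` of a real function `f` along the tangent vector `X` at `x`. -/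
def dirDeriv {V H M : Type*} [NormedAddCommGroup V] [NormedSpace ℝ V] [TopologicalSpace H]
    (I : ModelWithCorners ℝ V H) [TopologicalSpace M] [ChartedSpace H M]
    (f : M → ℝ) (x : M) (X : TangentSpace I x) : ℝ :=
  mfderiv I 𝓘(ℝ, ℝ) f x X

/-! ### Lie algebroids -/

section Algebroid

variable {EM : Type*} [NormedAddCommGroup EM] [NormedSpace ℝ EM]
  {M : Type*} [TopologicalSpace M] [ChartedSpace EM M] [IsManifold 𝓘(ℝ, EM) ∞ M]
  {F : Type*} [NormedAddCommGroup F] [NormedSpace ℝ F]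
  {E : M → Type*} [∀ x, AddCommGroup (E x)] [∀ x, Module ℝ (E x)]
  [∀ x, TopologicalSpace (E x)] [TopologicalSpace (TotalSpace F E)]
  [FiberBundle F E] [VectorBundle ℝ F E]

/-- The product `f v` of a smooth function and a smooth section. -/
def functionSmul (f : C^∞⟮𝓘(ℝ, EM), M; ℝ⟯) (v : Cₛ^∞⟮𝓘(ℝ, EM); F, E⟯) :
    Cₛ^∞⟮𝓘(ℝ, EM); F, E⟯ :=
  ⟨fun x => f x • v x, f.contMDiff.smul_section v.contMDiff⟩

variable (EM M F E) in
/-- A Lie algebroid structure on the smooth vector bundle `E → M`: a smooth bundle map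
`ρ : E → TM` (the anchor) and a Lie bracket on the real vector space of smooth sections of `E`
such that `[u, f v] = f [u, v] + (ρ(u) f) v` and `ρ([u, v]) = [ρ(u), ρ(v)]`. -/
structure LieAlgebroid where
  anchor : ∀ x, E x →ₗ[ℝ] TangentSpace 𝓘(ℝ, EM) x
  contMDiff_anchor : ContMDiff (𝓘(ℝ, EM).prod 𝓘(ℝ, F)) 𝓘(ℝ, EM).tangent ∞
    (fun e : TotalSpace F E => (⟨e.1, anchor e.1 e.2⟩ : TangentBundle 𝓘(ℝ, EM) M))
  bracket : Cₛ^∞⟮𝓘(ℝ, EM); F, E⟯ →ₗ[ℝ] Cₛ^∞⟮𝓘(ℝ, EM); F, E⟯ →ₗ[ℝ] Cₛ^∞⟮𝓘(ℝ, EM); F, E⟯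
  bracket_self : ∀ u, bracket u u = 0
  jacobi : ∀ u v w, bracket u (bracket v w) = bracket (bracket u v) w + bracket v (bracket u w)
  leibniz : ∀ (u v : Cₛ^∞⟮𝓘(ℝ, EM); F, E⟯) (f : C^∞⟮𝓘(ℝ, EM), M; ℝ⟯) (x : M),
    bracket u (functionSmul f v) x =
      f x • bracket u v x + dirDeriv 𝓘(ℝ, EM) f x (anchor x (u x)) • v x
  anchor_bracket : ∀ (u v : Cₛ^∞⟮𝓘(ℝ, EM); F, E⟯) (x : M),
    anchor x (bracket u v x) =
      VectorField.mlieBracket 𝓘(ℝ, EM) (fun y => anchor y (u y)) (fun y => anchor y (v y)) x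

/-- The space of smooth sections `Sec(E)`, as a Lie algebra with the bracket of the
algebroid `A`. -/
@[nolint unusedArguments]
def LieAlgebroid.Sec (_A : LieAlgebroid EM M F E) := Cₛ^∞⟮𝓘(ℝ, EM); F, E⟯

instance (A : LieAlgebroid EM M F E) : AddCommGroup A.Sec :=
  inferInstanceAs (AddCommGroup Cₛ^∞⟮𝓘(ℝ, EM); F, E⟯)

instance (A : LieAlgebroid EM M F E) : Module ℝ A.Sec :=
  inferInstanceAs (Module ℝ Cₛ^∞⟮𝓘(ℝ, EM); F, E⟯)

instance (A : LieAlgebroid EM M F E) : DFunLike A.Sec M E :=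
  inferInstanceAs (DFunLike Cₛ^∞⟮𝓘(ℝ, EM); F, E⟯ M E)

instance (A : LieAlgebroid EM M F E) : LieRing A.Sec where
  bracket u v := A.bracket u v
  add_lie u v w := LinearMap.congr_fun (map_add A.bracket u v) w
  lie_add u v w := map_add (A.bracket u) v w
  lie_self u := A.bracket_self u
  leibniz_lie u v w := A.jacobi u v w

instance (A : LieAlgebroid EM M F E) : LieAlgebra ℝ A.Sec where
  lie_smul c u v := map_smul (A.bracket u) c v

/-- Through every point of the total space there passes a smooth global section. -/
theorem exists_section_through [FiniteDimensional ℝ EM] [T2Space M] [SigmaCompactSpace M] [ContMDiffVectorBundle ∞ F E 𝓘(ℝ, EM)]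
    (e : TotalSpace F E) : ∃ v : Cₛ^∞⟮𝓘(ℝ, EM); F, E⟯, v e.1 = e.2 := by
  obtain ⟨x, a⟩ := e
  obtain ⟨s, hs⟩ := exists_contMDiffSection_forall_mem_convex_of_local (n := (⊤ : ℕ∞))
    𝓘(ℝ, EM) E (fun y => {w : E y | y = x → (⟨y, w⟩ : TotalSpace F E) = ⟨x, a⟩})
    (fun y => by
      by_cases h : y = x
      · subst h
        intro v hv w hw s t _ _ hst
        simp only [Set.mem_ofPred_eq, forall_const, TotalSpace.mk_inj] at hv hw ⊢
        rw [hv, hw, ← add_smul, hst, one_smul]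
      · simp [h, convex_univ])
    (fun y => by
      by_cases h : y = x
      · subst h
        obtain ⟨U, hU, hs⟩ : ∃ U ∈ 𝓝 y, ContMDiffOn 𝓘(ℝ, EM) (𝓘(ℝ, EM).prod 𝓘(ℝ, F)) ∞
            (fun z => (⟨z, FiberBundle.extend F a z⟩ : TotalSpace F E)) U :=
          FiberBundle.exists_contMDiffOn_extend _ _ _
        refine ⟨U, hU, FiberBundle.extend F a, hs, ?_⟩
        rintro z - rfl
        simp
      · refine ⟨{x}ᶜ, isOpen_compl_singleton.mem_nhds h, 0,
          (contMDiff_zeroSection ℝ E).contMDiffOn, ?_⟩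
        intro z hz hzx
        exact absurd hzx hz)
  exact ⟨s, by simpa [TotalSpace.mk_inj] using hs x rfl⟩

variable [FiniteDimensional ℝ EM] [T2Space M] [SigmaCompactSpace M] [ContMDiffVectorBundle ∞ F E 𝓘(ℝ, EM)]

/-- Some smooth section of `E` through the point `e` of the total space. -/
def sectionThrough (e : TotalSpace F E) : Cₛ^∞⟮𝓘(ℝ, EM); F, E⟯ :=
  (exists_section_through e).choose

namespace LieAlgebroid

variable (A : LieAlgebroid EM M F E)

/-- The vertical lift of `w ∈ E_x` to the point `e ∈ E_x`: the velocity at `s = 0` of the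
curve `s ↦ e + s w`. -/
def verticalLift (e : TotalSpace F E) (w : E e.1) :
    TangentSpace (𝓘(ℝ, EM).prod 𝓘(ℝ, F)) e :=
  mfderiv 𝓘(ℝ, ℝ) (𝓘(ℝ, EM).prod 𝓘(ℝ, F))
    (fun s : ℝ => (⟨e.1, e.2 + s • w⟩ : TotalSpace F E)) 0 (1 : ℝ)

/-- The tangent lift `d_T(u)` of a section `u`, a vector field on the total space of `E`. At
`e ∈ E_x` it is `T_x v (ρ(u)_x) - ([u, v]_x)^vert`, where `v` is any section with `v(x) = e`; by
the Leibniz rule the value does not depend on `v`. Evaluated on a frame `s_a` it is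
`u^a Q_a^A ∂/∂x^A + (y^a Q_a^A ∂u^c/∂x^A - y^a u^b Q_{ba}^c) ∂/∂y^c`. -/
def tangentLift (u : A.Sec) (e : TotalSpace F E) :
    TangentSpace (𝓘(ℝ, EM).prod 𝓘(ℝ, F)) e :=
  let v : A.Sec := sectionThrough e
  mfderiv 𝓘(ℝ, EM) (𝓘(ℝ, EM).prod 𝓘(ℝ, F)) (fun y => (⟨y, v y⟩ : TotalSpace F E)) e.1
      (A.anchor e.1 (u e.1))
    - verticalLift e (⁅u, v⁆ e.1)

/-- The derivative `d_T(u)[q]` of a function `q` on `E` along the tangent lift of `u`. -/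
def lieDeriv (u : A.Sec) (q : TotalSpace F E → ℝ) (e : TotalSpace F E) : ℝ :=
  dirDeriv (𝓘(ℝ, EM).prod 𝓘(ℝ, F)) q e (A.tangentLift u e)

/-- `α` is a smooth section of the dual bundle `E*`, i.e. a fibrewise linear map which is a smooth
function on the total space. -/
def IsOneForm (α : ∀ x, E x →ₗ[ℝ] ℝ) : Prop :=
  ContMDiff (𝓘(ℝ, EM).prod 𝓘(ℝ, F)) 𝓘(ℝ, ℝ) ∞ (fun e : TotalSpace F E => α e.1 e.2)

/-- The algebroid differential of a section `α` of `E*`: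
`(d_E α)(u, v) = ρ(u)(α(v)) - ρ(v)(α(u)) - α([u, v])`, evaluated at `a, b ∈ E_x` through any
sections `u, v` with `u(x) = a`, `v(x) = b` (the value does not depend on them). -/
def dOneForm (α : ∀ x, E x →ₗ[ℝ] ℝ) (x : M) (a b : E x) : ℝ :=
  let u : A.Sec := sectionThrough ⟨x, a⟩
  let v : A.Sec := sectionThrough ⟨x, b⟩
  dirDeriv 𝓘(ℝ, EM) (fun y => α y (v y)) x (A.anchor x a)
    - dirDeriv 𝓘(ℝ, EM) (fun y => α y (u y)) x (A.anchor x b)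
    - α x (⁅u, v⁆ x)

end LieAlgebroid

/-- A Riemannian metric on `E` as a quadratic function on the total space. -/
def metricFunction [∀ x, IsTopologicalAddGroup (E x)] [∀ x, ContinuousConstSMul ℝ (E x)]
    (G : ContMDiffRiemannianMetric 𝓘(ℝ, EM) ∞ F E) (e : TotalSpace F E) : ℝ :=
  G.inner e.1 e.2 e.2

/-- `u` is a Killing section of `(E, G)`: `L_u G = d_T(u)[G] = 0`. -/
def LieAlgebroid.IsKilling [∀ x, IsTopologicalAddGroup (E x)] [∀ x, ContinuousConstSMul ℝ (E x)]
    (A : LieAlgebroid EM M F E) (G : ContMDiffRiemannianMetric 𝓘(ℝ, EM) ∞ F E)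
    (u : A.Sec) : Prop :=
  ∀ e, A.lieDeriv u (metricFunction G) e = 0

end Algebroid

/-! ### The Riemannian manifold `(N, g)`: trace and volume -/

section Source

variable {k : ℕ} {N : Type*} [TopologicalSpace N] [ChartedSpace (EuclideanSpace ℝ (Fin k)) N]
  [IsManifold (𝓡 k) ∞ N]

/-- The matrix `g(b_i, b_j)` of a family of tangent vectors. -/
def gramMatrix
    (g : ContMDiffRiemannianMetric (𝓡 k) ∞ (EuclideanSpace ℝ (Fin k))
      (TangentSpace (𝓡 k) : N → Type _))
    (z : N) (b : Fin k → TangentSpace (𝓡 k) z) : Matrix (Fin k) (Fin k) ℝ :=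
  Matrix.of fun i j => g.inner z (b i) (b j)

/-- The trace `Tr(g⁻¹ q) = ∑ g^{ij} q_{ij}` of a quadratic form `q` on `T_z N`, where
`q_{ij} = (q(b_i + b_j) - q(b_i) - q(b_j)) / 2` in the coordinate basis `b` of `T_z N`. -/
def metricTrace
    (g : ContMDiffRiemannianMetric (𝓡 k) ∞ (EuclideanSpace ℝ (Fin k))
      (TangentSpace (𝓡 k) : N → Type _))
    (z : N) (q : TangentSpace (𝓡 k) z → ℝ) : ℝ :=
  let b : Fin k → TangentSpace (𝓡 k) z := fun i => EuclideanSpace.basisFun (Fin k) ℝ i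
  ∑ i, ∑ j, (gramMatrix g z b)⁻¹ i j * ((q (b i + b j) - q (b i) - q (b j)) / 2)

variable [MeasurableSpace N]

/-- The Riemannian measure on the domain of the chart at `c`, given by `√(det g_{ij}) dz`, where
`g_{ij}` are the components of `g` in the coordinate basis of this chart. -/
def chartVolume
    (g : ContMDiffRiemannianMetric (𝓡 k) ∞ (EuclideanSpace ℝ (Fin k))
      (TangentSpace (𝓡 k) : N → Type _)) (c : N) : Measure N :=
  let ψ := (chartAt (EuclideanSpace ℝ (Fin k)) c).symm
  Measure.map ψ ((volume.restrict ψ.source).withDensity fun y =>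
    ENNReal.ofReal (Real.sqrt (gramMatrix g (ψ y) fun i =>
      mfderiv (𝓡 k) (𝓡 k) ψ y (EuclideanSpace.basisFun (Fin k) ℝ i)).det))

variable [T2Space N] [SigmaCompactSpace N]

variable (k N) in
/-- A smooth partition of unity subordinate to the charts. -/
def chartPartition : SmoothPartitionOfUnity N (𝓡 k) N univ :=
  (SmoothPartitionOfUnity.exists_isSubordinate_chartAt_source (𝓡 k) N).choose

/-- The Riemannian volume measure `dVol_g`: the measures `√(det g_{ij}) dz` on the charts, glued
by a partition of unity (by the change of variables formula, the result does not depend on the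
partition). -/
def riemannianVolume
    (g : ContMDiffRiemannianMetric (𝓡 k) ∞ (EuclideanSpace ℝ (Fin k))
      (TangentSpace (𝓡 k) : N → Type _)) : Measure N :=
  Measure.sum fun c : N =>
    (chartVolume g c).withDensity fun z => ENNReal.ofReal (chartPartition k N c z)

end Source

/-! ### The sigma model -/

section SigmaModel

variable {EM : Type*} [NormedAddCommGroup EM] [NormedSpace ℝ EM] [FiniteDimensional ℝ EM]
  {M : Type*} [TopologicalSpace M] [ChartedSpace EM M] [IsManifold 𝓘(ℝ, EM) ∞ M]
  [T2Space M] [SigmaCompactSpace M]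
  {F : Type*} [NormedAddCommGroup F] [NormedSpace ℝ F]
  {E : M → Type*} [∀ x, AddCommGroup (E x)] [∀ x, Module ℝ (E x)]
  [∀ x, TopologicalSpace (E x)] [TopologicalSpace (TotalSpace F E)]
  [FiberBundle F E] [VectorBundle ℝ F E] [ContMDiffVectorBundle ∞ F E 𝓘(ℝ, EM)]
  {k : ℕ} {N : Type*} [TopologicalSpace N] [ChartedSpace (EuclideanSpace ℝ (Fin k)) N]
  [IsManifold (𝓡 k) ∞ N]

variable (EM F E k N) in
/-- A smooth vector bundle morphism `Φ : TN → E` over a map `φ : N → M`. -/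
structure BundleMap where
  base : N → M
  fiber : ∀ z, TangentSpace (𝓡 k) z →ₗ[ℝ] E (base z)
  contMDiff : ContMDiff (𝓡 k).tangent (𝓘(ℝ, EM).prod 𝓘(ℝ, F)) ∞
    (fun p : TangentBundle (𝓡 k) N => (⟨base p.1, fiber p.1 p.2⟩ : TotalSpace F E))

namespace BundleMap

/-- `Φ` as a map of total spaces. -/
def toMap (Φ : BundleMap EM F E k N) (p : TangentBundle (𝓡 k) N) : TotalSpace F E :=
  ⟨Φ.base p.1, Φ.fiber p.1 p.2⟩

/-- `(d(Φ^* f) - Φ^*(d_E f))(X)` for a function `f` on `M` and `X ∈ T_z N`. -/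
def defectZero (A : LieAlgebroid EM M F E) (Φ : BundleMap EM F E k N)
    (f : C^∞⟮𝓘(ℝ, EM), M; ℝ⟯) (z : N) (X : TangentSpace (𝓡 k) z) : ℝ :=
  dirDeriv (𝓡 k) (fun w => f (Φ.base w)) z X
    - dirDeriv 𝓘(ℝ, EM) f (Φ.base z) (A.anchor (Φ.base z) (Φ.fiber z X))

/-- `(d(Φ^* α) - Φ^*(d_E α))(X, Y)` at `z`, for a section `α` of `E*` and vector fields
`X, Y` on `N`. -/
def defectOne (A : LieAlgebroid EM M F E) (Φ : BundleMap EM F E k N)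
    (α : ∀ x, E x →ₗ[ℝ] ℝ) (X Y : ∀ z : N, TangentSpace (𝓡 k) z) (z : N) : ℝ :=
  dirDeriv (𝓡 k) (fun w => α (Φ.base w) (Φ.fiber w (Y w))) z (X z)
    - dirDeriv (𝓡 k) (fun w => α (Φ.base w) (Φ.fiber w (X w))) z (Y z)
    - α (Φ.base z) (Φ.fiber z (VectorField.mlieBracket (𝓡 k) X Y z))
    - A.dOneForm α (Φ.base z) (Φ.fiber z (X z)) (Φ.fiber z (Y z))

/-- `Φ : TN → E` is a morphism of Lie algebroids: `Φ^*` commutes with the differentials on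
functions and on one-forms (which generate all algebroid forms). -/
def IsLieAlgebroidMorphism (A : LieAlgebroid EM M F E) (Φ : BundleMap EM F E k N) : Prop :=
  (∀ (f : C^∞⟮𝓘(ℝ, EM), M; ℝ⟯) (z : N) (X : TangentSpace (𝓡 k) z), Φ.defectZero A f z X = 0) ∧
  ∀ (α : ∀ x, E x →ₗ[ℝ] ℝ) (X Y : Cₛ^∞⟮𝓡 k; EuclideanSpace ℝ (Fin k),
      (TangentSpace (𝓡 k) : N → Type _)⟯) (z : N),
    LieAlgebroid.IsOneForm (EM := EM) (F := F) α → Φ.defectOne A α X Y z = 0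

/-- `Tr(g⁻¹ Φ^* q)` at `z`, for a function `q` on `E` that is quadratic on the fibres. -/
def pullbackTrace
    (g : ContMDiffRiemannianMetric (𝓡 k) ∞ (EuclideanSpace ℝ (Fin k))
      (TangentSpace (𝓡 k) : N → Type _))
    (Φ : BundleMap EM F E k N) (q : TotalSpace F E → ℝ) (z : N) : ℝ :=
  metricTrace g z fun X => q (Φ.toMap ⟨z, X⟩)

/-- The sigma model action `∫_D Tr(g⁻¹ Φ^* G) dVol_g` over a region `D ⊆ N`. The action `S[Φ]` of
the model is the case `D = N`. -/
def action [MeasurableSpace N] [T2Space N] [SigmaCompactSpace N]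
    [∀ x, IsTopologicalAddGroup (E x)] [∀ x, ContinuousConstSMul ℝ (E x)]
    (g : ContMDiffRiemannianMetric (𝓡 k) ∞ (EuclideanSpace ℝ (Fin k))
      (TangentSpace (𝓡 k) : N → Type _))
    (G : ContMDiffRiemannianMetric 𝓘(ℝ, EM) ∞ F E) (D : Set N)
    (Φ : BundleMap EM F E k N) : ℝ :=
  ∫ z in D, Φ.pullbackTrace g (metricFunction G) z ∂(riemannianVolume g)

end BundleMap

namespace LieAlgebroid

variable (A : LieAlgebroid EM M F E)

/-- The infinitesimal field redefinition induced by the section `u`: the value at the field `Φ` is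
the vector field `d_T(u) ∘ Φ` along `Φ`, i.e. in coordinates
`δφ^A = u^a Q_a^A`, `δχ_i^a = χ_i^b (Q_b^A ∂u^a/∂x^A - u^c Q_{cb}^a)`. -/
def redefinition (u : A.Sec) (Φ : BundleMap EM F E k N) (p : TangentBundle (𝓡 k) N) :
    TangentSpace (𝓘(ℝ, EM).prod 𝓘(ℝ, F)) (Φ.toMap p) :=
  A.tangentLift u (Φ.toMap p)

/-- The smooth one-parameter family of fields `Ψ t` realises, to first order at `t = 0`, the
field redefinition of `Ψ 0` induced by `u`. No field equation and no morphism condition is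
imposed. -/
def IsRedefinitionFamily (u : A.Sec) (Ψ : ℝ → BundleMap EM F E k N) : Prop :=
  ContMDiff (𝓘(ℝ, ℝ).prod (𝓡 k).tangent) (𝓘(ℝ, EM).prod 𝓘(ℝ, F)) ∞
    (fun r : ℝ × TangentBundle (𝓡 k) N => (Ψ r.1).toMap r.2) ∧
  ∀ p, mfderiv 𝓘(ℝ, ℝ) (𝓘(ℝ, EM).prod 𝓘(ℝ, F)) (fun t => (Ψ t).toMap p) 0 (1 : ℝ) =
    A.redefinition u (Ψ 0) p

/-- `O'` is the first variation of the functional `O` of the fields under the redefinition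
induced by `u`. -/
def HasVariation (u : A.Sec) (O O' : BundleMap EM F E k N → ℝ) : Prop :=
  ∀ Ψ : ℝ → BundleMap EM F E k N, A.IsRedefinitionFamily u Ψ →
    HasDerivAt (fun t => O (Ψ t)) (O' (Ψ 0)) 0

/-- At Lie algebroid morphisms, the redefinition induced by `u` satisfies the linearised morphism
condition, i.e. it is tangent to the space of fields of the model. -/
def PreservesMorphisms (k : ℕ) (N : Type*) [TopologicalSpace N]
    [ChartedSpace (EuclideanSpace ℝ (Fin k)) N] [IsManifold (𝓡 k) ∞ N] (u : A.Sec) : Prop :=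
  ∀ Ψ : ℝ → BundleMap EM F E k N, A.IsRedefinitionFamily u Ψ →
    (Ψ 0).IsLieAlgebroidMorphism A →
    (∀ (f : C^∞⟮𝓘(ℝ, EM), M; ℝ⟯) (z : N) (X : TangentSpace (𝓡 k) z),
      HasDerivAt (fun t => (Ψ t).defectZero A f z X) 0 0) ∧
    ∀ (α : ∀ x, E x →ₗ[ℝ] ℝ) (X Y : Cₛ^∞⟮𝓡 k; EuclideanSpace ℝ (Fin k),
        (TangentSpace (𝓡 k) : N → Type _)⟯) (z : N),
      IsOneForm (EM := EM) (F := F) α → HasDerivAt (fun t => (Ψ t).defectOne A α X Y z) 0 0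

variable [MeasurableSpace N] [T2Space N] [SigmaCompactSpace N]
    [∀ x, IsTopologicalAddGroup (E x)] [∀ x, ContinuousConstSMul ℝ (E x)]
    (g : ContMDiffRiemannianMetric (𝓡 k) ∞ (EuclideanSpace ℝ (Fin k))
      (TangentSpace (𝓡 k) : N → Type _))
    (G : ContMDiffRiemannianMetric 𝓘(ℝ, EM) ∞ F E)

/-- The action over the region `D` is invariant under the field redefinition induced by `u`: its
first variation vanishes at every Lie algebroid morphism. For the integral to converge, the part
of `D` on which the fields are not zero is required to lie in a compact set; for compact `D`, in
particular if `N` is compact and `D = N`, this is no restriction. -/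
def LeavesActionInvariant (D : Set N) (u : A.Sec) : Prop :=
  ∀ Ψ : ℝ → BundleMap EM F E k N, A.IsRedefinitionFamily u Ψ →
    (Ψ 0).IsLieAlgebroidMorphism A →
    (∃ C : Set N, IsCompact C ∧ ∀ t, ∀ z ∈ D \ C, (Ψ t).fiber z = 0) →
    HasDerivAt (fun t => (Ψ t).action g G D) 0 0

/-- `u` induces an internal symmetry of the sigma model: the induced field redefinition is tangent
to the space of Lie algebroid morphisms and leaves the action invariant, over every region. -/
def IsInternalSymmetry (u : A.Sec) : Prop :=
  A.PreservesMorphisms k N u ∧ ∀ D : Set N, MeasurableSet D → A.LeavesActionInvariant g G D u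

end LieAlgebroid

end SigmaModel

end

/-!
A tangent vector of `E` is determined by the derivatives of the functions pulled back from `M` and
of the fibrewise linear functions `e ↦ ⟨α, e⟩` given by one-forms. On a velocity of `v` corrected
by the vertical lift of `[u, v]`, these derivatives are `ρ(u) f` and `⟨L_u α, v(x)⟩`, which depend
on `v(x)` only; so `d_T(u)` is well defined. By the same separation, `L_u` is a derivation of
`C^∞(E)` depending homomorphically on `u`, and it commutes with the algebroid differential, so that
`δ_u` is tangent to the morphisms. The variation of the action is found by differentiating under
the integral sign, and `L_u G` is its density.

For the converse, let `v` be a section, `γ` an integral curve of `ρ(v)` and `h` a function on the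
source with small values. The field `X ↦ dh(X) v(γ(h))` is a morphism, because both sides of the
morphism condition contain `dh ∧ dh`, and the variation of its density is `|dh|² (L_u G)(v(γ(h)))`.
If `L_u G` does not vanish at `e₀ = v(γ(0))`, it has constant sign at all `v(γ(h))` once `h` is
small, so the variation of the action is not zero.
-/

noncomputable section

/-! ### Directional derivatives -/

section DirDeriv

variable {V H P : Type*} [NormedAddCommGroup V] [NormedSpace ℝ V] [TopologicalSpace H]
  {I : ModelWithCorners ℝ V H} [TopologicalSpace P] [ChartedSpace H P]
  {V' H' P' : Type*} [NormedAddCommGroup V'] [NormedSpace ℝ V'] [TopologicalSpace H']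
  {I' : ModelWithCorners ℝ V' H'} [TopologicalSpace P'] [ChartedSpace H' P']

theorem dirDeriv_comp {q : P' → ℝ} {F : P → P'} {x : P}
    (hq : MDifferentiableAt I' 𝓘(ℝ, ℝ) q (F x)) (hF : MDifferentiableAt I I' F x)
    (X : TangentSpace I x) :
    dirDeriv I (fun y => q (F y)) x X = dirDeriv I' q (F x) (mfderiv I I' F x X) :=
  DFunLike.congr_fun (mfderiv_comp x hq hF) X

theorem dirDeriv_congr {f f' : P → ℝ} {x : P} (h : f =ᶠ[𝓝 x] f') (X : TangentSpace I x) :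
    dirDeriv I f x X = dirDeriv I f' x X := by
  unfold dirDeriv
  rw [h.mfderiv_eq]
  rfl

theorem dirDeriv_const (c : ℝ) (x : P) (X : TangentSpace I x) :
    dirDeriv I (fun _ => c) x X = 0 := by
  unfold dirDeriv
  rw [mfderiv_const]
  rfl

theorem dirDeriv_apply_zero (f : P → ℝ) (x : P) : dirDeriv I f x 0 = 0 := map_zero _

theorem dirDeriv_apply_add (f : P → ℝ) (x : P) (X Y : TangentSpace I x) :
    dirDeriv I f x (X + Y) = dirDeriv I f x X + dirDeriv I f x Y := map_add _ _ _

theorem dirDeriv_apply_sub (f : P → ℝ) (x : P) (X Y : TangentSpace I x) :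
    dirDeriv I f x (X - Y) = dirDeriv I f x X - dirDeriv I f x Y := map_sub _ _ _

theorem dirDeriv_apply_smul (f : P → ℝ) (x : P) (c : ℝ) (X : TangentSpace I x) :
    dirDeriv I f x (c • X) = c * dirDeriv I f x X := map_smul _ _ _

theorem dirDeriv_add {f f' : P → ℝ} {x : P} (hf : MDifferentiableAt I 𝓘(ℝ, ℝ) f x)
    (hf' : MDifferentiableAt I 𝓘(ℝ, ℝ) f' x) (X : TangentSpace I x) :
    dirDeriv I (fun y => f y + f' y) x X = dirDeriv I f x X + dirDeriv I f' x X :=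
  DFunLike.congr_fun (hf.hasMFDerivAt.add hf'.hasMFDerivAt).mfderiv X

theorem dirDeriv_sub {f f' : P → ℝ} {x : P} (hf : MDifferentiableAt I 𝓘(ℝ, ℝ) f x)
    (hf' : MDifferentiableAt I 𝓘(ℝ, ℝ) f' x) (X : TangentSpace I x) :
    dirDeriv I (fun y => f y - f' y) x X = dirDeriv I f x X - dirDeriv I f' x X :=
  DFunLike.congr_fun (hf.hasMFDerivAt.sub hf'.hasMFDerivAt).mfderiv X

theorem dirDeriv_mul {f f' : P → ℝ} {x : P} (hf : MDifferentiableAt I 𝓘(ℝ, ℝ) f x)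
    (hf' : MDifferentiableAt I 𝓘(ℝ, ℝ) f' x) (X : TangentSpace I x) :
    dirDeriv I (fun y => f y * f' y) x X = f x * dirDeriv I f' x X + f' x * dirDeriv I f x X :=
  DFunLike.congr_fun (hf.hasMFDerivAt.mul hf'.hasMFDerivAt).mfderiv X

theorem dirDeriv_const_mul {f : P → ℝ} {x : P} (hf : MDifferentiableAt I 𝓘(ℝ, ℝ) f x) (c : ℝ)
    (X : TangentSpace I x) :
    dirDeriv I (fun y => c * f y) x X = c * dirDeriv I f x X := by
  rw [dirDeriv_mul mdifferentiableAt_const hf, dirDeriv_const, mul_zero, add_zero]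

theorem dirDeriv_sum {ι : Type} {s : Finset ι} {f : ι → P → ℝ} {x : P}
    (hf : ∀ i ∈ s, MDifferentiableAt I 𝓘(ℝ, ℝ) (f i) x) (X : TangentSpace I x) :
    dirDeriv I (fun y => ∑ i ∈ s, f i y) x X = ∑ i ∈ s, dirDeriv I (f i) x X := by
  have hsum : HasMFDerivAt I 𝓘(ℝ, ℝ) (∑ i ∈ s, f i) x (∑ i ∈ s, mfderiv I 𝓘(ℝ, ℝ) (f i) x) :=
    .sum fun i hi => (hf i hi).hasMFDerivAt
  rw [Finset.sum_fn] at hsum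
  exact (DFunLike.congr_fun hsum.mfderiv X).trans (sum_apply _ _ _)

theorem dirDeriv_continuousLinearMap (l : V →L[ℝ] ℝ) (y w : V) :
    dirDeriv 𝓘(ℝ, V) l y w = l w :=
  DFunLike.congr_fun (ContinuousLinearMap.mfderiv_eq l) w

theorem dirDeriv_sum_mul {ι : Type} [Fintype ι] {g : ι → P → ℝ} {c ξ : ι → ℝ} {x : P}
    (hg : ∀ i, MDifferentiableAt I 𝓘(ℝ, ℝ) (g i) x) (X : TangentSpace I x) :
    dirDeriv (𝓘(ℝ, ι → ℝ).prod I) (fun r : (ι → ℝ) × P => ∑ i, r.1 i * g i r.2) (c, x) (ξ, X) =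
      ∑ i, (c i * dirDeriv I (g i) x X + g i x * ξ i) := by
  have hcoord (i : ι) : MDifferentiableAt 𝓘(ℝ, ι → ℝ) 𝓘(ℝ, ℝ) (fun a : ι → ℝ => a i) c :=
    (ContinuousLinearMap.proj (R := ℝ) (φ := fun _ : ι => ℝ) i).mdifferentiableAt
  have hfst (i : ι) : MDifferentiableAt (𝓘(ℝ, ι → ℝ).prod I) 𝓘(ℝ, ℝ)
      (fun r : (ι → ℝ) × P => r.1 i) (c, x) := (hcoord i).comp (c, x) mdifferentiableAt_fst
  have hsnd (i : ι) : MDifferentiableAt (𝓘(ℝ, ι → ℝ).prod I) 𝓘(ℝ, ℝ)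
      (fun r : (ι → ℝ) × P => g i r.2) (c, x) := (hg i).comp (c, x) mdifferentiableAt_snd
  have hdfst (i : ι) : dirDeriv (𝓘(ℝ, ι → ℝ).prod I) (fun r : (ι → ℝ) × P => r.1 i) (c, x) (ξ, X) =
      ξ i := by
    refine (dirDeriv_comp (q := fun a : ι → ℝ => a i) (hcoord i) mdifferentiableAt_fst _).trans ?_
    rw [mfderiv_fst]
    exact dirDeriv_continuousLinearMap (ContinuousLinearMap.proj (φ := fun _ : ι => ℝ) i) c ξ
  have hdsnd (i : ι) : dirDeriv (𝓘(ℝ, ι → ℝ).prod I) (fun r : (ι → ℝ) × P => g i r.2) (c, x)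
      (ξ, X) = dirDeriv I (g i) x X := by
    refine (dirDeriv_comp (hg i) mdifferentiableAt_snd _).trans ?_
    rw [mfderiv_snd]
    rfl
  refine (dirDeriv_sum (fun i _ => (hfst i).mul (hsnd i)) _).trans
    (Finset.sum_congr rfl fun i _ => ?_)
  exact (dirDeriv_mul (hfst i) (hsnd i) _).trans
    (congrArg₂ (fun a b => c i * a + g i x * b) (hdsnd i) (hdfst i))

theorem dirDeriv_real (f : ℝ → ℝ) (x c : ℝ) : dirDeriv 𝓘(ℝ, ℝ) f x c = c * deriv f x := by
  unfold dirDeriv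
  rw [mfderiv_eq_fderiv]
  exact (fderiv_eq_smul_deriv (f := f) (x := x) c).trans (smul_eq_mul c _)

theorem hasDerivAt_comp_curve {q : P → ℝ} {c : ℝ → P} {t : ℝ}
    (hq : MDifferentiableAt I 𝓘(ℝ, ℝ) q (c t)) (hc : MDifferentiableAt 𝓘(ℝ, ℝ) I c t) :
    HasDerivAt (fun s => q (c s)) (dirDeriv I q (c t) (mfderiv 𝓘(ℝ, ℝ) I c t (1 : ℝ))) t := by
  have hderiv := (dirDeriv_comp hq hc (1 : ℝ)).symm.trans (dirDeriv_real _ _ _)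
  rw [one_mul] at hderiv
  have hqc : MDifferentiableAt 𝓘(ℝ, ℝ) 𝓘(ℝ, ℝ) (fun s => q (c s)) t := hq.comp t hc
  exact hderiv ▸ hqc.differentiableAt.hasDerivAt

theorem mdifferentiableAt_dirDeriv [IsManifold I 2 P] {f : P → ℝ} (hf : ContMDiff I 𝓘(ℝ, ℝ) 2 f)
    {F : P' → TangentBundle I P} {x : P'} (hF : MDifferentiableAt I' I.tangent F x) :
    MDifferentiableAt I' 𝓘(ℝ, ℝ) (fun y => dirDeriv I f (F y).1 (F y).2) x := by
  have htangentMap : ContMDiff I.tangent 𝓘(ℝ, ℝ).tangent 1 (tangentMap I 𝓘(ℝ, ℝ) f) :=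
    hf.contMDiff_tangentMap (by norm_num)
  exact (((contMDiff_snd_tangentBundle_modelSpace ℝ 𝓘(ℝ, ℝ)).comp htangentMap).mdifferentiableAt
    (by simp)).comp x hF

theorem contMDiffAt_dirDeriv [IsManifold I ∞ P] {f : P → ℝ} (hf : ContMDiff I 𝓘(ℝ, ℝ) ∞ f)
    {F : P' → TangentBundle I P} {x : P'} (hF : ContMDiffAt I' I.tangent ∞ F x) :
    ContMDiffAt I' 𝓘(ℝ, ℝ) ∞ (fun y => dirDeriv I f (F y).1 (F y).2) x := by
  have htangentMap : ContMDiff I.tangent 𝓘(ℝ, ℝ).tangent ∞ (tangentMap I 𝓘(ℝ, ℝ) f) :=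
    hf.contMDiff_tangentMap (by simp)
  exact (contMDiff_snd_tangentBundle_modelSpace ℝ 𝓘(ℝ, ℝ)).contMDiffAt.comp x
    (htangentMap.contMDiffAt.comp x hF)

theorem contMDiff_dirDeriv [IsManifold I ∞ P] {f : P → ℝ} (hf : ContMDiff I 𝓘(ℝ, ℝ) ∞ f)
    {F : P' → TangentBundle I P} (hF : ContMDiff I' I.tangent ∞ F) :
    ContMDiff I' 𝓘(ℝ, ℝ) ∞ (fun y => dirDeriv I f (F y).1 (F y).2) :=
  fun x => contMDiffAt_dirDeriv hf (hF x)

end DirDeriv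

/-! ### Vector fields in charts -/

section Charts

variable {V H P : Type*} [NormedAddCommGroup V] [NormedSpace ℝ V] [TopologicalSpace H]
  {I : ModelWithCorners ℝ V H} [TopologicalSpace P] [ChartedSpace H P] [I.Boundaryless]

theorem mdifferentiableAt_extChartAt_symm [IsManifold I 1 P] {x₀ : P} {y : V}
    (hy : y ∈ (extChartAt I x₀).target) :
    MDifferentiableAt 𝓘(ℝ, V) I (extChartAt I x₀).symm y := by
  have := mdifferentiableWithinAt_extChartAt_symm (I := I) (x := x₀) hy
  rwa [I.range_eq_univ, mdifferentiableWithinAt_univ] at this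

theorem contMDiffAt_extChartAt_symm {n : WithTop ℕ∞} [IsManifold I n P] {x₀ : P} {y : V}
    (hy : y ∈ (extChartAt I x₀).target) :
    ContMDiffAt 𝓘(ℝ, V) I n (extChartAt I x₀).symm y :=
  (contMDiffOn_extChartAt_symm x₀).contMDiffAt ((isOpen_extChartAt_target x₀).mem_nhds hy)

theorem dirDeriv_eq_fderiv_extChartAt [IsManifold I 1 P] {f : P → ℝ} {x₀ x : P}
    (hx : x ∈ (extChartAt I x₀).source) (hf : MDifferentiableAt I 𝓘(ℝ, ℝ) f x)
    (X : TangentSpace I x) :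
    dirDeriv I f x X = fderiv ℝ (fun y => f ((extChartAt I x₀).symm y)) (extChartAt I x₀ x)
      (mfderiv I 𝓘(ℝ, V) (extChartAt I x₀) x X) := by
  have hf' : MDifferentiableAt I 𝓘(ℝ, ℝ) f ((extChartAt I x₀).symm (extChartAt I x₀ x)) := by
    rwa [(extChartAt I x₀).left_inv hx]
  have hfchart : MDifferentiableAt 𝓘(ℝ, V) 𝓘(ℝ, ℝ) (fun y => f ((extChartAt I x₀).symm y))
      (extChartAt I x₀ x) :=
    hf'.comp _ (mdifferentiableAt_extChartAt_symm ((extChartAt I x₀).map_source hx))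
  have hf_eq : f =ᶠ[𝓝 x] fun z => (fun y => f ((extChartAt I x₀).symm y)) (extChartAt I x₀ z) := by
    filter_upwards [extChartAt_source_mem_nhds' hx] with z hz
    exact congrArg f ((extChartAt I x₀).left_inv hz).symm
  rw [dirDeriv_congr hf_eq,
    dirDeriv_comp hfchart (mdifferentiableAt_extChartAt (by simpa using hx)), dirDeriv,
    mfderiv_eq_fderiv]
  rfl

variable (I) in
/-- The expression of a vector field `X` in the chart at `x₀`, a vector field on the model space. -/
def fieldInChart (x₀ : P) (X : ∀ z : P, TangentSpace I z) : V → V :=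
  VectorField.mpullback 𝓘(ℝ, V) I (extChartAt I x₀).symm X

theorem isInvertible_mfderiv_extChartAt_symm [IsManifold I 1 P] {x₀ : P} {y : V}
    (hy : y ∈ (extChartAt I x₀).target) :
    (mfderiv 𝓘(ℝ, V) I (extChartAt I x₀).symm y).IsInvertible := by
  have := isInvertible_mfderivWithin_extChartAt_symm (I := I) hy
  rwa [I.range_eq_univ, mfderivWithin_univ] at this

theorem mfderiv_extChartAt_symm_fieldInChart [IsManifold I 1 P] {x₀ : P} {y : V}
    (hy : y ∈ (extChartAt I x₀).target) (X : ∀ z : P, TangentSpace I z) :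
    mfderiv 𝓘(ℝ, V) I (extChartAt I x₀).symm y (fieldInChart (V := V) I x₀ X y) =
      X ((extChartAt I x₀).symm y) :=
  (isInvertible_mfderiv_extChartAt_symm hy).self_apply_inverse _

theorem fderiv_fieldInChart [IsManifold I 1 P] {f : P → ℝ} {x₀ : P} {y : V}
    (hy : y ∈ (extChartAt I x₀).target)
    (hf : MDifferentiableAt I 𝓘(ℝ, ℝ) f ((extChartAt I x₀).symm y))
    (X : ∀ z : P, TangentSpace I z) :
    fderiv ℝ (fun y => f ((extChartAt I x₀).symm y)) y (fieldInChart I x₀ X y) =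
      dirDeriv I f ((extChartAt I x₀).symm y) (X ((extChartAt I x₀).symm y)) := by
  rw [← mfderiv_eq_fderiv]
  exact (dirDeriv_comp hf (mdifferentiableAt_extChartAt_symm hy) _).trans
    (congrArg _ (mfderiv_extChartAt_symm_fieldInChart hy X))

theorem differentiableAt_fieldInChart [CompleteSpace V] [IsManifold I 2 P] {x₀ : P}
    {X : ∀ z : P, TangentSpace I z}
    (hX : MDifferentiableAt I I.tangent (fun z => (X z : TangentBundle I P)) x₀) :
    DifferentiableAt ℝ (fieldInChart I x₀ X) (extChartAt I x₀ x₀) := by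
  rw [← mdifferentiableWithinAt_univ] at hX
  have := hX.differentiableWithinAt_mpullbackWithin_vectorField
  rw [I.range_eq_univ, preimage_univ, univ_inter, VectorField.mpullbackWithin_univ] at this
  exact differentiableWithinAt_univ.1 this

theorem contDiffOn_fieldInChart [CompleteSpace V] [IsManifold I ∞ P]
    {X : ∀ z : P, TangentSpace I z}
    (hX : ContMDiff I I.tangent ∞ (fun z => (X z : TangentBundle I P))) (x₀ : P) :
    ContDiffOn ℝ ∞ (fieldInChart I x₀ X) (extChartAt I x₀).target := fun _ hy =>
  (contMDiffAt_vectorSpace_iff_contDiffAt.1 ((hX _).mpullback_vectorField_preimage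
    (contMDiffAt_extChartAt_symm (n := ∞) hy) (isInvertible_mfderiv_extChartAt_symm hy)
    (by simp))).contDiffWithinAt

theorem fieldInChart_extChartAt [IsManifold I 1 P] {x₀ x : P}
    (hx : x ∈ (extChartAt I x₀).source) (X : ∀ z : P, TangentSpace I z) :
    fieldInChart I x₀ X (extChartAt I x₀ x) = mfderiv I 𝓘(ℝ, V) (extChartAt I x₀) x (X x) := by
  have hleft := mfderivWithin_extChartAt_symm_comp_mfderiv_extChartAt' (I := I) hx
  rw [I.range_eq_univ, mfderivWithin_univ] at hleft
  have hX : (X ((extChartAt I x₀).symm (extChartAt I x₀ x)) : V) = X x := by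
    rw [(extChartAt I x₀).left_inv hx]
  have htarget := (extChartAt I x₀).map_source hx
  refine (isInvertible_mfderiv_extChartAt_symm htarget).injective ?_
  exact (mfderiv_extChartAt_symm_fieldInChart htarget X).trans
    (hX.trans (DFunLike.congr_fun hleft (X x)).symm)

theorem fieldInChart_mlieBracket [IsManifold I 1 P] (X Y : ∀ z : P, TangentSpace I z) (x₀ : P) :
    fieldInChart I x₀ (VectorField.mlieBracket I X Y) (extChartAt I x₀ x₀) =
      VectorField.lieBracket ℝ (fieldInChart I x₀ X) (fieldInChart I x₀ Y)
        (extChartAt I x₀ x₀) := by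
  have hinv := isInvertible_mfderiv_extChartAt (I := I) (mem_extChartAt_source x₀)
  have huniv : (extChartAt I x₀).symm ⁻¹' univ ∩ range I = univ := by simp [I.range_eq_univ]
  rw [fieldInChart_extChartAt (mem_extChartAt_source x₀), ← VectorField.mlieBracketWithin_univ,
    VectorField.mlieBracketWithin_apply]
  refine (hinv.self_apply_inverse _).trans ?_
  have hfield (Z : ∀ z : P, TangentSpace I z) :
      VectorField.mpullbackWithin 𝓘(ℝ, V) I (extChartAt I x₀).symm Z (range I) =
        fieldInChart I x₀ Z := by
    rw [I.range_eq_univ, VectorField.mpullbackWithin_univ, fieldInChart]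
  rw [huniv, hfield, hfield]
  exact congrFun (VectorField.lieBracketWithin_univ (𝕜 := ℝ) (V := fieldInChart (V := V) I x₀ X)
    (W := fieldInChart (V := V) I x₀ Y)) _

theorem fderiv_lieBracket {f : V → ℝ} {X Y : V → V} {y : V} (hf : ContDiffAt ℝ 2 f y)
    (hX : DifferentiableAt ℝ X y) (hY : DifferentiableAt ℝ Y y) :
    fderiv ℝ f y (VectorField.lieBracket ℝ X Y y) =
      fderiv ℝ (fun z => fderiv ℝ f z (Y z)) y (X y)
        - fderiv ℝ (fun z => fderiv ℝ f z (X z)) y (Y y) := by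
  have hf' : DifferentiableAt ℝ (fderiv ℝ f) y :=
    (hf.fderiv_right (m := 1) (by norm_num)).differentiableAt (by simp)
  have hsymm : IsSymmSndFDerivAt ℝ f y := hf.isSymmSndFDerivAt (by simp)
  rw [fderiv_clm_apply hf' hY, fderiv_clm_apply hf' hX, VectorField.lieBracket]
  simp only [map_sub, add_apply, ContinuousLinearMap.comp_apply,
    ContinuousLinearMap.flip_apply, hsymm.eq (X y) (Y y)]
  ring

theorem dirDeriv_mlieBracket [CompleteSpace V] [IsManifold I 2 P] {f : P → ℝ}
    (hf : ContMDiff I 𝓘(ℝ, ℝ) 2 f) {X Y : ∀ z : P, TangentSpace I z} {x₀ : P}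
    (hX : MDifferentiableAt I I.tangent (fun z => (X z : TangentBundle I P)) x₀)
    (hY : MDifferentiableAt I I.tangent (fun z => (Y z : TangentBundle I P)) x₀) :
    dirDeriv I f x₀ (VectorField.mlieBracket I X Y x₀) =
      dirDeriv I (fun z => dirDeriv I f z (Y z)) x₀ (X x₀)
        - dirDeriv I (fun z => dirDeriv I f z (X z)) x₀ (Y x₀) := by
  have : IsManifold I 1 P := IsManifold.of_le (n := 2) (by norm_num)
  have hf' (x : P) : MDifferentiableAt I 𝓘(ℝ, ℝ) f x := hf.mdifferentiableAt (by simp)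
  have hleft : (extChartAt I x₀).symm (extChartAt I x₀ x₀) = x₀ := extChartAt_to_inv x₀
  have htarget := mem_extChartAt_target (I := I) x₀
  set fchart : V → ℝ := fun y => f ((extChartAt I x₀).symm y)
  have hfchart : ContDiffAt ℝ 2 fchart (extChartAt I x₀ x₀) :=
    (hf.contMDiffAt.comp _ (contMDiffAt_extChartAt_symm htarget)).contDiffAt
  have iterated (Z W : ∀ z : P, TangentSpace I z)
      (hW : MDifferentiableAt I I.tangent (fun z => (W z : TangentBundle I P)) x₀) :
      dirDeriv I (fun z => dirDeriv I f z (W z)) x₀ (Z x₀) =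
        fderiv ℝ (fun y => fderiv ℝ fchart y (fieldInChart I x₀ W y)) (extChartAt I x₀ x₀)
          (fieldInChart I x₀ Z (extChartAt I x₀ x₀)) := by
    have houter := fderiv_fieldInChart (f := fun z => dirDeriv I f z (W z)) htarget
      (hleft.symm ▸ mdifferentiableAt_dirDeriv hf hW) Z
    have hinner : (fun y => dirDeriv I f ((extChartAt I x₀).symm y)
        (W ((extChartAt I x₀).symm y))) =ᶠ[𝓝 (extChartAt I x₀ x₀)]
          fun y => fderiv ℝ fchart y (fieldInChart I x₀ W y) := by
      filter_upwards [extChartAt_target_mem_nhds x₀] with y hy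
      exact (fderiv_fieldInChart hy (hf' _) W).symm
    rw [hinner.fderiv_eq, hleft] at houter
    exact houter.symm
  have hbracket := fderiv_fieldInChart htarget (hf' _) (VectorField.mlieBracket I X Y)
  rw [hleft] at hbracket
  rw [iterated X Y hY, iterated Y X hX, ← hbracket, fieldInChart_mlieBracket]
  exact fderiv_lieBracket hfchart (differentiableAt_fieldInChart hX)
    (differentiableAt_fieldInChart hY)

end Charts

/-! ### Smooth families of functions and of points -/

section Families

variable {V H P : Type*} [NormedAddCommGroup V] [NormedSpace ℝ V] [TopologicalSpace H]
  {I : ModelWithCorners ℝ V H} [TopologicalSpace P] [ChartedSpace H P]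

theorem contMDiffAt_tangentBundle_prodMk [IsManifold I ∞ P]
    {V' H' P' : Type*} [NormedAddCommGroup V'] [NormedSpace ℝ V'] [TopologicalSpace H']
    {I' : ModelWithCorners ℝ V' H'} [TopologicalSpace P'] [ChartedSpace H' P'] [IsManifold I' ∞ P']
    {W K Q : Type*} [NormedAddCommGroup W] [NormedSpace ℝ W] [TopologicalSpace K]
    {J : ModelWithCorners ℝ W K} [TopologicalSpace Q] [ChartedSpace K Q]
    {F : Q → TangentBundle I P} {F' : Q → TangentBundle I' P'} {x : Q}
    (hF : ContMDiffAt J I.tangent ∞ F x) (hF' : ContMDiffAt J I'.tangent ∞ F' x) :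
    ContMDiffAt J (I.prod I').tangent ∞ (fun y => (⟨((F y).1, (F' y).1), ((F y).2, (F' y).2)⟩ :
      TangentBundle (I.prod I') (P × P'))) x :=
  (contMDiff_equivTangentBundleProd_symm (I := I) (M := P) (I' := I') (M' := P')
    (n := ∞)).contMDiffAt.comp x (hF.prodMk hF')

theorem contMDiff_tangentBundle_mk {n : WithTop ℕ∞} {W : Type*} [NormedAddCommGroup W]
    [NormedSpace ℝ W] {b ξ : P → W} (hb : ContMDiff I 𝓘(ℝ, W) n b)
    (hξ : ContMDiff I 𝓘(ℝ, W) n ξ) :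
    ContMDiff I 𝓘(ℝ, W).tangent n (fun p => (⟨b p, ξ p⟩ : TangentBundle 𝓘(ℝ, W) W)) := fun p =>
  Bundle.contMDiffAt_totalSpace.2 ⟨hb p, by simpa using hξ p⟩

theorem hasDerivAt_comp_prodMk_left {h : ℝ × P → ℝ} {t : ℝ} {p : P}
    (hh : MDifferentiableAt (𝓘(ℝ, ℝ).prod I) 𝓘(ℝ, ℝ) h (t, p)) :
    HasDerivAt (fun s => h (s, p))
      (dirDeriv (𝓘(ℝ, ℝ).prod I) h (t, p) ((1 : ℝ), (0 : TangentSpace I p))) t := by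
  have hcurve : MDifferentiableAt 𝓘(ℝ, ℝ) (𝓘(ℝ, ℝ).prod I) (fun s : ℝ => (s, p)) t :=
    mdifferentiableAt_id.prodMk mdifferentiableAt_const
  have hderiv := hasDerivAt_comp_curve hh hcurve
  rwa [mfderiv_prod_left] at hderiv

theorem contMDiff_deriv_fst [IsManifold I ∞ P] {h : ℝ × P → ℝ}
    (hh : ContMDiff (𝓘(ℝ, ℝ).prod I) 𝓘(ℝ, ℝ) ∞ h) :
    ContMDiff (𝓘(ℝ, ℝ).prod I) 𝓘(ℝ, ℝ) ∞ (fun r : ℝ × P => deriv (fun s => h (s, r.2)) r.1) := by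
  have hderiv : (fun r : ℝ × P => deriv (fun s => h (s, r.2)) r.1) =
      fun r : ℝ × P => dirDeriv (𝓘(ℝ, ℝ).prod I) h r ((1 : ℝ), (0 : TangentSpace I r.2)) :=
    funext fun r => (hasDerivAt_comp_prodMk_left (hh.mdifferentiableAt (by simp))).deriv
  have hone : ContMDiff 𝓘(ℝ, ℝ) 𝓘(ℝ, ℝ).tangent ∞
      (fun t : ℝ => (⟨t, (1 : ℝ)⟩ : TangentBundle 𝓘(ℝ, ℝ) ℝ)) :=
    contMDiff_vectorSpace_iff_contDiff.2 contDiff_const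
  have hzero : ContMDiff I I.tangent ∞ (fun p : P => (⟨p, 0⟩ : TangentBundle I P)) :=
    contMDiff_zeroSection ℝ _
  rw [hderiv]
  exact fun r => contMDiffAt_dirDeriv hh (F := fun r : ℝ × P =>
    (⟨(r.1, r.2), ((1 : ℝ), (0 : TangentSpace I r.2))⟩ :
      TangentBundle (𝓘(ℝ, ℝ).prod I) (ℝ × P)))
    (contMDiffAt_tangentBundle_prodMk (hone.comp contMDiff_fst).contMDiffAt
      (hzero.comp contMDiff_snd).contMDiffAt)

theorem fderiv_comp_prodMk_right {h : ℝ × V → ℝ} {t : ℝ} {y : V}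
    (hh : DifferentiableAt ℝ h (t, y)) (X : V) :
    fderiv ℝ (fun z => h (t, z)) y X = fderiv ℝ h (t, y) (0, X) :=
  DFunLike.congr_fun (hh.hasFDerivAt.comp y (hasFDerivAt_prodMk_right t y)).fderiv X

theorem deriv_comp_prodMk_left {h : ℝ × V → ℝ} {t : ℝ} {y : V}
    (hh : DifferentiableAt ℝ h (t, y)) :
    deriv (fun s => h (s, y)) t = fderiv ℝ h (t, y) (1, 0) := by
  have := HasFDerivAt.comp t hh.hasFDerivAt (hasFDerivAt_prodMk_left (𝕜 := ℝ) t y)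
  exact this.hasDerivAt.deriv

theorem hasDerivAt_fderiv_comp_prodMk_right {h : ℝ × V → ℝ} {t : ℝ} {y : V}
    (hh : ContDiffAt ℝ 2 h (t, y)) (X : V) :
    HasDerivAt (fun s => fderiv ℝ (fun z => h (s, z)) y X)
      (fderiv ℝ (fun z => deriv (fun s => h (s, z)) t) y X) t := by
  have hdiff : ∀ᶠ r in 𝓝 (t, y), DifferentiableAt ℝ h r :=
    (hh.eventually (by simp)).mono fun r hr => hr.differentiableAt (by simp)
  have hfderiv : DifferentiableAt ℝ (fderiv ℝ h) (t, y) :=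
    (hh.fderiv_right (m := 1) (by norm_num)).differentiableAt (by simp)
  have hsymm : IsSymmSndFDerivAt ℝ h (t, y) := hh.isSymmSndFDerivAt (by simp)
  have hspace : (fun s => fderiv ℝ (fun z => h (s, z)) y X) =ᶠ[𝓝 t]
      fun s => fderiv ℝ h (s, y) (0, X) :=
    ((Continuous.prodMk_left y).tendsto t |>.eventually hdiff).mono
      fun s hs => fderiv_comp_prodMk_right hs X
  have htime : (fun z => deriv (fun s => h (s, z)) t) =ᶠ[𝓝 y] fun z => fderiv ℝ h (t, z) (1, 0) :=
    ((Continuous.prodMk_right t).tendsto y |>.eventually hdiff).mono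
      fun z hz => deriv_comp_prodMk_left hz
  have hleft : HasDerivAt (fun s => fderiv ℝ h (s, y)) (fderiv ℝ (fderiv ℝ h) (t, y) (1, 0)) t := by
    have := HasFDerivAt.comp t hfderiv.hasFDerivAt (hasFDerivAt_prodMk_left (𝕜 := ℝ) t y)
    exact this.hasDerivAt
  have hright : HasFDerivAt (fun z => fderiv ℝ h (t, z))
      ((fderiv ℝ (fderiv ℝ h) (t, y)).comp (ContinuousLinearMap.inr ℝ ℝ V)) y :=
    hfderiv.hasFDerivAt.comp y (hasFDerivAt_prodMk_right t y)
  rw [htime.fderiv_eq, (hright.clm_apply (hasFDerivAt_const ((1 : ℝ), (0 : V)) y)).fderiv]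
  refine ((hleft.clm_apply (hasDerivAt_const t ((0 : ℝ), X))).congr_of_eventuallyEq
    hspace).congr_deriv ?_
  simp [hsymm.eq (0, X) (1, 0)]

theorem hasDerivAt_dirDeriv [IsManifold I ∞ P] [I.Boundaryless] {h : ℝ × P → ℝ}
    (hh : ContMDiff (𝓘(ℝ, ℝ).prod I) 𝓘(ℝ, ℝ) ∞ h) (t : ℝ) (x : P) (X : TangentSpace I x) :
    HasDerivAt (fun s => dirDeriv I (fun y => h (s, y)) x X)
      (dirDeriv I (fun y => deriv (fun s => h (s, y)) t) x X) t := by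
  have slice {h : ℝ × P → ℝ} (hh : ContMDiff (𝓘(ℝ, ℝ).prod I) 𝓘(ℝ, ℝ) ∞ h) (s : ℝ) :
      MDifferentiableAt I 𝓘(ℝ, ℝ) (fun y => h (s, y)) x :=
    (hh.comp (contMDiff_const.prodMk contMDiff_id)).mdifferentiableAt (by simp)
  simp_rw [fun s => dirDeriv_eq_fderiv_extChartAt (mem_extChartAt_source x) (slice hh s) X]
  rw [dirDeriv_eq_fderiv_extChartAt (mem_extChartAt_source x) (slice (contMDiff_deriv_fst hh) t) X]
  refine hasDerivAt_fderiv_comp_prodMk_right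
    (h := fun r : ℝ × V => h (r.1, (extChartAt I x).symm r.2)) ?_ _
  have hchart : ContMDiffAt 𝓘(ℝ, V) I ∞ (extChartAt I x).symm (extChartAt I x x) :=
    contMDiffAt_extChartAt_symm (mem_extChartAt_target x)
  have hcomp := hh.contMDiffAt.comp (t, extChartAt I x x) (contMDiffAt_fst.prodMk
    (hchart.comp (t, extChartAt I x x) contMDiffAt_snd))
  rw [← modelWithCornersSelf_prod, chartedSpaceSelf_prod] at hcomp
  exact hcomp.contDiffAt.of_le (by norm_cast)

theorem mfderiv_injective_of_comp_eventuallyEq_id {V' H' P' : Type*} [NormedAddCommGroup V']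
    [NormedSpace ℝ V'] [TopologicalSpace H'] {I' : ModelWithCorners ℝ V' H'} [TopologicalSpace P']
    [ChartedSpace H' P'] {f : P → P'} {g : P' → P} {x : P}
    (hf : MDifferentiableAt I I' f x) (hg : MDifferentiableAt I' I g (f x))
    (hgf : g ∘ f =ᶠ[𝓝 x] id) : Function.Injective (mfderiv I I' f x) := by
  have hid (ξ : TangentSpace I x) : mfderiv I' I g (f x) (mfderiv I I' f x ξ) = ξ := by
    refine (mfderiv_comp_apply x hg hf ξ).symm.trans ?_
    refine (DFunLike.congr_fun (hgf.mfderiv_eq (I := I) (I' := I)) ξ).trans ?_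
    rw [mfderiv_id]
    rfl
  intro ξ η h
  rw [← hid ξ, ← hid η, h]

theorem tangentSpace_ext_dirDeriv [IsManifold I ∞ P] [I.Boundaryless] [T2Space P]
    [FiniteDimensional ℝ V] {x : P} {X Y : TangentSpace I x}
    (h : ∀ f : C^∞⟮I, P; ℝ⟯, dirDeriv I f x X = dirDeriv I f x Y) : X = Y := by
  obtain ⟨χ⟩ : Nonempty (SmoothBumpFunction I x) := inferInstance
  have hchart : MDifferentiableAt I 𝓘(ℝ, V) (extChartAt I x) x :=
    mdifferentiableAt_extChartAt (mem_chart_source H x)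
  have coordinate (l : V →L[ℝ] ℝ) : ∃ f : C^∞⟮I, P; ℝ⟯, ∀ Z,
      dirDeriv I f x Z = l (mfderiv I 𝓘(ℝ, V) (extChartAt I x) x Z) := by
    have hsmooth : ContMDiffOn I 𝓘(ℝ, ℝ) ∞ (fun y => l (extChartAt I x y)) (chartAt H x).source :=
      l.contMDiff.comp_contMDiffOn contMDiffOn_extChartAt
    have heq : (fun y => χ y • l (extChartAt I x y)) =ᶠ[𝓝 x] fun y => l (extChartAt I x y) := by
      filter_upwards [χ.eventuallyEq_one] with y hy
      rw [hy, Pi.one_apply, one_smul]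
    refine ⟨⟨_, χ.contMDiff_smul hsmooth⟩, fun Z => (dirDeriv_congr heq Z).trans ?_⟩
    exact (dirDeriv_comp l.mdifferentiableAt hchart Z).trans (dirDeriv_continuousLinearMap l _ _)
  refine (isInvertible_mfderiv_extChartAt (mem_extChartAt_source x)).injective ?_
  refine (SeparatingDual.eq_iff_forall_dual_eq (R := ℝ) (V := V)).2 fun l => ?_
  obtain ⟨f, hf⟩ := coordinate l
  exact (hf X).symm.trans ((h f).trans (hf Y))

theorem exists_contDiff_abs_le_hasDerivAt_one {ε : ℝ} (hε : 0 < ε) :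
    ∃ τ : ℝ → ℝ, ContDiff ℝ ∞ τ ∧ τ 0 = 0 ∧ HasDerivAt τ 1 0 ∧ ∀ t, |τ t| ≤ ε := by
  refine ⟨fun t => ε * Real.sin (t / ε),
    contDiff_const.mul (Real.contDiff_sin.comp (contDiff_id.div_const ε)), by simp, ?_, fun t => ?_⟩
  · refine ((((hasDerivAt_id (0 : ℝ)).div_const ε).sin).const_mul ε).congr_deriv ?_
    simp [hε.ne']
  · rw [abs_mul, abs_of_pos hε]
    exact mul_le_of_le_one_right hε.le (Real.abs_sin_le_one _)

variable (I) in
theorem exists_pos_eventually_extChartAt_add_smul_mem_target [I.Boundaryless] {w : P → V} {p₀ : P}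
    (hw : ContinuousAt w p₀) :
    ∃ ε > 0, ∀ᶠ p in 𝓝 p₀, ∀ s : ℝ, |s| ≤ ε →
      extChartAt I p₀ p + s • w p ∈ (extChartAt I p₀).target := by
  have hcont : ContinuousAt (fun r : ℝ × P => extChartAt I p₀ r.2 + r.1 • w r.2) (0, p₀) :=
    (ContinuousAt.comp (x := ((0 : ℝ), p₀)) (continuousAt_extChartAt p₀) continuousAt_snd).add
      (continuousAt_fst.smul (ContinuousAt.comp (x := ((0 : ℝ), p₀)) hw continuousAt_snd))
  have htarget : ∀ᶠ r : ℝ × P in 𝓝 0 ×ˢ 𝓝 p₀,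
      extChartAt I p₀ r.2 + r.1 • w r.2 ∈ (extChartAt I p₀).target := by
    rw [← nhds_prod_eq]
    exact hcont.eventually ((isOpen_extChartAt_target p₀).mem_nhds (by simp))
  obtain ⟨small, hsmall, near, hnear, hmem⟩ := Filter.eventually_prod_iff.1 htarget
  obtain ⟨ε, hε, hball⟩ := Metric.nhds_basis_closedBall.eventually_iff.1 hsmall
  exact ⟨ε, hε, hnear.mono fun p hp s hs => hmem (hball (by simpa using hs)) hp⟩

theorem contMDiffAt_extChartAt_symm_add_smul [IsManifold I ∞ P] [I.Boundaryless] {w : P → V}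
    {τ : ℝ → ℝ} {p₀ p : P} {t : ℝ} (hp : p ∈ (extChartAt I p₀).source)
    (hw : ContMDiffAt I 𝓘(ℝ, V) ∞ w p) (hτ : ContDiffAt ℝ ∞ τ t)
    (htarget : extChartAt I p₀ p + τ t • w p ∈ (extChartAt I p₀).target) :
    ContMDiffAt (𝓘(ℝ, ℝ).prod I) I ∞
      (fun r : ℝ × P => (extChartAt I p₀).symm (extChartAt I p₀ r.2 + τ r.1 • w r.2)) (t, p) := by
  have hchart : ContMDiffAt I 𝓘(ℝ, V) ∞ (extChartAt I p₀) p :=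
    contMDiffAt_extChartAt' (by rwa [extChartAt_source] at hp)
  exact ContMDiffAt.comp (x := (t, p)) (contMDiffAt_extChartAt_symm htarget)
    ((ContMDiffAt.comp (x := (t, p)) hchart contMDiffAt_snd).add
      ((hτ.contMDiffAt.comp (t, p) contMDiffAt_fst).smul
        (ContMDiffAt.comp (x := (t, p)) hw contMDiffAt_snd)))

theorem mfderiv_extChartAt_symm_add_smul_fieldInChart [IsManifold I 1 P] [I.Boundaryless]
    {τ : ℝ → ℝ} (hτ0 : τ 0 = 0) (hτ : HasDerivAt τ 1 0) {p₀ p : P}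
    (hp : p ∈ (extChartAt I p₀).source) (Z : ∀ p : P, TangentSpace I p) :
    mfderiv 𝓘(ℝ, ℝ) I (fun t => (extChartAt I p₀).symm
      (extChartAt I p₀ p + τ t • fieldInChart I p₀ Z (extChartAt I p₀ p))) 0 (1 : ℝ) = Z p := by
  set φ := extChartAt I p₀
  obtain ⟨y, hy, rfl⟩ : ∃ y ∈ φ.target, φ.symm y = p :=
    ⟨φ p, φ.map_source hp, φ.left_inv hp⟩
  rw [φ.right_inv hy]
  have hcurve :
      HasDerivAt (fun t => y + τ t • fieldInChart I p₀ Z y) (fieldInChart I p₀ Z y) 0 := by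
    simpa using (hτ.smul_const (fieldInChart I p₀ Z y)).const_add y
  refine (mfderiv_comp_apply_of_eq (f := fun t => y + τ t • fieldInChart I p₀ Z y) (0 : ℝ)
    (mdifferentiableAt_extChartAt_symm hy) hcurve.differentiableAt.mdifferentiableAt
    (by simp [hτ0]) _).trans ?_
  rw [mfderiv_eq_fderiv, ← mfderiv_extChartAt_symm_fieldInChart hy Z]
  exact congrArg _ hcurve.deriv

theorem exists_smooth_family_mfderiv_eq [CompleteSpace V] [IsManifold I ∞ P] [I.Boundaryless]
    {Z : ∀ p : P, TangentSpace I p}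
    (hZ : ContMDiff I I.tangent ∞ (fun p => (⟨p, Z p⟩ : TangentBundle I P))) (p₀ : P) :
    ∃ R : ℝ → P → P, ∀ᶠ p in 𝓝 p₀,
      (∀ t, ContMDiffAt (𝓘(ℝ, ℝ).prod I) I ∞ (fun r : ℝ × P => R r.1 r.2) (t, p)) ∧
        R 0 p = p ∧ mfderiv 𝓘(ℝ, ℝ) I (fun t => R t p) 0 (1 : ℝ) = Z p := by
  have hw {p : P} (hp : p ∈ (extChartAt I p₀).source) :
      ContMDiffAt I 𝓘(ℝ, V) ∞ (fun p => fieldInChart I p₀ Z (extChartAt I p₀ p)) p :=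
    ContMDiffAt.comp (x := p) (g := fieldInChart I p₀ Z)
      ((contDiffOn_fieldInChart hZ p₀).contDiffAt ((isOpen_extChartAt_target p₀).mem_nhds
        ((extChartAt I p₀).map_source hp))).contMDiffAt
      (contMDiffAt_extChartAt' (by rwa [extChartAt_source] at hp))
  obtain ⟨ε, hε, htarget⟩ := exists_pos_eventually_extChartAt_add_smul_mem_target I
    (hw (mem_extChartAt_source p₀)).continuousAt
  obtain ⟨τ, hτ, hτ0, hτ', hτε⟩ := exists_contDiff_abs_le_hasDerivAt_one hε
  refine ⟨fun t p => (extChartAt I p₀).symm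
    (extChartAt I p₀ p + τ t • fieldInChart I p₀ Z (extChartAt I p₀ p)), ?_⟩
  filter_upwards [htarget, extChartAt_source_mem_nhds (I := I) p₀] with p hp hsource
  exact ⟨fun t => contMDiffAt_extChartAt_symm_add_smul hsource (hw hsource) hτ.contDiffAt
      (hp _ (hτε t)),
    by simp only [hτ0, zero_smul, add_zero, (extChartAt I p₀).left_inv hsource],
    mfderiv_extChartAt_symm_add_smul_fieldInChart hτ0 hτ' hsource Z⟩

end Families

/-! ### Smooth maps into vector bundles, and local frames -/

section VectorBundle

variable {EB HB B : Type*} [NormedAddCommGroup EB] [NormedSpace ℝ EB] [TopologicalSpace HB]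
  {IB : ModelWithCorners ℝ EB HB} [TopologicalSpace B] [ChartedSpace HB B]
  {F : Type*} [NormedAddCommGroup F] [NormedSpace ℝ F]
  {E : B → Type*} [∀ x, AddCommGroup (E x)] [∀ x, Module ℝ (E x)]
  [∀ x, TopologicalSpace (E x)] [TopologicalSpace (TotalSpace F E)]
  [FiberBundle F E] [VectorBundle ℝ F E]

omit [NormedSpace ℝ F] [∀ x, AddCommGroup (E x)] [∀ x, Module ℝ (E x)] [VectorBundle ℝ F E] in
variable (F E) in
theorem trivializationAt_baseSet_mem_nhds (x : B) : (trivializationAt F E x).baseSet ∈ 𝓝 x :=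
  (trivializationAt F E x).open_baseSet.mem_nhds (mem_baseSet_trivializationAt F E x)

omit [∀ x, AddCommGroup (E x)] [∀ x, Module ℝ (E x)] [VectorBundle ℝ F E] in
theorem mdifferentiableAt_comp_proj (f : C^∞⟮IB, B; ℝ⟯) (e : TotalSpace F E) :
    MDifferentiableAt (IB.prod 𝓘(ℝ, F)) 𝓘(ℝ, ℝ) (fun e : TotalSpace F E => f e.1) e :=
  (f.contMDiff.comp (contMDiff_proj E)).mdifferentiableAt (by simp)

section Maps

variable {V H Q : Type*} [NormedAddCommGroup V] [NormedSpace ℝ V] [TopologicalSpace H]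
  {I : ModelWithCorners ℝ V H} [TopologicalSpace Q] [ChartedSpace H Q]
  {n : WithTop ℕ∞} {b : Q → B} {q : Q}

theorem contMDiffAt_totalSpace_add {s s' : ∀ q, E (b q)}
    (hs : ContMDiffAt I (IB.prod 𝓘(ℝ, F)) n (fun q => (⟨b q, s q⟩ : TotalSpace F E)) q)
    (hs' : ContMDiffAt I (IB.prod 𝓘(ℝ, F)) n (fun q => (⟨b q, s' q⟩ : TotalSpace F E)) q) :
    ContMDiffAt I (IB.prod 𝓘(ℝ, F)) n (fun q => (⟨b q, s q + s' q⟩ : TotalSpace F E)) q := by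
  rw [contMDiffAt_totalSpace] at *
  refine ⟨hs.1, (hs.2.add hs'.2).congr_of_eventuallyEq ?_⟩
  filter_upwards [hs.1.continuousAt.eventually (trivializationAt_baseSet_mem_nhds F E (b q))]
    with r hr
  exact ((trivializationAt F E (b q)).linear ℝ hr).map_add _ _

theorem contMDiffAt_totalSpace_smul {c : Q → ℝ} {s : ∀ q, E (b q)}
    (hc : ContMDiffAt I 𝓘(ℝ, ℝ) n c q)
    (hs : ContMDiffAt I (IB.prod 𝓘(ℝ, F)) n (fun q => (⟨b q, s q⟩ : TotalSpace F E)) q) :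
    ContMDiffAt I (IB.prod 𝓘(ℝ, F)) n (fun q => (⟨b q, c q • s q⟩ : TotalSpace F E)) q := by
  rw [contMDiffAt_totalSpace] at *
  refine ⟨hs.1, (hc.smul hs.2).congr_of_eventuallyEq ?_⟩
  filter_upwards [hs.1.continuousAt.eventually (trivializationAt_baseSet_mem_nhds F E (b q))]
    with r hr
  exact ((trivializationAt F E (b q)).linear ℝ hr).map_smul _ _

theorem contMDiffAt_totalSpace_sum [ContMDiffVectorBundle n F E IB] {ι : Type*} {t : Finset ι}
    {s : ι → ∀ q, E (b q)} (hb : ContMDiffAt I IB n b q)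
    (hs : ∀ i ∈ t, ContMDiffAt I (IB.prod 𝓘(ℝ, F)) n
      (fun q => (⟨b q, s i q⟩ : TotalSpace F E)) q) :
    ContMDiffAt I (IB.prod 𝓘(ℝ, F)) n
      (fun q => (⟨b q, ∑ i ∈ t, s i q⟩ : TotalSpace F E)) q := by
  classical
  induction t using Finset.induction_on with
  | empty => simpa [zeroSection, Function.comp_def] using
      (contMDiff_zeroSection ℝ E).contMDiffAt.comp q hb
  | insert a t ha ih =>
    simp only [Finset.sum_insert ha]
    exact contMDiffAt_totalSpace_add (hs a (Finset.mem_insert_self _ _))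
      (ih fun i hi => hs i (Finset.mem_insert_of_mem hi))

variable (IB) in
theorem contMDiff_fiber_add_smul {x : B} (a w : E x) :
    ContMDiff 𝓘(ℝ, ℝ) (IB.prod 𝓘(ℝ, F)) n (fun s : ℝ => (⟨x, a + s • w⟩ : TotalSpace F E)) :=
  fun _ => contMDiffAt_totalSpace_add (b := fun _ => x) (s := fun _ => a) (s' := fun s => s • w)
    contMDiffAt_const
    (contMDiffAt_totalSpace_smul (s := fun _ => w) contMDiffAt_id contMDiffAt_const)

theorem contMDiff_linearCombination [ContMDiffVectorBundle n F E IB] {ι : Type*} [Fintype ι]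
    (s : ι → ContMDiffSection IB F n E) :
    ContMDiff (𝓘(ℝ, ι → ℝ).prod IB) (IB.prod 𝓘(ℝ, F)) n
      (fun r : (ι → ℝ) × B => (⟨r.2, ∑ i, r.1 i • s i r.2⟩ : TotalSpace F E)) := fun r =>
  contMDiffAt_totalSpace_sum (s := fun i (r : (ι → ℝ) × B) => r.1 i • s i r.2) contMDiffAt_snd
    fun i _ => contMDiffAt_totalSpace_smul (b := Prod.snd) (s := fun r : (ι → ℝ) × B => s i r.2)
      ((contDiff_apply ℝ ℝ i).contMDiff.contMDiffAt.comp r contMDiffAt_fst)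
      ((s i).contMDiff.contMDiffAt.comp r contMDiffAt_snd)

end Maps

section Frames

theorem localFrameCoeff_apply_eq_repr_basisAt [ContMDiffVectorBundle 1 F E IB] {ι : Type*}
    (b : Module.Basis ι ℝ F) (t : Trivialization F (TotalSpace.proj : TotalSpace F E → B))
    [MemTrivializationAtlas t] {x : B} (hx : x ∈ t.baseSet) (i : ι) (a : E x) :
    t.localFrameCoeff IB b i x a = (t.basisAt b hx).repr a i := by
  classical
  simpa using t.localFrameCoeff_apply_of_mem_baseSet (I := IB) b hx (Function.update 0 x a) i

theorem contMDiffOn_localFrameCoeff_totalSpace [ContMDiffVectorBundle ∞ F E IB]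
    [ContMDiffVectorBundle 1 F E IB] [FiniteDimensional ℝ F] {ι : Type*} (b : Module.Basis ι ℝ F)
    (t : Trivialization F (TotalSpace.proj : TotalSpace F E → B)) [MemTrivializationAtlas t]
    (i : ι) :
    ContMDiffOn (IB.prod 𝓘(ℝ, F)) 𝓘(ℝ, ℝ) ∞
      (fun e : TotalSpace F E => t.localFrameCoeff IB b i e.1 e.2)
      (TotalSpace.proj ⁻¹' t.baseSet) := by
  have hcoord : ContMDiff 𝓘(ℝ, F) 𝓘(ℝ, ℝ) ∞ (b.coord i) :=
    (LinearMap.toContinuousLinearMap (b.coord i)).contDiff.contMDiff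
  have ht : ContMDiffOn (IB.prod 𝓘(ℝ, F)) 𝓘(ℝ, F) ∞ (fun e : TotalSpace F E => (t e).2)
      (TotalSpace.proj ⁻¹' t.baseSet) := fun e he =>
    ((t.contMDiffAt_iff (f := fun e : TotalSpace F E => e) (t.mem_source.2 he)).1
      contMDiffAt_id).2.contMDiffWithinAt
  refine (hcoord.comp_contMDiffOn ht).congr fun e he => ?_
  rw [localFrameCoeff_apply_eq_repr_basisAt b t he]
  simp [Trivialization.basisAt]

variable [FiniteDimensional ℝ EB] [T2Space B] [IsManifold IB ∞ B]

theorem exists_contMDiffSection_eventuallyEq [ContMDiffVectorBundle ∞ F E IB] {x : B} {U : Set B}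
    (hU : U ∈ 𝓝 x) {s : ∀ y, E y}
    (hs : ContMDiffOn IB (IB.prod 𝓘(ℝ, F)) ∞ (fun y => (⟨y, s y⟩ : TotalSpace F E)) U) :
    ∃ σ : ContMDiffSection IB F ∞ E, ∀ᶠ y in 𝓝 x, σ y = s y := by
  have hU' : interior U ∈ 𝓝 x := interior_mem_nhds.2 hU
  obtain ⟨χ, -, hχ⟩ := (SmoothBumpFunction.nhds_basis_tsupport (I := IB) x).mem_iff.1 hU'
  refine ⟨⟨_, χ.contMDiff.contMDiffOn.smul_section_of_tsupport isOpen_interior hχ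
    (hs.mono interior_subset)⟩, χ.eventuallyEq_one.mono fun y hy => ?_⟩
  exact (congrArg (· • s y) hy).trans (one_smul ℝ _)

omit [VectorBundle ℝ F E] in
theorem exists_contMDiff_linear_eventuallyEq {x : B} {U : Set B} (hU : U ∈ 𝓝 x)
    {α : ∀ y, E y →ₗ[ℝ] ℝ}
    (hα : ContMDiffOn (IB.prod 𝓘(ℝ, F)) 𝓘(ℝ, ℝ) ∞ (fun e : TotalSpace F E => α e.1 e.2)
      (TotalSpace.proj ⁻¹' U)) :
    ∃ β : ∀ y, E y →ₗ[ℝ] ℝ,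
      ContMDiff (IB.prod 𝓘(ℝ, F)) 𝓘(ℝ, ℝ) ∞ (fun e : TotalSpace F E => β e.1 e.2) ∧
        ∀ᶠ y in 𝓝 x, β y = α y := by
  have hU' : interior U ∈ 𝓝 x := interior_mem_nhds.2 hU
  obtain ⟨χ, -, hχ⟩ := (SmoothBumpFunction.nhds_basis_tsupport (I := IB) x).mem_iff.1 hU'
  have hproj : Continuous (TotalSpace.proj : TotalSpace F E → B) := FiberBundle.continuous_proj F E
  refine ⟨fun y => χ y • α y, contMDiff_of_tsupport fun e he => ?_,
    χ.eventuallyEq_one.mono fun y hy => (congrArg (· • α y) hy).trans (one_smul ℝ _)⟩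
  have he' : e.1 ∈ tsupport χ :=
    tsupport_comp_subset_preimage χ hproj (tsupport_smul_subset_left (χ ∘ TotalSpace.proj) _ he)
  exact (χ.contMDiff.comp (contMDiff_proj E)).contMDiffAt.smul
    (hα.contMDiffAt (hproj.continuousAt (mem_interior_iff_mem_nhds.1 (hχ he'))))

theorem exists_frame_dualFrame [ContMDiffVectorBundle ∞ F E IB] [FiniteDimensional ℝ F] (x : B) :
    ∃ (s : Fin (Module.finrank ℝ F) → ContMDiffSection IB F ∞ E)
      (θ : Fin (Module.finrank ℝ F) → ∀ y, E y →ₗ[ℝ] ℝ),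
      (∀ i, ContMDiff (IB.prod 𝓘(ℝ, F)) 𝓘(ℝ, ℝ) ∞ (fun e : TotalSpace F E => θ i e.1 e.2)) ∧
      ∀ᶠ y in 𝓝 x, (∀ a : E y, ∑ i, θ i y a • s i y = a) ∧
        ∀ i j, θ i y (s j y) = if i = j then 1 else 0 := by
  have : ContMDiffVectorBundle 1 F E IB := ContMDiffVectorBundle.of_le (n := ∞) (by simp)
  let t := trivializationAt F E x
  let b := Module.finBasis ℝ F
  have ht : t.baseSet ∈ 𝓝 x := trivializationAt_baseSet_mem_nhds F E x
  choose s hs using fun i =>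
    exists_contMDiffSection_eventuallyEq ht (s := t.localFrame b i)
      (t.contMDiffOn_localFrame_baseSet (I := IB) ∞ b i)
  choose θ hθ hθt using fun i =>
    exists_contMDiff_linear_eventuallyEq ht
      (contMDiffOn_localFrameCoeff_totalSpace (IB := IB) b t i)
  refine ⟨s, θ, hθ, ?_⟩
  filter_upwards [ht, Filter.eventually_all.2 hs, Filter.eventually_all.2 hθt] with y hy hsy hθy
  simp only [hsy, hθy, t.localFrame_apply_of_mem_baseSet b hy,
    localFrameCoeff_apply_eq_repr_basisAt b t hy]
  refine ⟨fun a => (t.basisAt b hy).sum_repr a, fun i j => ?_⟩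
  rw [Module.Basis.repr_self, Finsupp.single_apply]
  simp only [eq_comm]

end Frames

section TotalSpace

variable [FiniteDimensional ℝ EB] [T2Space B] [IsManifold IB ∞ B] [IB.Boundaryless]

theorem tangentSpace_totalSpace_ext [ContMDiffVectorBundle ∞ F E IB] [FiniteDimensional ℝ F]
    {e : TotalSpace F E} {ξ η : TangentSpace (IB.prod 𝓘(ℝ, F)) e}
    (h₀ : ∀ f : C^∞⟮IB, B; ℝ⟯,
      dirDeriv (IB.prod 𝓘(ℝ, F)) (fun e' : TotalSpace F E => f e'.1) e ξ =
        dirDeriv (IB.prod 𝓘(ℝ, F)) (fun e' : TotalSpace F E => f e'.1) e η)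
    (h₁ : ∀ α : ∀ x, E x →ₗ[ℝ] ℝ,
      ContMDiff (IB.prod 𝓘(ℝ, F)) 𝓘(ℝ, ℝ) ∞ (fun e' : TotalSpace F E => α e'.1 e'.2) →
      dirDeriv (IB.prod 𝓘(ℝ, F)) (fun e' : TotalSpace F E => α e'.1 e'.2) e ξ =
        dirDeriv (IB.prod 𝓘(ℝ, F)) (fun e' : TotalSpace F E => α e'.1 e'.2) e η) :
    ξ = η := by
  obtain ⟨s, θ, hθ, h⟩ := exists_frame_dualFrame (IB := IB) (F := F) (E := E) e.1
  let coord : TotalSpace F E → Fin (Module.finrank ℝ F) → ℝ := fun e' i => θ i e'.1 e'.2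
  have hcoord : MDifferentiableAt (IB.prod 𝓘(ℝ, F)) 𝓘(ℝ, Fin (Module.finrank ℝ F) → ℝ) coord e :=
    (contMDiff_pi_space.2 hθ).mdifferentiableAt (by simp)
  have hproj : MDifferentiableAt (IB.prod 𝓘(ℝ, F)) IB (π F E) e :=
    (contMDiff_proj (n := ∞) E).mdifferentiableAt (by simp)
  refine mfderiv_injective_of_comp_eventuallyEq_id (hcoord.prodMk hproj)
    ((contMDiff_linearCombination s).mdifferentiableAt (by simp)) ?_ ?_
  · filter_upwards [(FiberBundle.continuous_proj F E).continuousAt.eventually h] with e' he'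
    exact congrArg (TotalSpace.mk e'.1) (he'.1 e'.2)
  · rw [mfderiv_prodMk hcoord hproj]
    refine Prod.ext (funext fun i => ?_)
      (tangentSpace_ext_dirDeriv (I := IB) (x := e.1) fun f => ?_)
    · let p : (Fin (Module.finrank ℝ F) → ℝ) →L[ℝ] ℝ := ContinuousLinearMap.proj i
      have hp (ζ : TangentSpace (IB.prod 𝓘(ℝ, F)) e) :=
        (dirDeriv_comp (q := p) p.mdifferentiableAt hcoord ζ).trans
          (dirDeriv_continuousLinearMap p (coord e) _)
      exact (hp ξ).symm.trans ((h₁ (θ i) (hθ i)).trans (hp η))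
    · have hf (ζ : TangentSpace (IB.prod 𝓘(ℝ, F)) e) :=
        dirDeriv_comp (f.contMDiff.mdifferentiableAt (x := e.1) (by simp)) hproj ζ
      exact (hf ξ).symm.trans ((h₀ f).trans (hf η))

end TotalSpace

end VectorBundle

/-! ### The tangent lift of a section -/

section Algebroid

variable {EM : Type*} [NormedAddCommGroup EM] [NormedSpace ℝ EM]
  {M : Type*} [TopologicalSpace M] [ChartedSpace EM M] [IsManifold 𝓘(ℝ, EM) ∞ M]
  {F : Type*} [NormedAddCommGroup F] [NormedSpace ℝ F]
  {E : M → Type*} [∀ x, AddCommGroup (E x)] [∀ x, Module ℝ (E x)]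
  [∀ x, TopologicalSpace (E x)] [TopologicalSpace (TotalSpace F E)]
  [FiberBundle F E] [VectorBundle ℝ F E]

namespace LieAlgebroid

section Sections

variable {A : LieAlgebroid EM M F E}

theorem contMDiff_sec (v : A.Sec) :
    ContMDiff 𝓘(ℝ, EM) (𝓘(ℝ, EM).prod 𝓘(ℝ, F)) ∞ (fun y => (⟨y, v y⟩ : TotalSpace F E)) :=
  ContMDiffSection.contMDiff (V := E) v

theorem mdifferentiableAt_sec (v : A.Sec) (x : M) :
    MDifferentiableAt 𝓘(ℝ, EM) (𝓘(ℝ, EM).prod 𝓘(ℝ, F))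
      (fun y => (⟨y, v y⟩ : TotalSpace F E)) x :=
  (contMDiff_sec v).mdifferentiableAt (by simp)

theorem Sec.ext {u v : A.Sec} (h : ∀ x, u x = v x) : u = v :=
  ContMDiffSection.ext (V := E) h

theorem Sec.add_apply (u v : A.Sec) (x : M) : (u + v) x = u x + v x := rfl

theorem Sec.smul_apply (c : ℝ) (u : A.Sec) (x : M) : (c • u) x = c • u x := rfl

theorem Sec.sub_apply (u v : A.Sec) (x : M) : (u - v) x = u x - v x := rfl

theorem Sec.zero_apply (x : M) : (0 : A.Sec) x = 0 := rfl

theorem Sec.sum_apply {ι : Type*} (t : Finset ι) (u : ι → A.Sec) (x : M) :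
    (∑ i ∈ t, u i) x = ∑ i ∈ t, u i x :=
  map_sum (⟨⟨fun u => u x, rfl⟩, fun _ _ => rfl⟩ : A.Sec →+ E x) u t

/-- The product of a smooth function and a section of a Lie algebroid, as an element of the Lie
algebra of sections. -/
def fsmul (f : C^∞⟮𝓘(ℝ, EM), M; ℝ⟯) (v : A.Sec) : A.Sec := functionSmul f v

theorem fsmul_apply (f : C^∞⟮𝓘(ℝ, EM), M; ℝ⟯) (v : A.Sec) (x : M) :
    fsmul f v x = f x • v x := rfl

theorem lie_fsmul (u v : A.Sec) (f : C^∞⟮𝓘(ℝ, EM), M; ℝ⟯) (x : M) :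
    ⁅u, fsmul f v⁆ x =
      f x • ⁅u, v⁆ x + dirDeriv 𝓘(ℝ, EM) f x (A.anchor x (u x)) • v x :=
  A.leibniz u v f x

theorem contMDiff_anchor_sec (u : A.Sec) : ContMDiff 𝓘(ℝ, EM) 𝓘(ℝ, EM).tangent ∞
    (fun y => (⟨y, A.anchor y (u y)⟩ : TangentBundle 𝓘(ℝ, EM) M)) :=
  A.contMDiff_anchor.comp (contMDiff_sec u)

/-- The derivation `f ↦ ρ(u) f` of the smooth functions on the base. -/
def anchorDeriv (u : A.Sec) (f : C^∞⟮𝓘(ℝ, EM), M; ℝ⟯) : C^∞⟮𝓘(ℝ, EM), M; ℝ⟯ :=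
  ⟨fun y => dirDeriv 𝓘(ℝ, EM) f y (A.anchor y (u y)),
    contMDiff_dirDeriv f.contMDiff (contMDiff_anchor_sec u)⟩

theorem anchorDeriv_apply (u : A.Sec) (f : C^∞⟮𝓘(ℝ, EM), M; ℝ⟯) (x : M) :
    anchorDeriv u f x = dirDeriv 𝓘(ℝ, EM) f x (A.anchor x (u x)) := rfl

theorem anchorDeriv_lie [CompleteSpace EM] (u v : A.Sec) (f : C^∞⟮𝓘(ℝ, EM), M; ℝ⟯) (x : M) :
    anchorDeriv ⁅u, v⁆ f x =
      anchorDeriv u (anchorDeriv v f) x - anchorDeriv v (anchorDeriv u f) x := by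
  rw [anchorDeriv_apply]
  exact (congrArg _ (A.anchor_bracket u v x)).trans
    (dirDeriv_mlieBracket (f.contMDiff.of_le (by norm_cast))
      ((contMDiff_anchor_sec u).mdifferentiableAt (by simp))
      ((contMDiff_anchor_sec v).mdifferentiableAt (by simp)))

end Sections

section OneForms

variable {A : LieAlgebroid EM M F E} {α : ∀ x, E x →ₗ[ℝ] ℝ}

/-- The contraction `α(v)` of a one-form with a section, as a smooth function on the base. -/
def pairing (hα : IsOneForm (EM := EM) (F := F) α) (v : A.Sec) : C^∞⟮𝓘(ℝ, EM), M; ℝ⟯ :=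
  ⟨fun y => α y (v y), ContMDiff.comp (g := fun e : TotalSpace F E => α e.1 e.2) hα
    (contMDiff_sec v)⟩

theorem mdifferentiableAt_pairing (hα : IsOneForm (EM := EM) (F := F) α) (v : A.Sec) (x : M) :
    MDifferentiableAt 𝓘(ℝ, EM) 𝓘(ℝ, ℝ) (fun y => α y (v y)) x :=
  (pairing hα v).contMDiff.mdifferentiableAt (by simp)

omit [IsManifold 𝓘(ℝ, EM) ∞ M] [VectorBundle ℝ F E] in
theorem IsOneForm.mdifferentiableAt (hα : IsOneForm (EM := EM) (F := F) α) (e : TotalSpace F E) :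
    MDifferentiableAt (𝓘(ℝ, EM).prod 𝓘(ℝ, F)) 𝓘(ℝ, ℝ)
      (fun e : TotalSpace F E => α e.1 e.2) e :=
  ContMDiff.mdifferentiableAt (n := ∞) hα (by simp)

variable [FiniteDimensional ℝ EM] [T2Space M]

theorem lie_congr {u v w : A.Sec} {x : M} (h : ∀ᶠ y in 𝓝 x, v y = w y) :
    ⁅u, v⁆ x = ⁅u, w⁆ x := by
  obtain ⟨χ, hχ, -⟩ := (SmoothBumpFunction.nhds_basis_support (I := 𝓘(ℝ, EM)) h).mem_iff.1 h
  let χ' : C^∞⟮𝓘(ℝ, EM), M; ℝ⟯ := ⟨χ, χ.contMDiff⟩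
  have hzero : fsmul χ' (v - w) = 0 := by
    refine Sec.ext fun y => ?_
    rw [fsmul_apply, Sec.sub_apply, Sec.zero_apply]
    by_cases hy : y ∈ tsupport χ
    · rw [show v y = w y from hχ hy, sub_self, smul_zero]
    · rw [show χ' y = 0 from image_eq_zero_of_notMem_tsupport hy, zero_smul]
  have hleibniz := lie_fsmul u (v - w) χ' x
  have hvw : (v - w) x = 0 := by rw [Sec.sub_apply, h.self_of_nhds, sub_self]
  rw [hzero, lie_zero, show χ' x = 1 from χ.eq_one, hvw, smul_zero, one_smul, add_zero, lie_sub,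
    Sec.sub_apply, Sec.zero_apply] at hleibniz
  exact (sub_eq_zero.1 hleibniz.symm)

theorem lie_eq_sum {n : ℕ} {s : Fin n → A.Sec} {θ : Fin n → ∀ y, E y →ₗ[ℝ] ℝ}
    (hθ : ∀ i, IsOneForm (EM := EM) (F := F) (θ i)) {x : M} (u w : A.Sec)
    (h : ∀ᶠ y in 𝓝 x, ∀ a : E y, ∑ i, θ i y a • s i y = a) :
    ⁅u, w⁆ x = ∑ i, (θ i x (w x) • ⁅u, s i⁆ x +
      dirDeriv 𝓘(ℝ, EM) (fun y => θ i y (w y)) x (A.anchor x (u x)) • s i x) := by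
  have hexpand : ⁅u, w⁆ x = ⁅u, ∑ i, fsmul (pairing (hθ i) w) (s i)⁆ x := by
    refine lie_congr ?_
    filter_upwards [h] with y hy
    rw [Sec.sum_apply]
    exact (hy (w y)).symm
  rw [hexpand, lie_sum, Sec.sum_apply]
  exact Finset.sum_congr rfl fun i _ => lie_fsmul u (s i) (pairing (hθ i) w) x

variable [FiniteDimensional ℝ F] [ContMDiffVectorBundle ∞ F E 𝓘(ℝ, EM)]

theorem exists_frame_sec (A : LieAlgebroid EM M F E) (x : M) :
    ∃ (s : Fin (Module.finrank ℝ F) → A.Sec)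
      (θ : Fin (Module.finrank ℝ F) → ∀ y, E y →ₗ[ℝ] ℝ),
      (∀ i, IsOneForm (EM := EM) (F := F) (θ i)) ∧
      ∀ᶠ y in 𝓝 x, ∀ a : E y, ∑ i, θ i y a • s i y = a := by
  obtain ⟨s, θ, hθ, h⟩ := exists_frame_dualFrame (IB := 𝓘(ℝ, EM)) (F := F) (E := E) x
  exact ⟨s, θ, hθ, h.mono fun y hy => hy.1⟩

theorem oneForm_lie_of_eq_zero (hα : IsOneForm (EM := EM) (F := F) α)
    (u : A.Sec) {w : A.Sec} {x : M} (hw : w x = 0) :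
    α x (⁅u, w⁆ x) = dirDeriv 𝓘(ℝ, EM) (fun y => α y (w y)) x (A.anchor x (u x)) := by
  obtain ⟨s, θ, hθ, hframe⟩ := A.exists_frame_sec x
  have hexpand : (fun y => α y (w y)) =ᶠ[𝓝 x] fun y => ∑ i, θ i y (w y) * α y (s i y) := by
    filter_upwards [hframe] with y hy
    conv_lhs => rw [← hy (w y)]
    simp only [map_sum, map_smul, smul_eq_mul]
  rw [lie_eq_sum hθ u w hframe, dirDeriv_congr hexpand,
    dirDeriv_sum (f := fun i y => θ i y (w y) * α y (s i y)) fun i _ =>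
      (mdifferentiableAt_pairing (hθ i) w x).mul (mdifferentiableAt_pairing hα (s i) x), map_sum]
  refine Finset.sum_congr rfl fun i _ => ?_
  rw [dirDeriv_mul (mdifferentiableAt_pairing (hθ i) w x) (mdifferentiableAt_pairing hα (s i) x)]
  simp [hw, mul_comm]

theorem dirDeriv_sub_oneForm_lie_congr (hα : IsOneForm (EM := EM) (F := F) α) (u : A.Sec)
    {v w : A.Sec} {x : M} (h : v x = w x) :
    dirDeriv 𝓘(ℝ, EM) (fun y => α y (v y)) x (A.anchor x (u x)) - α x (⁅u, v⁆ x) =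
      dirDeriv 𝓘(ℝ, EM) (fun y => α y (w y)) x (A.anchor x (u x)) - α x (⁅u, w⁆ x) := by
  have hsub := oneForm_lie_of_eq_zero hα u (w := v - w) (x := x)
    (by rw [Sec.sub_apply, h, sub_self])
  simp only [lie_sub, Sec.sub_apply, map_sub] at hsub
  rw [dirDeriv_sub (mdifferentiableAt_pairing hα v x) (mdifferentiableAt_pairing hα w x)] at hsub
  linarith

end OneForms

omit [IsManifold 𝓘(ℝ, EM) ∞ M] in
theorem dirDeriv_verticalLift {q : TotalSpace F E → ℝ} {e : TotalSpace F E}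
    (hq : MDifferentiableAt (𝓘(ℝ, EM).prod 𝓘(ℝ, F)) 𝓘(ℝ, ℝ) q e) (w : E e.1) :
    dirDeriv (𝓘(ℝ, EM).prod 𝓘(ℝ, F)) q e (verticalLift e w) =
      deriv (fun s : ℝ => q ⟨e.1, e.2 + s • w⟩) 0 := by
  have hzero : (⟨e.1, e.2 + (0 : ℝ) • w⟩ : TotalSpace F E) = e := by simp
  rw [(hasDerivAt_comp_curve (q := q) (c := fun s : ℝ => (⟨e.1, e.2 + s • w⟩ : TotalSpace F E))
    (t := 0) (by rwa [hzero])
    ((contMDiff_fiber_add_smul (n := 1) _ e.2 w).mdifferentiableAt one_ne_zero)).deriv]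
  -- The two sides live in the tangent spaces at `e + 0 w` and at `e`, both of which are `EM × F`.
  let D : TotalSpace F E → EM × F → ℝ := fun e ξ => dirDeriv (𝓘(ℝ, EM).prod 𝓘(ℝ, F)) q e ξ
  exact congrArg (fun e => D e (mfderiv 𝓘(ℝ, ℝ) (𝓘(ℝ, EM).prod 𝓘(ℝ, F))
    (fun s : ℝ => (⟨_, _ + s • w⟩ : TotalSpace F E)) 0 (1 : ℝ))) hzero.symm

section TangentLift

variable {A : LieAlgebroid EM M F E}

theorem dirDeriv_mfderiv_sub_verticalLift {q : TotalSpace F E → ℝ} {x : M} (u v : A.Sec)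
    (hq : MDifferentiableAt (𝓘(ℝ, EM).prod 𝓘(ℝ, F)) 𝓘(ℝ, ℝ) q ⟨x, v x⟩) :
    dirDeriv (𝓘(ℝ, EM).prod 𝓘(ℝ, F)) q ⟨x, v x⟩
      (mfderiv 𝓘(ℝ, EM) (𝓘(ℝ, EM).prod 𝓘(ℝ, F)) (fun y => (⟨y, v y⟩ : TotalSpace F E)) x
        (A.anchor x (u x)) - verticalLift (⟨x, v x⟩ : TotalSpace F E) (⁅u, v⁆ x)) =
    dirDeriv 𝓘(ℝ, EM) (fun y => q ⟨y, v y⟩) x (A.anchor x (u x))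
      - deriv (fun s : ℝ => q ⟨x, v x + s • ⁅u, v⁆ x⟩) 0 := by
  rw [dirDeriv_apply_sub, dirDeriv_verticalLift hq,
    dirDeriv_comp (F := fun y => (⟨y, v y⟩ : TotalSpace F E)) hq (mdifferentiableAt_sec v x)]

variable [FiniteDimensional ℝ EM] [T2Space M] [SigmaCompactSpace M]
  [ContMDiffVectorBundle ∞ F E 𝓘(ℝ, EM)]

theorem exists_sec (A : LieAlgebroid EM M F E) (e : TotalSpace F E) :
    ∃ v : A.Sec, v e.1 = e.2 :=
  exists_section_through e

theorem exists_lieDeriv_eq {q : TotalSpace F E → ℝ} {e : TotalSpace F E} (u : A.Sec)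
    (hq : MDifferentiableAt (𝓘(ℝ, EM).prod 𝓘(ℝ, F)) 𝓘(ℝ, ℝ) q e) :
    ∃ v : A.Sec, v e.1 = e.2 ∧ A.lieDeriv u q e =
      dirDeriv 𝓘(ℝ, EM) (fun y => q ⟨y, v y⟩) e.1 (A.anchor e.1 (u e.1))
        - deriv (fun s : ℝ => q ⟨e.1, e.2 + s • ⁅u, v⁆ e.1⟩) 0 := by
  obtain ⟨v, hv, hve⟩ : ∃ v : A.Sec, v = (sectionThrough e : A.Sec) ∧ v e.1 = e.2 :=
    ⟨_, rfl, (exists_section_through e).choose_spec⟩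
  have he : (⟨e.1, v e.1⟩ : TotalSpace F E) = e := by rw [hve]
  have h := dirDeriv_mfderiv_sub_verticalLift (x := e.1) (q := q) u v (by rwa [he])
  rw [hve] at h
  subst hv
  exact ⟨_, hve, h⟩

theorem lieDeriv_comp_proj (u : A.Sec) (f : C^∞⟮𝓘(ℝ, EM), M; ℝ⟯) (e : TotalSpace F E) :
    A.lieDeriv u (fun e' : TotalSpace F E => f e'.1) e = anchorDeriv u f e.1 := by
  obtain ⟨v, -, h⟩ := exists_lieDeriv_eq u (mdifferentiableAt_comp_proj f e)
  simp only [h, deriv_const', sub_zero]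
  rfl

variable [FiniteDimensional ℝ F]

theorem lieDeriv_oneForm {α : ∀ x, E x →ₗ[ℝ] ℝ} (hα : IsOneForm (EM := EM) (F := F) α)
    (u v : A.Sec) (x : M) :
    A.lieDeriv u (fun e : TotalSpace F E => α e.1 e.2) ⟨x, v x⟩ =
      anchorDeriv u (pairing hα v) x - α x (⁅u, v⁆ x) := by
  obtain ⟨w, hw, h⟩ := exists_lieDeriv_eq (e := ⟨x, v x⟩) u (hα.mdifferentiableAt _)
  rw [h]
  have hderiv : deriv (fun s : ℝ => α x (v x + s • ⁅u, w⁆ x)) 0 = α x (⁅u, w⁆ x) := by simp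
  exact (congrArg _ hderiv).trans (dirDeriv_sub_oneForm_lie_congr hα u hw)

theorem tangentLift_eq (u v : A.Sec) (x : M) : A.tangentLift u ⟨x, v x⟩ =
    mfderiv 𝓘(ℝ, EM) (𝓘(ℝ, EM).prod 𝓘(ℝ, F)) (fun y => (⟨y, v y⟩ : TotalSpace F E)) x
      (A.anchor x (u x)) - verticalLift (⟨x, v x⟩ : TotalSpace F E) (⁅u, v⁆ x) := by
  refine tangentSpace_totalSpace_ext (fun f => ?_) fun α hα => ?_
  · rw [dirDeriv_mfderiv_sub_verticalLift u v (mdifferentiableAt_comp_proj f _)]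
    simp only [deriv_const', sub_zero]
    exact lieDeriv_comp_proj u f ⟨x, v x⟩
  · rw [dirDeriv_mfderiv_sub_verticalLift u v (IsOneForm.mdifferentiableAt hα _)]
    have hderiv : deriv (fun s : ℝ => α x (v x + s • ⁅u, v⁆ x)) 0 = α x (⁅u, v⁆ x) := by simp
    exact (lieDeriv_oneForm hα u v x).trans (congrArg _ hderiv.symm)

end TangentLift

end LieAlgebroid

end Algebroid

/-! ### The Lie derivative as a homomorphism into derivations -/

section Algebroid

variable {EM : Type*} [NormedAddCommGroup EM] [NormedSpace ℝ EM] [FiniteDimensional ℝ EM]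
  {M : Type*} [TopologicalSpace M] [ChartedSpace EM M] [IsManifold 𝓘(ℝ, EM) ∞ M]
  [T2Space M] [SigmaCompactSpace M]
  {F : Type*} [NormedAddCommGroup F] [NormedSpace ℝ F] [FiniteDimensional ℝ F]
  {E : M → Type*} [∀ x, AddCommGroup (E x)] [∀ x, Module ℝ (E x)]
  [∀ x, TopologicalSpace (E x)] [TopologicalSpace (TotalSpace F E)]
  [FiberBundle F E] [VectorBundle ℝ F E] [ContMDiffVectorBundle ∞ F E 𝓘(ℝ, EM)]
  {A : LieAlgebroid EM M F E}

namespace LieAlgebroid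

theorem lieDeriv_oneForm_add {α : ∀ x, E x →ₗ[ℝ] ℝ} (hα : IsOneForm (EM := EM) (F := F) α)
    (u : A.Sec) (x : M) (a b : E x) :
    A.lieDeriv u (fun e : TotalSpace F E => α e.1 e.2) ⟨x, a + b⟩ =
      A.lieDeriv u (fun e : TotalSpace F E => α e.1 e.2) ⟨x, a⟩ +
      A.lieDeriv u (fun e : TotalSpace F E => α e.1 e.2) ⟨x, b⟩ := by
  obtain ⟨v, rfl⟩ : ∃ v : A.Sec, v x = a := A.exists_sec ⟨x, a⟩
  obtain ⟨w, rfl⟩ : ∃ w : A.Sec, w x = b := A.exists_sec ⟨x, b⟩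
  rw [← Sec.add_apply, lieDeriv_oneForm hα, lieDeriv_oneForm hα, lieDeriv_oneForm hα, lie_add,
    Sec.add_apply, map_add, anchorDeriv_apply, anchorDeriv_apply, anchorDeriv_apply]
  have h : ⇑(pairing hα (v + w)) = fun y => pairing hα v y + pairing hα w y := by
    ext y
    exact map_add (α y) _ _
  rw [h, dirDeriv_add ((pairing hα v).contMDiff.mdifferentiableAt (by simp))
    ((pairing hα w).contMDiff.mdifferentiableAt (by simp))]
  ring

theorem lieDeriv_oneForm_smul {α : ∀ x, E x →ₗ[ℝ] ℝ} (hα : IsOneForm (EM := EM) (F := F) α)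
    (u : A.Sec) (x : M) (c : ℝ) (a : E x) :
    A.lieDeriv u (fun e : TotalSpace F E => α e.1 e.2) ⟨x, c • a⟩ =
      c * A.lieDeriv u (fun e : TotalSpace F E => α e.1 e.2) ⟨x, a⟩ := by
  obtain ⟨v, rfl⟩ : ∃ v : A.Sec, v x = a := A.exists_sec ⟨x, a⟩
  rw [← Sec.smul_apply, lieDeriv_oneForm hα, lieDeriv_oneForm hα, lie_smul,
    Sec.smul_apply, map_smul, anchorDeriv_apply, anchorDeriv_apply]
  have h : ⇑(pairing hα (c • v)) = fun y => c * pairing hα v y := by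
    ext y
    exact map_smul (α y) _ _
  rw [h, dirDeriv_const_mul ((pairing hα v).contMDiff.mdifferentiableAt (by simp)), smul_eq_mul]
  ring

/-- The Lie derivative `𝓛_u α` of a one-form, again a one-form: its value at `a` is the derivative
of the function `α` on the total space along `d_T(u)`. -/
def lieOneForm (u : A.Sec) {α : ∀ x, E x →ₗ[ℝ] ℝ} (hα : IsOneForm (EM := EM) (F := F) α) (x : M) :
    E x →ₗ[ℝ] ℝ where
  toFun a := A.lieDeriv u (fun e : TotalSpace F E => α e.1 e.2) ⟨x, a⟩
  map_add' := lieDeriv_oneForm_add hα u x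
  map_smul' c a := lieDeriv_oneForm_smul hα u x c a

theorem lieOneForm_sec (u v : A.Sec) {α : ∀ x, E x →ₗ[ℝ] ℝ}
    (hα : IsOneForm (EM := EM) (F := F) α) (x : M) :
    lieOneForm u hα x (v x) = anchorDeriv u (pairing hα v) x - α x (⁅u, v⁆ x) :=
  lieDeriv_oneForm hα u v x

theorem tangentLift_linearCombination {n : ℕ} {s : Fin n → A.Sec} {x : M}
    {θ : Fin n → E x →ₗ[ℝ] ℝ} (h : ∀ a : E x, ∑ i, θ i a • s i x = a) (u : A.Sec)
    (c : Fin n → ℝ) :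
    A.tangentLift u ⟨x, ∑ i, c i • s i x⟩ =
      mfderiv (𝓘(ℝ, Fin n → ℝ).prod 𝓘(ℝ, EM)) (𝓘(ℝ, EM).prod 𝓘(ℝ, F))
        (fun r : (Fin n → ℝ) × M => (⟨r.2, ∑ i, r.1 i • s i r.2⟩ : TotalSpace F E)) (c, x)
        ((fun j => -∑ i, c i * θ j (⁅u, s i⁆ x)), A.anchor x (u x)) := by
  have hK : MDifferentiableAt (𝓘(ℝ, Fin n → ℝ).prod 𝓘(ℝ, EM)) (𝓘(ℝ, EM).prod 𝓘(ℝ, F))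
      (fun r : (Fin n → ℝ) × M => (⟨r.2, ∑ i, r.1 i • s i r.2⟩ : TotalSpace F E)) (c, x) :=
    (contMDiff_linearCombination s).mdifferentiableAt (by simp)
  refine tangentSpace_totalSpace_ext (fun f => ?_) fun α hα => ?_
  · refine Eq.trans ?_ (dirDeriv_comp (mdifferentiableAt_comp_proj f _) hK _)
    refine (lieDeriv_comp_proj u f _).trans (Eq.trans ?_ (dirDeriv_comp
      (f.contMDiff.mdifferentiableAt (by simp)) mdifferentiableAt_snd _).symm)
    rw [mfderiv_snd]
    rfl
  · refine Eq.trans ?_ (dirDeriv_comp (IsOneForm.mdifferentiableAt hα _) hK _)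
    have hlie : ∑ j, α x (s j x) * -∑ i, c i * θ j (⁅u, s i⁆ x) =
        -∑ i, c i * α x (⁅u, s i⁆ x) := by
      have hα_lie (i : Fin n) : α x (⁅u, s i⁆ x) = ∑ j, θ j (⁅u, s i⁆ x) * α x (s j x) := by
        conv_lhs => rw [← h (⁅u, s i⁆ x)]
        simp only [map_sum, map_smul, smul_eq_mul]
      simp only [hα_lie, mul_neg, Finset.mul_sum, Finset.sum_neg_distrib]
      rw [Finset.sum_comm]
      simp only [mul_left_comm, mul_comm]
    calc lieOneForm u hα x (∑ i, c i • s i x)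
        = ∑ i, (c i * anchorDeriv u (pairing hα (s i)) x +
            α x (s i x) * -∑ k, c k * θ i (⁅u, s k⁆ x)) := by
          rw [Finset.sum_add_distrib, hlie, ← sub_eq_add_neg, ← Finset.sum_sub_distrib, map_sum]
          refine Finset.sum_congr rfl fun i _ => ?_
          rw [map_smul, smul_eq_mul, ← mul_sub]
          exact congrArg _ (lieOneForm_sec u (s i) hα x)
      _ = dirDeriv _ (fun r : (Fin n → ℝ) × M => ∑ i, r.1 i * α r.2 (s i r.2)) (c, x) _ :=
          (dirDeriv_sum_mul (fun i => mdifferentiableAt_pairing hα (s i) x) _).symm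
      _ = _ := by simp only [map_sum, map_smul, smul_eq_mul]

theorem contMDiff_tangentLift (u : A.Sec) :
    ContMDiff (𝓘(ℝ, EM).prod 𝓘(ℝ, F)) (𝓘(ℝ, EM).prod 𝓘(ℝ, F)).tangent ∞
      (fun e : TotalSpace F E =>
        (⟨e, A.tangentLift u e⟩ : TangentBundle (𝓘(ℝ, EM).prod 𝓘(ℝ, F)) (TotalSpace F E))) := by
  intro e₀
  obtain ⟨s, θ, hθ, h⟩ := A.exists_frame_sec e₀.1
  have hK : ContMDiff (𝓘(ℝ, Fin (Module.finrank ℝ F) → ℝ).prod 𝓘(ℝ, EM)).tangent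
      (𝓘(ℝ, EM).prod 𝓘(ℝ, F)).tangent ∞ _ :=
    (contMDiff_linearCombination (IB := 𝓘(ℝ, EM)) (F := F) (E := E) s).contMDiff_tangentMap
      (m := ∞) (by simp)
  have hcoeff : ContMDiff (𝓘(ℝ, EM).prod 𝓘(ℝ, F)) 𝓘(ℝ, Fin (Module.finrank ℝ F) → ℝ) ∞
      (fun (e : TotalSpace F E) j => -∑ i, θ i e.1 e.2 * θ j e.1 (⁅u, s i⁆ e.1)) :=
    contMDiff_pi_space.2 fun j => ContMDiff.neg <| contMDiff_finsetSum fun i _ =>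
      ContMDiff.mul (hθ i) ((pairing (hθ j) ⁅u, s i⁆).contMDiff.comp (contMDiff_proj E))
  have hvert : ContMDiff (𝓘(ℝ, EM).prod 𝓘(ℝ, F)) 𝓘(ℝ, Fin (Module.finrank ℝ F) → ℝ).tangent ∞
      (fun e : TotalSpace F E => (⟨fun i => θ i e.1 e.2,
        fun j => -∑ i, θ i e.1 e.2 * θ j e.1 (⁅u, s i⁆ e.1)⟩ :
        TangentBundle 𝓘(ℝ, Fin (Module.finrank ℝ F) → ℝ) (Fin (Module.finrank ℝ F) → ℝ))) :=
    contMDiff_tangentBundle_mk (contMDiff_pi_space.2 hθ) hcoeff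
  have hhor : ContMDiff (𝓘(ℝ, EM).prod 𝓘(ℝ, F)) 𝓘(ℝ, EM).tangent ∞
      (fun e : TotalSpace F E => (⟨e.1, A.anchor e.1 (u e.1)⟩ : TangentBundle 𝓘(ℝ, EM) M)) :=
    (contMDiff_anchor_sec u).comp (contMDiff_proj E)
  refine (hK.contMDiffAt.comp e₀ (contMDiffAt_tangentBundle_prodMk (hvert e₀) (hhor e₀))
    ).congr_of_eventuallyEq ?_
  filter_upwards [(FiberBundle.continuous_proj F E).continuousAt.eventually h] with e he
  have hlift := tangentLift_linearCombination he u fun i => θ i e.1 e.2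
  rw [he e.2] at hlift
  let T : TotalSpace F E → EM × F → TangentBundle (𝓘(ℝ, EM).prod 𝓘(ℝ, F)) (TotalSpace F E) :=
    fun e ξ => ⟨e, ξ⟩
  exact (congrArg (T e) hlift).trans
    (congrArg (fun e' => T e' _) (congrArg (TotalSpace.mk e.1) (he e.2)).symm)

theorem contMDiff_lieDeriv (u : A.Sec) {q : TotalSpace F E → ℝ}
    (hq : ContMDiff (𝓘(ℝ, EM).prod 𝓘(ℝ, F)) 𝓘(ℝ, ℝ) ∞ q) :
    ContMDiff (𝓘(ℝ, EM).prod 𝓘(ℝ, F)) 𝓘(ℝ, ℝ) ∞ (A.lieDeriv u q) :=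
  contMDiff_dirDeriv hq (contMDiff_tangentLift u)

theorem isOneForm_lieOneForm (u : A.Sec) {α : ∀ x, E x →ₗ[ℝ] ℝ}
    (hα : IsOneForm (EM := EM) (F := F) α) :
    IsOneForm (EM := EM) (F := F) (lieOneForm u hα) :=
  contMDiff_lieDeriv u (q := fun e : TotalSpace F E => α e.1 e.2) hα

theorem lieDeriv_lieDeriv_oneForm {α : ∀ x, E x →ₗ[ℝ] ℝ}
    (hα : IsOneForm (EM := EM) (F := F) α) (u v w : A.Sec) (x : M) :
    A.lieDeriv u (A.lieDeriv v (fun e : TotalSpace F E => α e.1 e.2)) ⟨x, w x⟩ =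
      anchorDeriv u (anchorDeriv v (pairing hα w)) x - anchorDeriv u (pairing hα ⁅v, w⁆) x
        - anchorDeriv v (pairing hα ⁅u, w⁆) x + α x (⁅v, ⁅u, w⁆⁆ x) := by
  have hpairing : ⇑(pairing (isOneForm_lieOneForm v hα) w) = fun y =>
      anchorDeriv v (pairing hα w) y - pairing hα ⁅v, w⁆ y :=
    funext fun y => lieOneForm_sec v w hα y
  refine (lieDeriv_oneForm (isOneForm_lieOneForm v hα) u w x).trans ?_
  rw [lieOneForm_sec, anchorDeriv_apply u (pairing (isOneForm_lieOneForm v hα) w), hpairing,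
    dirDeriv_sub ((anchorDeriv v (pairing hα w)).contMDiff.mdifferentiableAt (by simp))
      ((pairing hα ⁅v, w⁆).contMDiff.mdifferentiableAt (by simp)), ← anchorDeriv_apply,
    ← anchorDeriv_apply]
  ring

theorem dirDeriv_mlieBracket_tangentLift (u v : A.Sec) {q : TotalSpace F E → ℝ}
    (hq : ContMDiff (𝓘(ℝ, EM).prod 𝓘(ℝ, F)) 𝓘(ℝ, ℝ) ∞ q) (e : TotalSpace F E) :
    dirDeriv (𝓘(ℝ, EM).prod 𝓘(ℝ, F)) q e
        (VectorField.mlieBracket (𝓘(ℝ, EM).prod 𝓘(ℝ, F)) (A.tangentLift u) (A.tangentLift v) e) =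
      A.lieDeriv u (A.lieDeriv v q) e - A.lieDeriv v (A.lieDeriv u q) e := by
  have : CompleteSpace EM := FiniteDimensional.complete ℝ EM
  have : CompleteSpace F := FiniteDimensional.complete ℝ F
  exact dirDeriv_mlieBracket (hq.of_le (by norm_cast))
    ((contMDiff_tangentLift u).mdifferentiableAt (by simp))
    ((contMDiff_tangentLift v).mdifferentiableAt (by simp))

theorem tangentLift_lie (u v : A.Sec) (e : TotalSpace F E) :
    A.tangentLift ⁅u, v⁆ e =
      VectorField.mlieBracket (𝓘(ℝ, EM).prod 𝓘(ℝ, F)) (A.tangentLift u) (A.tangentLift v) e := by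
  have : CompleteSpace EM := FiniteDimensional.complete ℝ EM
  refine tangentSpace_totalSpace_ext (fun f => ?_) fun α hα => ?_
  · have hproj (w : A.Sec) : A.lieDeriv w (fun e' : TotalSpace F E => f e'.1) =
        fun e' => anchorDeriv w f e'.1 := funext (lieDeriv_comp_proj w f)
    rw [dirDeriv_mlieBracket_tangentLift u v (q := fun e' : TotalSpace F E => f e'.1)
      (f.contMDiff.comp (contMDiff_proj E))]
    refine (lieDeriv_comp_proj ⁅u, v⁆ f e).trans ?_
    rw [anchorDeriv_lie, hproj, hproj, lieDeriv_comp_proj, lieDeriv_comp_proj]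
  · obtain ⟨x, a⟩ := e
    obtain ⟨w, rfl⟩ : ∃ w : A.Sec, w x = a := A.exists_sec ⟨x, a⟩
    rw [dirDeriv_mlieBracket_tangentLift u v (q := fun e : TotalSpace F E => α e.1 e.2) hα]
    refine (lieDeriv_oneForm hα ⁅u, v⁆ w x).trans ?_
    rw [lieDeriv_lieDeriv_oneForm hα, lieDeriv_lieDeriv_oneForm hα, anchorDeriv_lie,
      leibniz_lie u v w, Sec.add_apply, map_add]
    ring

theorem lieDeriv_lie (u v : A.Sec) {q : TotalSpace F E → ℝ}
    (hq : ContMDiff (𝓘(ℝ, EM).prod 𝓘(ℝ, F)) 𝓘(ℝ, ℝ) ∞ q) (e : TotalSpace F E) :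
    A.lieDeriv ⁅u, v⁆ q e = A.lieDeriv u (A.lieDeriv v q) e - A.lieDeriv v (A.lieDeriv u q) e :=
  (congrArg _ (tangentLift_lie u v e)).trans (dirDeriv_mlieBracket_tangentLift u v hq e)

theorem tangentLift_add (u v : A.Sec) (e : TotalSpace F E) :
    A.tangentLift (u + v) e = A.tangentLift u e + A.tangentLift v e := by
  refine tangentSpace_totalSpace_ext (fun f => ?_) fun α hα => ?_
  · rw [dirDeriv_apply_add]
    refine (lieDeriv_comp_proj (u + v) f e).trans
      (Eq.trans ?_ (congrArg₂ (· + ·) (lieDeriv_comp_proj u f e) (lieDeriv_comp_proj v f e)).symm)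
    rw [anchorDeriv_apply, Sec.add_apply, map_add, dirDeriv_apply_add]
    rfl
  · obtain ⟨x, a⟩ := e
    obtain ⟨w, rfl⟩ : ∃ w : A.Sec, w x = a := A.exists_sec ⟨x, a⟩
    rw [dirDeriv_apply_add]
    refine (lieDeriv_oneForm hα (u + v) w x).trans
      (Eq.trans ?_ (congrArg₂ (· + ·) (lieDeriv_oneForm hα u w x)
        (lieDeriv_oneForm hα v w x)).symm)
    rw [anchorDeriv_apply, Sec.add_apply, map_add, dirDeriv_apply_add, add_lie, Sec.add_apply,
      map_add, ← anchorDeriv_apply, ← anchorDeriv_apply]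
    ring

theorem tangentLift_smul (c : ℝ) (u : A.Sec) (e : TotalSpace F E) :
    A.tangentLift (c • u) e = c • A.tangentLift u e := by
  refine tangentSpace_totalSpace_ext (fun f => ?_) fun α hα => ?_
  · rw [dirDeriv_apply_smul]
    refine (lieDeriv_comp_proj (c • u) f e).trans
      (Eq.trans ?_ (congrArg (c * ·) (lieDeriv_comp_proj u f e)).symm)
    rw [anchorDeriv_apply, Sec.smul_apply, map_smul, dirDeriv_apply_smul]
    rfl
  · obtain ⟨x, a⟩ := e
    obtain ⟨w, rfl⟩ : ∃ w : A.Sec, w x = a := A.exists_sec ⟨x, a⟩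
    rw [dirDeriv_apply_smul]
    refine (lieDeriv_oneForm hα (c • u) w x).trans
      (Eq.trans ?_ (congrArg (c * ·) (lieDeriv_oneForm hα u w x)).symm)
    rw [anchorDeriv_apply, Sec.smul_apply, map_smul, dirDeriv_apply_smul, smul_lie, Sec.smul_apply,
      map_smul, ← anchorDeriv_apply, smul_eq_mul]
    ring

/-- The tangent lift `d_T(u)` as a derivation `q ↦ 𝓛_u q` of the smooth functions on the total
space. -/
def lieDerivation (u : A.Sec) : Derivation ℝ C^∞⟮𝓘(ℝ, EM).prod 𝓘(ℝ, F), TotalSpace F E; ℝ⟯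
    C^∞⟮𝓘(ℝ, EM).prod 𝓘(ℝ, F), TotalSpace F E; ℝ⟯ :=
  Derivation.mk'
    { toFun := fun f => ⟨A.lieDeriv u f, contMDiff_lieDeriv u f.contMDiff⟩
      map_add' := fun f f' => ContMDiffMap.ext fun e =>
        dirDeriv_add (f.contMDiff.mdifferentiableAt (by simp))
          (f'.contMDiff.mdifferentiableAt (by simp)) _
      map_smul' := fun c f => ContMDiffMap.ext fun e =>
        dirDeriv_const_mul (f.contMDiff.mdifferentiableAt (by simp)) c _ }
    fun f f' => ContMDiffMap.ext fun e =>
      dirDeriv_mul (f.contMDiff.mdifferentiableAt (by simp))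
        (f'.contMDiff.mdifferentiableAt (by simp)) _

variable (A) in
/-- The homomorphism `u ↦ d_T(u)` into the Lie algebra of vector fields on the total space, the
latter being encoded as derivations of the smooth functions. -/
def lieHom : A.Sec →ₗ⁅ℝ⁆ Derivation ℝ C^∞⟮𝓘(ℝ, EM).prod 𝓘(ℝ, F), TotalSpace F E; ℝ⟯
    C^∞⟮𝓘(ℝ, EM).prod 𝓘(ℝ, F), TotalSpace F E; ℝ⟯ where
  toFun := lieDerivation
  map_add' u v := Derivation.ext fun f => ContMDiffMap.ext fun e => by
    change dirDeriv _ _ _ _ = dirDeriv _ _ _ _ + dirDeriv _ _ _ _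
    rw [tangentLift_add, dirDeriv_apply_add]
  map_smul' c u := Derivation.ext fun f => ContMDiffMap.ext fun e => by
    change dirDeriv _ _ _ _ = c * dirDeriv _ _ _ _
    rw [tangentLift_smul, dirDeriv_apply_smul]
  map_lie' {u v} := Derivation.ext fun f => ContMDiffMap.ext fun e => by
    rw [Derivation.commutator_apply]
    exact lieDeriv_lie u v f.contMDiff e

theorem lieHom_apply (u : A.Sec)
    (f : C^∞⟮𝓘(ℝ, EM).prod 𝓘(ℝ, F), TotalSpace F E; ℝ⟯) (e : TotalSpace F E) :
    A.lieHom u f e = A.lieDeriv u f e := rfl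

omit [FiniteDimensional ℝ EM] [IsManifold 𝓘(ℝ, EM) ∞ M] [T2Space M] [SigmaCompactSpace M]
  [FiniteDimensional ℝ F] [ContMDiffVectorBundle ∞ F E 𝓘(ℝ, EM)] in
theorem contMDiff_totalSpace_const_smul (c : ℝ) :
    ContMDiff (𝓘(ℝ, EM).prod 𝓘(ℝ, F)) (𝓘(ℝ, EM).prod 𝓘(ℝ, F)) ∞
      (fun e : TotalSpace F E => (⟨e.1, c • e.2⟩ : TotalSpace F E)) := fun _ =>
  contMDiffAt_totalSpace_smul (b := fun e : TotalSpace F E => e.1) (s := fun e => e.2)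
    contMDiffAt_const contMDiffAt_id

theorem tangentLift_const_smul (u : A.Sec) (c : ℝ) (e : TotalSpace F E) :
    A.tangentLift u (⟨e.1, c • e.2⟩ : TotalSpace F E) =
      mfderiv (𝓘(ℝ, EM).prod 𝓘(ℝ, F)) (𝓘(ℝ, EM).prod 𝓘(ℝ, F))
        (fun e : TotalSpace F E => (⟨e.1, c • e.2⟩ : TotalSpace F E)) e (A.tangentLift u e) := by
  have hm : MDifferentiableAt (𝓘(ℝ, EM).prod 𝓘(ℝ, F)) (𝓘(ℝ, EM).prod 𝓘(ℝ, F))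
      (fun e : TotalSpace F E => (⟨e.1, c • e.2⟩ : TotalSpace F E)) e :=
    (contMDiff_totalSpace_const_smul c).mdifferentiableAt (by simp)
  refine tangentSpace_totalSpace_ext (fun f => ?_) fun α hα => ?_
  · rw [← dirDeriv_comp (mdifferentiableAt_comp_proj f _) hm]
    exact (lieDeriv_comp_proj u f _).trans (lieDeriv_comp_proj u f e).symm
  · rw [← dirDeriv_comp (IsOneForm.mdifferentiableAt hα _) hm]
    simp only [map_smul, smul_eq_mul]
    rw [dirDeriv_const_mul (IsOneForm.mdifferentiableAt hα e)]
    exact map_smul (lieOneForm u hα e.1) c e.2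

end LieAlgebroid

end Algebroid

section RiemannianMetric

variable {EB HB B : Type*} [NormedAddCommGroup EB] [NormedSpace ℝ EB] [TopologicalSpace HB]
  {IB : ModelWithCorners ℝ EB HB} [TopologicalSpace B] [ChartedSpace HB B]
  {F : Type*} [NormedAddCommGroup F] [NormedSpace ℝ F]
  {E : B → Type*} [∀ x, AddCommGroup (E x)] [∀ x, Module ℝ (E x)]
  [∀ x, TopologicalSpace (E x)] [∀ x, IsTopologicalAddGroup (E x)]
  [∀ x, ContinuousConstSMul ℝ (E x)] [TopologicalSpace (TotalSpace F E)]
  [FiberBundle F E] [VectorBundle ℝ F E] {n : ℕ∞ω}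

omit [∀ x, IsTopologicalAddGroup (E x)] [∀ x, ContinuousConstSMul ℝ (E x)] in
theorem contMDiffAt_riemannianMetric_inner (G : ContMDiffRiemannianMetric IB n F E)
    {V H Q : Type*} [NormedAddCommGroup V] [NormedSpace ℝ V] [TopologicalSpace H]
    {I : ModelWithCorners ℝ V H} [TopologicalSpace Q] [ChartedSpace H Q]
    {b : Q → B} {v w : ∀ q, E (b q)} {q : Q}
    (hv : ContMDiffAt I (IB.prod 𝓘(ℝ, F)) n (fun q => (⟨b q, v q⟩ : TotalSpace F E)) q)
    (hw : ContMDiffAt I (IB.prod 𝓘(ℝ, F)) n (fun q => (⟨b q, w q⟩ : TotalSpace F E)) q) :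
    ContMDiffAt I 𝓘(ℝ, ℝ) n (fun q => G.inner (b q) (v q) (w q)) q := by
  have hb : ContMDiffAt I IB n b q := (contMDiffAt_totalSpace.1 hv).1
  have hinner := ContMDiffAt.clm_bundle_apply₂ (F₁ := F) (F₂ := F) (F₃ := ℝ)
    (E₃ := Bundle.Trivial B ℝ) (G.contMDiff.contMDiffAt.comp q hb) hv hw
  simpa using (contMDiffAt_totalSpace.1 hinner).2

end RiemannianMetric

/-! ### Killing sections and central sections -/

section Algebroid

variable {EM : Type*} [NormedAddCommGroup EM] [NormedSpace ℝ EM]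
  {M : Type*} [TopologicalSpace M] [ChartedSpace EM M]
  {F : Type*} [NormedAddCommGroup F] [NormedSpace ℝ F]
  {E : M → Type*} [∀ x, AddCommGroup (E x)] [∀ x, Module ℝ (E x)]
  [∀ x, TopologicalSpace (E x)] [TopologicalSpace (TotalSpace F E)]
  [FiberBundle F E] [VectorBundle ℝ F E]

section Metric

variable [∀ x, IsTopologicalAddGroup (E x)] [∀ x, ContinuousConstSMul ℝ (E x)]
  (G : ContMDiffRiemannianMetric 𝓘(ℝ, EM) ∞ F E)

theorem contMDiff_metricFunction :
    ContMDiff (𝓘(ℝ, EM).prod 𝓘(ℝ, F)) 𝓘(ℝ, ℝ) ∞ (metricFunction G) := fun _ =>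
  contMDiffAt_riemannianMetric_inner G (b := fun e : TotalSpace F E => e.1) (v := fun e => e.2)
    (w := fun e => e.2) contMDiffAt_id contMDiffAt_id

theorem metricFunction_smul (c : ℝ) (e : TotalSpace F E) :
    metricFunction G ⟨e.1, c • e.2⟩ = c ^ 2 * metricFunction G e := by
  simp only [metricFunction, map_smul, smul_apply, smul_eq_mul]
  ring

end Metric

variable [FiniteDimensional ℝ EM] [IsManifold 𝓘(ℝ, EM) ∞ M] [T2Space M] [SigmaCompactSpace M]
  [ContMDiffVectorBundle ∞ F E 𝓘(ℝ, EM)]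
  {A : LieAlgebroid EM M F E}

namespace LieAlgebroid

section Fields

variable {k : ℕ} {N : Type*} [TopologicalSpace N] [ChartedSpace (EuclideanSpace ℝ (Fin k)) N]
  [IsManifold (𝓡 k) ∞ N]

theorem IsRedefinitionFamily.contMDiff_curve {u : A.Sec} {Ψ : ℝ → BundleMap EM F E k N}
    (hΨ : A.IsRedefinitionFamily u Ψ) (p : TangentBundle (𝓡 k) N) :
    ContMDiff 𝓘(ℝ, ℝ) (𝓘(ℝ, EM).prod 𝓘(ℝ, F)) ∞ (fun t => (Ψ t).toMap p) :=
  hΨ.1.comp (contMDiff_id.prodMk contMDiff_const)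

theorem IsRedefinitionFamily.hasDerivAt {u : A.Sec} {Ψ : ℝ → BundleMap EM F E k N}
    (hΨ : A.IsRedefinitionFamily u Ψ) {q : TotalSpace F E → ℝ}
    (hq : ContMDiff (𝓘(ℝ, EM).prod 𝓘(ℝ, F)) 𝓘(ℝ, ℝ) ∞ q) (p : TangentBundle (𝓡 k) N) :
    HasDerivAt (fun t => q ((Ψ t).toMap p)) (A.lieDeriv u q ((Ψ 0).toMap p)) 0 := by
  have h := hasDerivAt_comp_curve (hq.mdifferentiableAt (by simp))
    ((hΨ.contMDiff_curve p).mdifferentiableAt (x := 0) (by simp))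
  rwa [hΨ.2 p] at h

theorem hasVariation_eval (u : A.Sec) {q : TotalSpace F E → ℝ}
    (hq : ContMDiff (𝓘(ℝ, EM).prod 𝓘(ℝ, F)) 𝓘(ℝ, ℝ) ∞ q) (p : TangentBundle (𝓡 k) N) :
    A.HasVariation u (fun Φ : BundleMap EM F E k N => q (Φ.toMap p))
      (fun Φ => A.lieDeriv u q (Φ.toMap p)) := fun _ hΨ => hΨ.hasDerivAt hq p

end Fields

theorem anchor_eq_zero_of_lie_eq_zero {u : A.Sec} (h : ∀ v : A.Sec, ⁅u, v⁆ = 0) (x : M) :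
    A.anchor x (u x) = 0 := by
  by_cases hx : ∃ a : E x, a ≠ 0
  · obtain ⟨a, ha⟩ := hx
    obtain ⟨v, rfl⟩ : ∃ v : A.Sec, v x = a := A.exists_sec ⟨x, a⟩
    refine tangentSpace_ext_dirDeriv (I := 𝓘(ℝ, EM)) fun f => ?_
    have hleibniz := lie_fsmul u v f x
    rw [h, h, Sec.zero_apply, smul_zero, zero_add] at hleibniz
    rw [(smul_eq_zero.1 hleibniz.symm).resolve_right ha, dirDeriv_apply_zero]
  · push Not at hx
    rw [hx (u x), map_zero]

variable [FiniteDimensional ℝ F]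

section Killing

variable [∀ x, IsTopologicalAddGroup (E x)] [∀ x, ContinuousConstSMul ℝ (E x)]
  (G : ContMDiffRiemannianMetric 𝓘(ℝ, EM) ∞ F E)

theorem lieDeriv_metricFunction_smul (u : A.Sec) (c : ℝ) (e : TotalSpace F E) :
    A.lieDeriv u (metricFunction G) ⟨e.1, c • e.2⟩ =
      c ^ 2 * A.lieDeriv u (metricFunction G) e := by
  have hG (e) := (contMDiff_metricFunction G).mdifferentiableAt (x := e) (by simp)
  rw [lieDeriv, tangentLift_const_smul, ← dirDeriv_comp (hG _)
    ((contMDiff_totalSpace_const_smul c).mdifferentiableAt (by simp))]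
  simp only [metricFunction_smul]
  exact dirDeriv_const_mul (hG e) _ _

/-- The Lie algebra `iso(E, G)` of Killing sections. -/
def killing (A : LieAlgebroid EM M F E) : LieSubalgebra ℝ A.Sec where
  carrier := {u | A.IsKilling G u}
  add_mem' {u v} hu hv e := by
    have hadd : A.lieDeriv (u + v) (metricFunction G) e =
        A.lieDeriv u (metricFunction G) e + A.lieDeriv v (metricFunction G) e := by
      rw [lieDeriv, tangentLift_add, dirDeriv_apply_add]
      rfl
    rw [hadd, hu e, hv e, add_zero]
  zero_mem' e := by
    have hzero := tangentLift_smul (A := A) 0 0 e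
    rw [zero_smul, zero_smul] at hzero
    rw [lieDeriv, hzero, dirDeriv_apply_zero]
  smul_mem' c u hu e := by
    have hsmul : A.lieDeriv (c • u) (metricFunction G) e =
        c * A.lieDeriv u (metricFunction G) e := by
      rw [lieDeriv, tangentLift_smul, dirDeriv_apply_smul]
      rfl
    rw [hsmul, hu e, mul_zero]
  lie_mem' {u v} hu hv e := by
    have hu' : A.lieDeriv u (metricFunction G) = fun _ => 0 := funext hu
    have hv' : A.lieDeriv v (metricFunction G) = fun _ => 0 := funext hv
    rw [lieDeriv_lie u v (contMDiff_metricFunction G), hu', hv', lieDeriv, lieDeriv,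
      dirDeriv_const, dirDeriv_const, sub_zero]

theorem mem_killing (u : A.Sec) : u ∈ A.killing G ↔ A.IsKilling G u := Iff.rfl

end Killing

theorem lie_eq_zero_of_lieDeriv_eq_zero {u : A.Sec}
    (h : ∀ q : TotalSpace F E → ℝ, ContMDiff (𝓘(ℝ, EM).prod 𝓘(ℝ, F)) 𝓘(ℝ, ℝ) ∞ q →
      ∀ e, A.lieDeriv u q e = 0) (v : A.Sec) : ⁅u, v⁆ = 0 := by
  refine Sec.ext fun x => ?_
  obtain ⟨s, θ, hθ, hframe⟩ := A.exists_frame_sec x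
  have hcoord (i) : θ i x (⁅u, v⁆ x) = 0 := by
    have hbase := h (fun e => pairing (hθ i) v e.1)
      ((pairing (hθ i) v).contMDiff.comp (contMDiff_proj E)) ⟨x, v x⟩
    rw [lieDeriv_comp_proj] at hbase
    have hfibre := (lieDeriv_oneForm (hθ i) u v x).symm.trans (h _ (hθ i) ⟨x, v x⟩)
    rwa [hbase, zero_sub, neg_eq_zero] at hfibre
  rw [← hframe.self_of_nhds (⁅u, v⁆ x), Sec.zero_apply]
  simp only [hcoord, zero_smul, Finset.sum_const_zero]

theorem tangentLift_eq_zero_of_lie_eq_zero {u : A.Sec} (h : ∀ v : A.Sec, ⁅u, v⁆ = 0)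
    (e : TotalSpace F E) : A.tangentLift u e = 0 := by
  refine tangentSpace_totalSpace_ext (fun f => ?_) fun α hα => ?_
  · refine (lieDeriv_comp_proj u f e).trans ?_
    rw [anchorDeriv_apply, anchor_eq_zero_of_lie_eq_zero h, dirDeriv_apply_zero,
      dirDeriv_apply_zero]
  · obtain ⟨x, a⟩ := e
    obtain ⟨v, rfl⟩ : ∃ v : A.Sec, v x = a := A.exists_sec ⟨x, a⟩
    refine (lieDeriv_oneForm hα u v x).trans ?_
    rw [anchorDeriv_apply, anchor_eq_zero_of_lie_eq_zero h, dirDeriv_apply_zero, h,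
      Sec.zero_apply, map_zero, sub_zero, dirDeriv_apply_zero]

theorem lieHom_eq_zero_iff (u : A.Sec) : A.lieHom u = 0 ↔ ∀ v : A.Sec, ⁅u, v⁆ = 0 := by
  refine ⟨fun h => lie_eq_zero_of_lieDeriv_eq_zero fun q hq e => ?_, fun h => ?_⟩
  · refine (lieHom_apply u ⟨q, hq⟩ e).symm.trans ?_
    rw [h]
    rfl
  · refine Derivation.ext fun f => ContMDiffMap.ext fun e => ?_
    rw [lieHom_apply, lieDeriv, tangentLift_eq_zero_of_lie_eq_zero h, dirDeriv_apply_zero]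
    rfl

variable {k : ℕ} {N : Type*} [TopologicalSpace N] [ChartedSpace (EuclideanSpace ℝ (Fin k)) N]
  [IsManifold (𝓡 k) ∞ N] in
theorem hasVariation_eval_lie (u v : A.Sec) {q : TotalSpace F E → ℝ}
    (hq : ContMDiff (𝓘(ℝ, EM).prod 𝓘(ℝ, F)) 𝓘(ℝ, ℝ) ∞ q) (p : TangentBundle (𝓡 k) N) :
    A.HasVariation ⁅u, v⁆ (fun Φ : BundleMap EM F E k N => q (Φ.toMap p))
      (fun Φ => A.lieDeriv u (A.lieDeriv v q) (Φ.toMap p)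
        - A.lieDeriv v (A.lieDeriv u q) (Φ.toMap p)) := fun _ hΨ =>
  (hΨ.hasDerivAt hq p).congr_deriv (lieDeriv_lie u v hq _)

end LieAlgebroid

end Algebroid

/-! ### The Lie derivative commutes with the algebroid differential -/

section Differential

variable {EM : Type*} [NormedAddCommGroup EM] [NormedSpace ℝ EM]
  {M : Type*} [TopologicalSpace M] [ChartedSpace EM M] [IsManifold 𝓘(ℝ, EM) ∞ M]
  {F : Type*} [NormedAddCommGroup F] [NormedSpace ℝ F]
  {E : M → Type*} [∀ x, AddCommGroup (E x)] [∀ x, Module ℝ (E x)]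
  [∀ x, TopologicalSpace (E x)] [TopologicalSpace (TotalSpace F E)]
  [FiberBundle F E] [VectorBundle ℝ F E] {A : LieAlgebroid EM M F E}

namespace LieAlgebroid

theorem lie_apply_skew (u v : A.Sec) (x : M) : -(⁅v, u⁆ x) = ⁅u, v⁆ x :=
  congrArg (fun w : A.Sec => w x) (lie_skew u v)

variable (A) in
/-- The algebroid differential `d_E f` of a function on the base. -/
def dFunction (f : C^∞⟮𝓘(ℝ, EM), M; ℝ⟯) (x : M) : E x →ₗ[ℝ] ℝ where
  toFun a := dirDeriv 𝓘(ℝ, EM) f x (A.anchor x a)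
  map_add' a b := by rw [map_add, dirDeriv_apply_add]
  map_smul' c a := by rw [map_smul, dirDeriv_apply_smul]; rfl

theorem dFunction_apply (f : C^∞⟮𝓘(ℝ, EM), M; ℝ⟯) (x : M) (a : E x) :
    A.dFunction f x a = dirDeriv 𝓘(ℝ, EM) f x (A.anchor x a) := rfl

theorem dFunction_sec (f : C^∞⟮𝓘(ℝ, EM), M; ℝ⟯) (v : A.Sec) (x : M) :
    A.dFunction f x (v x) = anchorDeriv v f x := rfl

theorem isOneForm_dFunction (f : C^∞⟮𝓘(ℝ, EM), M; ℝ⟯) :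
    IsOneForm (EM := EM) (F := F) (A.dFunction f) :=
  contMDiff_dirDeriv f.contMDiff A.contMDiff_anchor

theorem pairing_dFunction (f : C^∞⟮𝓘(ℝ, EM), M; ℝ⟯) (v : A.Sec) :
    pairing (A.isOneForm_dFunction f) v = anchorDeriv v f := rfl

variable [FiniteDimensional ℝ EM] [T2Space M] [SigmaCompactSpace M]
  [FiniteDimensional ℝ F] [ContMDiffVectorBundle ∞ F E 𝓘(ℝ, EM)]

theorem lieOneForm_dFunction (u : A.Sec) (f : C^∞⟮𝓘(ℝ, EM), M; ℝ⟯) (x : M) (a : E x) :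
    lieOneForm u (A.isOneForm_dFunction f) x a = A.dFunction (anchorDeriv u f) x a := by
  have : CompleteSpace EM := FiniteDimensional.complete ℝ EM
  obtain ⟨v, rfl⟩ : ∃ v : A.Sec, v x = a := A.exists_sec ⟨x, a⟩
  rw [lieOneForm_sec, pairing_dFunction, dFunction_sec, dFunction_sec, anchorDeriv_lie]
  ring

variable {α : ∀ x, E x →ₗ[ℝ] ℝ} (hα : IsOneForm (EM := EM) (F := F) α)
include hα

theorem dOneForm_sec (v w : A.Sec) (x : M) :
    A.dOneForm α x (v x) (w x) =
      anchorDeriv v (pairing hα w) x - anchorDeriv w (pairing hα v) x - α x (⁅v, w⁆ x) := by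
  set v' : A.Sec := sectionThrough (⟨x, v x⟩ : TotalSpace F E)
  set w' : A.Sec := sectionThrough (⟨x, w x⟩ : TotalSpace F E)
  have hv : v' x = v x := (exists_section_through (⟨x, v x⟩ : TotalSpace F E)).choose_spec
  have hw : w' x = w x := (exists_section_through (⟨x, w x⟩ : TotalSpace F E)).choose_spec
  have hdef : A.dOneForm α x (v x) (w x) =
      dirDeriv 𝓘(ℝ, EM) (fun y => α y (w' y)) x (A.anchor x (v x))
        - dirDeriv 𝓘(ℝ, EM) (fun y => α y (v' y)) x (A.anchor x (w x)) - α x (⁅v', w'⁆ x) := rfl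
  have hreplace_w := dirDeriv_sub_oneForm_lie_congr hα v' hw
  have hreplace_v := dirDeriv_sub_oneForm_lie_congr hα w hv
  rw [hv, ← lie_apply_skew v' w, map_neg] at hreplace_w
  rw [← lie_apply_skew w v, map_neg] at hreplace_v
  rw [hdef, anchorDeriv_apply, anchorDeriv_apply]
  change _ = dirDeriv 𝓘(ℝ, EM) (fun y => α y (w y)) x (A.anchor x (v x))
    - dirDeriv 𝓘(ℝ, EM) (fun y => α y (v y)) x (A.anchor x (w x)) - α x (⁅v, w⁆ x)
  linarith

theorem dOneForm_skew (x : M) (a b : E x) : A.dOneForm α x a b = -A.dOneForm α x b a := by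
  obtain ⟨v, rfl⟩ : ∃ v : A.Sec, v x = a := A.exists_sec ⟨x, a⟩
  obtain ⟨w, rfl⟩ : ∃ w : A.Sec, w x = b := A.exists_sec ⟨x, b⟩
  rw [dOneForm_sec hα, dOneForm_sec hα, ← lie_apply_skew v w, map_neg]
  ring

/-- The one-form `a ↦ (d_E α)(a, w)`, written as `d_E(α(w)) - 𝓛_w α` by Cartan's formula. -/
def contraction (w : A.Sec) (x : M) : E x →ₗ[ℝ] ℝ :=
  A.dFunction (pairing hα w) x - lieOneForm w hα x

theorem contraction_eq_dOneForm (w : A.Sec) (x : M) (a : E x) :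
    contraction hα w x a = A.dOneForm α x a (w x) := by
  obtain ⟨v, rfl⟩ : ∃ v : A.Sec, v x = a := A.exists_sec ⟨x, a⟩
  rw [dOneForm_sec hα, contraction, LinearMap.sub_apply, lieOneForm_sec, dFunction_sec,
    ← lie_apply_skew v w, map_neg]
  ring

theorem isOneForm_contraction (w : A.Sec) : IsOneForm (EM := EM) (F := F) (contraction hα w) :=
  (A.isOneForm_dFunction _).sub (isOneForm_lieOneForm w hα)

/-- `(d_E α)(a, ·)` as a linear form on the fibre. -/
def dOneFormRight (x : M) (a : E x) : E x →ₗ[ℝ] ℝ where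
  toFun b := A.dOneForm α x a b
  map_add' b c := by
    obtain ⟨v, rfl⟩ : ∃ v : A.Sec, v x = a := A.exists_sec ⟨x, a⟩
    simp only [dOneForm_skew hα x (v x), ← contraction_eq_dOneForm hα v x, map_add, neg_add]
  map_smul' r b := by
    obtain ⟨v, rfl⟩ : ∃ v : A.Sec, v x = a := A.exists_sec ⟨x, a⟩
    simp only [dOneForm_skew hα x (v x), ← contraction_eq_dOneForm hα v x, map_smul, smul_neg,
      RingHom.id_apply]

theorem dOneFormRight_apply (x : M) (a b : E x) :
    dOneFormRight (A := A) hα x a b = A.dOneForm α x a b := rfl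

theorem dFunction_pairing_lieOneForm (u w : A.Sec) (x : M) (a : E x) :
    A.dFunction (pairing (isOneForm_lieOneForm u hα) w) x a =
      A.dFunction (anchorDeriv u (pairing hα w)) x a - A.dFunction (pairing hα ⁅u, w⁆) x a := by
  have hpairing : ⇑(pairing (isOneForm_lieOneForm u hα) w) = fun y =>
      anchorDeriv u (pairing hα w) y - pairing hα ⁅u, w⁆ y :=
    funext fun y => lieOneForm_sec u w hα y
  rw [dFunction_apply, hpairing,
    dirDeriv_sub ((anchorDeriv u (pairing hα w)).contMDiff.mdifferentiableAt (by simp))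
      ((pairing hα ⁅u, w⁆).contMDiff.mdifferentiableAt (by simp)), ← dFunction_apply,
    ← dFunction_apply]

theorem lieOneForm_contraction (u w : A.Sec) (x : M) (a : E x) :
    lieOneForm u (isOneForm_contraction hα w) x a =
      A.dOneForm (lieOneForm u hα) x a (w x) + A.dOneForm α x a (⁅u, w⁆ x) := by
  have hsub : lieOneForm u (isOneForm_contraction hα w) x a =
      lieOneForm u (A.isOneForm_dFunction (pairing hα w)) x a -
        lieOneForm u (isOneForm_lieOneForm w hα) x a :=
    dirDeriv_sub (IsOneForm.mdifferentiableAt (A.isOneForm_dFunction (pairing hα w)) _)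
      (IsOneForm.mdifferentiableAt (isOneForm_lieOneForm w hα) _) _
  have hlie : lieOneForm ⁅u, w⁆ hα x a = lieOneForm u (isOneForm_lieOneForm w hα) x a -
      lieOneForm w (isOneForm_lieOneForm u hα) x a := lieDeriv_lie u w hα ⟨x, a⟩
  rw [hsub, lieOneForm_dFunction, ← contraction_eq_dOneForm (isOneForm_lieOneForm u hα),
    ← contraction_eq_dOneForm hα, contraction, contraction, LinearMap.sub_apply,
    LinearMap.sub_apply, dFunction_pairing_lieOneForm, hlie]
  ring

section Frame

variable {n : ℕ} {s : Fin n → A.Sec} {θ : Fin n → ∀ y, E y →ₗ[ℝ] ℝ}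
  (hθ : ∀ i, IsOneForm (EM := EM) (F := F) (θ i)) {x : M}

theorem dOneForm_eq_sum_contraction {a b : E x} (hb : ∑ i, θ i x b • s i x = b) :
    A.dOneForm α x a b = ∑ i, θ i x b * contraction hα (s i) x a := by
  conv_lhs => rw [← dOneFormRight_apply hα, ← hb]
  simp only [map_sum, map_smul, smul_eq_mul, dOneFormRight_apply, contraction_eq_dOneForm]

omit hα in
theorem sum_lieOneForm_smul_add_smul_lie (u : A.Sec)
    (h : ∀ᶠ y in 𝓝 x, ∀ a : E y, ∑ i, θ i y a • s i y = a) (b : E x) :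
    ∑ i, (lieOneForm u (hθ i) x b • s i x + θ i x b • ⁅u, s i⁆ x) = 0 := by
  obtain ⟨w, rfl⟩ : ∃ w : A.Sec, w x = b := A.exists_sec ⟨x, b⟩
  have hterm (i) : lieOneForm u (hθ i) x (w x) • s i x + θ i x (w x) • ⁅u, s i⁆ x =
      (θ i x (w x) • ⁅u, s i⁆ x +
        dirDeriv 𝓘(ℝ, EM) (fun y => θ i y (w y)) x (A.anchor x (u x)) • s i x)
        - θ i x (⁅u, w⁆ x) • s i x := by
    rw [lieOneForm_sec, sub_smul]
    change dirDeriv 𝓘(ℝ, EM) (fun y => θ i y (w y)) x (A.anchor x (u x)) • s i x - _ + _ = _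
    abel
  simp only [hterm]
  rw [Finset.sum_sub_distrib, ← lie_eq_sum hθ u w h, h.self_of_nhds, sub_self]

theorem sum_lieOneForm_mul_contraction (u : A.Sec)
    (h : ∀ᶠ y in 𝓝 x, ∀ a : E y, ∑ i, θ i y a • s i y = a) (a b : E x) :
    ∑ i, (lieOneForm u (hθ i) x b * contraction hα (s i) x a
        + θ i x b * lieOneForm u (isOneForm_contraction hα (s i)) x a) =
      A.dOneForm (lieOneForm u hα) x a b := by
  have hzero := congrArg (dOneFormRight (A := A) hα x a)
    (sum_lieOneForm_smul_add_smul_lie hθ u h b)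
  rw [map_zero, map_sum] at hzero
  rw [dOneForm_eq_sum_contraction (isOneForm_lieOneForm u hα) (h.self_of_nhds b),
    ← add_zero (∑ i, _ * contraction (isOneForm_lieOneForm u hα) (s i) x a), ← hzero,
    ← Finset.sum_add_distrib]
  refine Finset.sum_congr rfl fun i _ => ?_
  simp only [lieOneForm_contraction, contraction_eq_dOneForm, map_add, map_smul, smul_eq_mul,
    dOneFormRight_apply]
  ring

end Frame

section Fields

variable {k : ℕ} {N : Type*} [TopologicalSpace N] [ChartedSpace (EuclideanSpace ℝ (Fin k)) N]
  [IsManifold (𝓡 k) ∞ N] {u : A.Sec} {Ψ : ℝ → BundleMap EM F E k N}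
  (hΨ : A.IsRedefinitionFamily u Ψ)
include hΨ

theorem IsRedefinitionFamily.hasDerivAt_oneForm (z : N) (X : TangentSpace (𝓡 k) z) :
    HasDerivAt (fun t => α ((Ψ t).base z) ((Ψ t).fiber z X))
      (lieOneForm u hα ((Ψ 0).base z) ((Ψ 0).fiber z X)) 0 :=
  hΨ.hasDerivAt hα ⟨z, X⟩

theorem IsRedefinitionFamily.hasDerivAt_dOneForm (z : N) (X Y : TangentSpace (𝓡 k) z) :
    HasDerivAt (fun t => A.dOneForm α ((Ψ t).base z) ((Ψ t).fiber z X) ((Ψ t).fiber z Y))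
      (A.dOneForm (lieOneForm u hα) ((Ψ 0).base z) ((Ψ 0).fiber z X) ((Ψ 0).fiber z Y)) 0 := by
  obtain ⟨s, θ, hθ, hframe⟩ := A.exists_frame_sec ((Ψ 0).base z)
  have hbase : Continuous fun t => (Ψ t).base z :=
    ((contMDiff_proj E (n := ∞) (IB := 𝓘(ℝ, EM)) (F := F)).comp
      (hΨ.contMDiff_curve ⟨z, 0⟩)).continuous
  have hexpand : ∀ᶠ t in 𝓝 (0 : ℝ),
      A.dOneForm α ((Ψ t).base z) ((Ψ t).fiber z X) ((Ψ t).fiber z Y) =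
        ∑ j, θ j ((Ψ t).base z) ((Ψ t).fiber z Y) *
          contraction hα (s j) ((Ψ t).base z) ((Ψ t).fiber z X) := by
    filter_upwards [hbase.continuousAt.eventually hframe] with t ht
    exact dOneForm_eq_sum_contraction hα (ht _)
  refine HasDerivAt.congr_of_eventuallyEq ?_ hexpand
  refine (HasDerivAt.fun_sum fun j _ => (hΨ.hasDerivAt_oneForm (hθ j) z Y).mul
    (hΨ.hasDerivAt_oneForm (isOneForm_contraction hα (s j)) z X)).congr_deriv ?_
  exact sum_lieOneForm_mul_contraction hα hθ u hframe _ _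

theorem IsRedefinitionFamily.hasDerivAt_dirDeriv_oneForm
    (Y : Cₛ^∞⟮𝓡 k; EuclideanSpace ℝ (Fin k), (TangentSpace (𝓡 k) : N → Type _)⟯) (z : N)
    (X : TangentSpace (𝓡 k) z) :
    HasDerivAt (fun t => dirDeriv (𝓡 k) (fun w => α ((Ψ t).base w) ((Ψ t).fiber w (Y w))) z X)
      (dirDeriv (𝓡 k) (fun w => lieOneForm u hα ((Ψ 0).base w) ((Ψ 0).fiber w (Y w))) z X) 0 := by
  have hsmooth : ContMDiff (𝓘(ℝ, ℝ).prod (𝓡 k)) 𝓘(ℝ, ℝ) ∞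
      (fun r : ℝ × N => α ((Ψ r.1).base r.2) ((Ψ r.1).fiber r.2 (Y r.2))) :=
    (hα.comp hΨ.1).comp (contMDiff_fst.prodMk (Y.contMDiff.comp contMDiff_snd))
  refine (hasDerivAt_dirDeriv hsmooth 0 z X).congr_deriv ?_
  exact congrArg (fun f => dirDeriv (𝓡 k) f z X)
    (funext fun w => (hΨ.hasDerivAt_oneForm hα w (Y w)).deriv)

theorem IsRedefinitionFamily.hasDerivAt_defectOne
    (X Y : Cₛ^∞⟮𝓡 k; EuclideanSpace ℝ (Fin k), (TangentSpace (𝓡 k) : N → Type _)⟯) (z : N) :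
    HasDerivAt (fun t => (Ψ t).defectOne A α X Y z) ((Ψ 0).defectOne A (lieOneForm u hα) X Y z) 0 :=
  (((hΨ.hasDerivAt_dirDeriv_oneForm hα Y z (X z)).sub
    (hΨ.hasDerivAt_dirDeriv_oneForm hα X z (Y z))).sub
    (hΨ.hasDerivAt_oneForm hα z (VectorField.mlieBracket (𝓡 k) X Y z))).sub
    (hΨ.hasDerivAt_dOneForm hα z (X z) (Y z))

omit hα

omit [FiniteDimensional ℝ F] in
theorem IsRedefinitionFamily.hasDerivAt_base (f : C^∞⟮𝓘(ℝ, EM), M; ℝ⟯) (z : N) :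
    HasDerivAt (fun t => f ((Ψ t).base z)) (anchorDeriv u f ((Ψ 0).base z)) 0 :=
  (hΨ.hasDerivAt (q := fun e => f e.1) (f.contMDiff.comp (contMDiff_proj E)) ⟨z, 0⟩).congr_deriv
    (lieDeriv_comp_proj u f _)

theorem IsRedefinitionFamily.hasDerivAt_defectZero (f : C^∞⟮𝓘(ℝ, EM), M; ℝ⟯) (z : N)
    (X : TangentSpace (𝓡 k) z) :
    HasDerivAt (fun t => (Ψ t).defectZero A f z X)
      ((Ψ 0).defectZero A (anchorDeriv u f) z X) 0 := by
  have hsmooth : ContMDiff (𝓘(ℝ, ℝ).prod (𝓡 k)) 𝓘(ℝ, ℝ) ∞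
      (fun r : ℝ × N => f ((Ψ r.1).base r.2)) :=
    (f.contMDiff.comp ((contMDiff_proj E).comp hΨ.1)).comp
      (contMDiff_fst.prodMk ((contMDiff_zeroSection ℝ (TangentSpace (𝓡 k))).comp contMDiff_snd))
  refine ((hasDerivAt_dirDeriv hsmooth 0 z X).sub
    (hΨ.hasDerivAt_oneForm (A.isOneForm_dFunction f) z X)).congr_deriv ?_
  exact congrArg₂ (· - ·)
    (congrArg (fun f => dirDeriv (𝓡 k) f z X) (funext fun w => (hΨ.hasDerivAt_base f w).deriv))
    (lieOneForm_dFunction u f _ _)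

omit hΨ in
theorem preservesMorphisms (u : A.Sec) : A.PreservesMorphisms k N u := fun _ hΨ hmor =>
  ⟨fun f z X => (hΨ.hasDerivAt_defectZero f z X).congr_deriv (hmor.1 _ z X),
    fun _ X Y z hα => (hΨ.hasDerivAt_defectOne hα X Y z).congr_deriv
      (hmor.2 _ X Y z (isOneForm_lieOneForm u hα))⟩

end Fields

end LieAlgebroid

end Differential

/-! ### Traces of quadratic forms -/

section Trace

section Bilinear

variable {R V ι : Type*} [CommRing R] [AddCommGroup V] [Module R V] [Fintype ι] [DecidableEq ι]

theorem trace_inv_toMatrix_mul_toMatrix (b c : Module.Basis ι R V)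
    (g B : LinearMap.BilinForm R V) :
    ((LinearMap.BilinForm.toMatrix c g)⁻¹ * LinearMap.BilinForm.toMatrix c B).trace =
      ((LinearMap.BilinForm.toMatrix b g)⁻¹ * LinearMap.BilinForm.toMatrix b B).trace := by
  set C := b.toMatrix c
  have : Invertible C := b.invertibleToMatrix c
  rw [← LinearMap.BilinForm.toMatrix_mul_basis_toMatrix (b := b) c g,
    ← LinearMap.BilinForm.toMatrix_mul_basis_toMatrix (b := b) c B]
  calc ((C.transpose * LinearMap.BilinForm.toMatrix b g * C)⁻¹ *
        (C.transpose * LinearMap.BilinForm.toMatrix b B * C)).trace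
      = (C⁻¹ * ((LinearMap.BilinForm.toMatrix b g)⁻¹ *
          LinearMap.BilinForm.toMatrix b B) * C).trace := by
        simp only [Matrix.mul_inv_rev, Matrix.mul_assoc,
          Matrix.inv_mul_cancel_left_of_invertible]
    _ = _ := Matrix.trace_conj' (isUnit_of_invertible C) _

theorem sum_inv_toMatrix_mul_eq (b c : Module.Basis ι R V) (g B : LinearMap.BilinForm R V) :
    ∑ i, ∑ j, (LinearMap.BilinForm.toMatrix b g)⁻¹ i j * B (b i) (b j) =
      ∑ i, ∑ j, (LinearMap.BilinForm.toMatrix c g)⁻¹ i j * B (c i) (c j) := by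
  simpa only [Matrix.trace, Matrix.diag, Matrix.mul_apply, LinearMap.BilinForm.toMatrix_apply,
    LinearMap.BilinForm.flip_apply] using trace_inv_toMatrix_mul_toMatrix c b g B.flip

end Bilinear

variable {k : ℕ} {N : Type*} [TopologicalSpace N] [ChartedSpace (EuclideanSpace ℝ (Fin k)) N]
  [IsManifold (𝓡 k) ∞ N]

/-- The coordinate basis of a tangent space, used by `metricTrace`. -/
def coordBasis (z : N) : Module.Basis (Fin k) ℝ (TangentSpace (𝓡 k) z) :=
  (EuclideanSpace.basisFun (Fin k) ℝ).toBasis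

variable (g : ContMDiffRiemannianMetric (𝓡 k) ∞ (EuclideanSpace ℝ (Fin k))
      (TangentSpace (𝓡 k) : N → Type _))

/-- The Riemannian metric on one tangent space as an algebraic bilinear form. -/
def metricForm (z : N) : LinearMap.BilinForm ℝ (TangentSpace (𝓡 k) z) :=
  LinearMap.mk₂ ℝ (fun X Y => g.inner z X Y)
    (fun X X' Y => by rw [map_add]; rfl) (fun c X Y => by rw [map_smul]; rfl)
    (fun X Y Y' => map_add _ _ _) (fun c X Y => map_smul _ _ _)

theorem toMatrix_metricForm {z : N} (b : Module.Basis (Fin k) ℝ (TangentSpace (𝓡 k) z)) :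
    LinearMap.BilinForm.toMatrix b (metricForm g z) = gramMatrix g z b := by
  ext i j
  rw [LinearMap.BilinForm.toMatrix_apply]
  rfl

theorem metricTrace_eq (z : N) (B : LinearMap.BilinForm ℝ (TangentSpace (𝓡 k) z))
    (hB : ∀ X Y, B X Y = B Y X) (c : Module.Basis (Fin k) ℝ (TangentSpace (𝓡 k) z)) :
    metricTrace g z (fun X => B X X) =
      ∑ i, ∑ j, (gramMatrix g z c)⁻¹ i j * B (c i) (c j) := by
  rw [← toMatrix_metricForm, ← sum_inv_toMatrix_mul_eq (coordBasis z) c, toMatrix_metricForm]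
  have hbasis : (fun i => EuclideanSpace.basisFun (Fin k) ℝ i : Fin k → TangentSpace (𝓡 k) z) =
      coordBasis z :=
    (EuclideanSpace.basisFun (Fin k) ℝ).coe_toBasis.symm
  unfold metricTrace
  rw [hbasis]
  refine Finset.sum_congr rfl fun i _ => Finset.sum_congr rfl fun j _ => ?_
  simp only [map_add, LinearMap.add_apply]
  rw [hB (coordBasis z j) (coordBasis z i)]
  ring

theorem posDef_gramMatrix {z : N} {b : Fin k → TangentSpace (𝓡 k) z}
    (hb : LinearIndependent ℝ b) : (gramMatrix g z b).PosDef := by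
  refine Matrix.PosDef.of_dotProduct_mulVec_pos ?_ fun x hx => ?_
  · ext i j
    simp only [Matrix.conjTranspose_apply, gramMatrix, Matrix.of_apply, star_trivial]
    exact g.symm z _ _
  · have hne : ∑ i, x i • b i ≠ 0 := fun h =>
      hx (funext (Fintype.linearIndependent_iff.1 hb x h))
    refine (g.pos z _ hne).trans_eq (?_ : metricForm g z (∑ i, x i • b i) (∑ i, x i • b i) = _)
    simp only [map_sum, LinearMap.sum_apply, map_smul, LinearMap.smul_apply, dotProduct,
      Matrix.mulVec, gramMatrix, Matrix.of_apply, star_trivial, smul_eq_mul, Finset.mul_sum]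
    rw [Finset.sum_comm]
    refine Finset.sum_congr rfl fun i _ => Finset.sum_congr rfl fun j _ => ?_
    change x j * (x i * g.inner z (b i) (b j)) = _
    ring

theorem det_gramMatrix_pos {z : N} {b : Fin k → TangentSpace (𝓡 k) z}
    (hb : LinearIndependent ℝ b) : 0 < (gramMatrix g z b).det :=
  (posDef_gramMatrix g hb).det_pos

theorem metricTrace_mul_self_pos {z : N} (l : TangentSpace (𝓡 k) z →ₗ[ℝ] ℝ) (hl : l ≠ 0) :
    0 < metricTrace g z fun X => l X * l X := by
  have htrace := metricTrace_eq g z ((LinearMap.mul ℝ ℝ).compl₁₂ l l) (fun X Y => mul_comm _ _)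
    (coordBasis z)
  have hne : (fun i => l (coordBasis z i)) ≠ 0 := fun h0 =>
    hl ((coordBasis z).ext fun i => congrFun h0 i)
  have hpos := (posDef_gramMatrix g (coordBasis z).linearIndependent).inv.dotProduct_mulVec_pos hne
  simp only [LinearMap.compl₁₂_apply, LinearMap.mul_apply'] at htrace
  rw [htrace]
  refine hpos.trans_eq ?_
  simp only [dotProduct, Matrix.mulVec, star_trivial, Finset.mul_sum]
  refine Finset.sum_congr rfl fun i _ => Finset.sum_congr rfl fun j _ => ?_
  ring

theorem continuousAt_gramMatrix {Q : Type*} [TopologicalSpace Q]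
    {V H : Type*} [NormedAddCommGroup V] [NormedSpace ℝ V] [TopologicalSpace H]
    {I : ModelWithCorners ℝ V H} [ChartedSpace H Q] {b : Q → N}
    {X : Fin k → ∀ q, TangentSpace (𝓡 k) (b q)} {q : Q}
    (hX : ∀ i, ContMDiffAt I (𝓡 k).tangent ∞ (fun q => (⟨b q, X i q⟩ : TangentBundle (𝓡 k) N)) q) :
    ContinuousAt (fun q => gramMatrix g (b q) (fun i => X i q)) q :=
  continuousAt_pi.2 fun i => continuousAt_pi.2 fun j =>
    (contMDiffAt_riemannianMetric_inner g (hX i) (hX j)).continuousAt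

theorem exists_frame_tangent [T2Space N] [SigmaCompactSpace N] (z₀ : N) :
    ∃ X : Fin k → Cₛ^∞⟮𝓡 k; EuclideanSpace ℝ (Fin k), (TangentSpace (𝓡 k) : N → Type _)⟯,
      ∀ᶠ z in 𝓝 z₀, LinearIndependent ℝ (fun i => X i z) := by
  obtain ⟨s, θ, -, hs⟩ := exists_frame_dualFrame (IB := 𝓡 k)
    (F := EuclideanSpace ℝ (Fin k)) (E := (TangentSpace (𝓡 k) : N → Type _)) z₀
  let e : Fin k ≃ Fin (Module.finrank ℝ (EuclideanSpace ℝ (Fin k))) :=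
    finCongr finrank_euclideanSpace_fin.symm
  refine ⟨fun i => s (e i), hs.mono fun z hz => ?_⟩
  exact (LinearIndependent.of_pairwise_dual_eq_zero_one _ (fun i => θ i z)
    (fun i j hij => (hz.2 i j).trans (if_neg hij))
    fun i => (hz.2 i i).trans (if_pos rfl)).comp e e.injective

end Trace

/-! ### The Lagrangian density of a smooth family of fields -/

section Lagrangian

variable {EM : Type*} [NormedAddCommGroup EM] [NormedSpace ℝ EM]
  {M : Type*} [TopologicalSpace M] [ChartedSpace EM M]
  {F : Type*} [NormedAddCommGroup F] [NormedSpace ℝ F]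
  {E : M → Type*} [∀ x, AddCommGroup (E x)] [∀ x, Module ℝ (E x)]
  [∀ x, TopologicalSpace (E x)] [∀ x, IsTopologicalAddGroup (E x)]
  [∀ x, ContinuousConstSMul ℝ (E x)] [TopologicalSpace (TotalSpace F E)]
  [FiberBundle F E] [VectorBundle ℝ F E]
  (G : ContMDiffRiemannianMetric 𝓘(ℝ, EM) ∞ F E)
  {k : ℕ} {N : Type*} [TopologicalSpace N] [ChartedSpace (EuclideanSpace ℝ (Fin k)) N]
  [IsManifold (𝓡 k) ∞ N]

namespace BundleMap

/-- The pullback `Φ^* G` of the metric of `E`, as a bilinear form on `T_z N`. -/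
def pullbackForm (Φ : BundleMap EM F E k N) (z : N) :
    LinearMap.BilinForm ℝ (TangentSpace (𝓡 k) z) :=
  LinearMap.mk₂ ℝ (fun X Y => G.inner (Φ.base z) (Φ.fiber z X) (Φ.fiber z Y))
    (fun X X' Y => by rw [map_add, map_add]; rfl) (fun c X Y => by rw [map_smul, map_smul]; rfl)
    (fun X Y Y' => by rw [map_add, map_add]) (fun c X Y => by rw [map_smul, map_smul])

variable (g : ContMDiffRiemannianMetric (𝓡 k) ∞ (EuclideanSpace ℝ (Fin k))
      (TangentSpace (𝓡 k) : N → Type _))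

theorem pullbackTrace_eq (Φ : BundleMap EM F E k N) {z : N} {b : Fin k → TangentSpace (𝓡 k) z}
    (hb : LinearIndependent ℝ b) :
    Φ.pullbackTrace g (metricFunction G) z = ∑ i, ∑ j, (gramMatrix g z b)⁻¹ i j *
      G.inner (Φ.base z) (Φ.fiber z (b i)) (Φ.fiber z (b j)) := by
  have : FiniteDimensional ℝ (TangentSpace (𝓡 k) z) :=
    (coordBasis z).finiteDimensional_of_finite
  let c : Module.Basis (Fin k) ℝ (TangentSpace (𝓡 k) z) :=
    basisOfLinearIndependentOfCardEqFinrank' b hb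
      (Module.finrank_eq_card_basis (coordBasis z)).symm
  have hc : (c : Fin k → TangentSpace (𝓡 k) z) = b :=
    coe_basisOfLinearIndependentOfCardEqFinrank' _ _ _
  have htrace := metricTrace_eq g z (Φ.pullbackForm G z) (fun X Y => G.symm _ _ _) c
  rwa [hc] at htrace

variable [T2Space N] [SigmaCompactSpace N]

theorem exists_pullbackTrace_eq_sum (z₀ : N) :
    ∃ (X : Fin k → Cₛ^∞⟮𝓡 k; EuclideanSpace ℝ (Fin k), (TangentSpace (𝓡 k) : N → Type _)⟯)
      (c : Fin k → Fin k → N → ℝ), (∀ i j, ContinuousAt (c i j) z₀) ∧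
      ∀ᶠ z in 𝓝 z₀, ∀ Φ : BundleMap EM F E k N,
        Φ.pullbackTrace g (metricFunction G) z =
          ∑ i, ∑ j, c i j z * G.inner (Φ.base z) (Φ.fiber z (X i z)) (Φ.fiber z (X j z)) := by
  obtain ⟨X, hX⟩ := exists_frame_tangent (k := k) z₀
  refine ⟨X, fun i j z => (gramMatrix g z fun i => X i z)⁻¹ i j, fun i j => ?_,
    hX.mono fun z hz Φ => Φ.pullbackTrace_eq G g hz⟩
  have hgram := continuousAt_gramMatrix g (b := fun z => z) (X := fun i z => X i z)
    fun i => (X i).contMDiff.contMDiffAt (x := z₀)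
  have hinv : ContinuousAt Inv.inv (gramMatrix g z₀ fun i => X i z₀) := by
    refine continuousAt_matrix_inv _ ?_
    rw [Ring.inverse_eq_inv']
    exact continuousAt_inv₀ (det_gramMatrix_pos g hX.self_of_nhds).ne'
  exact continuousAt_pi.1 (continuousAt_pi.1 (ContinuousAt.comp (x := z₀) hinv hgram) i) j

end BundleMap

section Family

variable (g : ContMDiffRiemannianMetric (𝓡 k) ∞ (EuclideanSpace ℝ (Fin k))
      (TangentSpace (𝓡 k) : N → Type _))
  {Ψ : ℝ → BundleMap EM F E k N}
  (hΨ : ContMDiff (𝓘(ℝ, ℝ).prod (𝓡 k).tangent) (𝓘(ℝ, EM).prod 𝓘(ℝ, F)) ∞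
    (fun r : ℝ × TangentBundle (𝓡 k) N => (Ψ r.1).toMap r.2))
include hΨ

omit [∀ x, IsTopologicalAddGroup (E x)] [∀ x, ContinuousConstSMul ℝ (E x)] in
theorem contMDiff_inner_family
    (X Y : Cₛ^∞⟮𝓡 k; EuclideanSpace ℝ (Fin k), (TangentSpace (𝓡 k) : N → Type _)⟯) :
    ContMDiff (𝓘(ℝ, ℝ).prod (𝓡 k)) 𝓘(ℝ, ℝ) ∞ (fun r : ℝ × N =>
      G.inner ((Ψ r.1).base r.2) ((Ψ r.1).fiber r.2 (X r.2)) ((Ψ r.1).fiber r.2 (Y r.2))) :=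
  fun r => contMDiffAt_riemannianMetric_inner G
    ((hΨ.comp (contMDiff_fst.prodMk (X.contMDiff.comp contMDiff_snd))) r)
    ((hΨ.comp (contMDiff_fst.prodMk (Y.contMDiff.comp contMDiff_snd))) r)

variable [T2Space N] [SigmaCompactSpace N]

theorem continuous_pullbackTrace_family :
    Continuous fun r : ℝ × N => (Ψ r.1).pullbackTrace g (metricFunction G) r.2 := by
  refine continuous_iff_continuousAt.2 fun r => ?_
  obtain ⟨X, c, hc, hsum⟩ := BundleMap.exists_pullbackTrace_eq_sum (EM := EM) G g r.2
  have hcont : ContinuousAt (fun r : ℝ × N => ∑ i, ∑ j, c i j r.2 * G.inner ((Ψ r.1).base r.2)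
      ((Ψ r.1).fiber r.2 (X i r.2)) ((Ψ r.1).fiber r.2 (X j r.2))) r :=
    tendsto_finsetSum _ fun i _ => tendsto_finsetSum _ fun j _ =>
      (ContinuousAt.comp (x := r) (hc i j) continuousAt_snd).mul
        (contMDiff_inner_family G hΨ (X i) (X j)).continuous.continuousAt
  exact hcont.congr ((continuousAt_snd.eventually hsum).mono fun r' hr' => (hr' _).symm)

theorem exists_hasDerivAt_pullbackTrace_family (z₀ : N) :
    ∃ D : ℝ × N → ℝ, (∀ t, ContinuousAt D (t, z₀)) ∧ ∀ᶠ z in 𝓝 z₀, ∀ t,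
      HasDerivAt (fun s => (Ψ s).pullbackTrace g (metricFunction G) z) (D (t, z)) t := by
  obtain ⟨X, c, hc, hsum⟩ := BundleMap.exists_pullbackTrace_eq_sum (EM := EM) G g z₀
  have hinner := fun i j => contMDiff_inner_family G hΨ (X i) (X j)
  refine ⟨fun r => ∑ i, ∑ j, c i j r.2 * deriv (fun s => G.inner ((Ψ s).base r.2)
    ((Ψ s).fiber r.2 (X i r.2)) ((Ψ s).fiber r.2 (X j r.2))) r.1, fun t => ?_, ?_⟩
  · exact tendsto_finsetSum _ fun i _ => tendsto_finsetSum _ fun j _ =>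
      (ContinuousAt.comp (x := (t, z₀)) (hc i j) continuousAt_snd).mul
        (contMDiff_deriv_fst (hinner i j)).continuous.continuousAt
  · filter_upwards [hsum] with z hz t
    rw [funext fun s => hz (Ψ s)]
    refine HasDerivAt.fun_sum fun i _ => HasDerivAt.fun_sum fun j _ => HasDerivAt.const_mul _ ?_
    exact (hasDerivAt_comp_prodMk_left
      ((hinner i j).mdifferentiableAt (by simp))).differentiableAt.hasDerivAt

theorem differentiableAt_pullbackTrace_family (t : ℝ) (z : N) :
    DifferentiableAt ℝ (fun s => (Ψ s).pullbackTrace g (metricFunction G) z) t := by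
  obtain ⟨D, -, hderiv⟩ := exists_hasDerivAt_pullbackTrace_family G g hΨ z
  exact (hderiv.self_of_nhds t).differentiableAt

theorem continuous_deriv_pullbackTrace_family :
    Continuous fun r : ℝ × N =>
      deriv (fun s => (Ψ s).pullbackTrace g (metricFunction G) r.2) r.1 := by
  refine continuous_iff_continuousAt.2 fun r => ?_
  obtain ⟨D, hD, hderiv⟩ := exists_hasDerivAt_pullbackTrace_family G g hΨ r.2
  exact (hD r.1).congr
    ((continuousAt_snd.eventually hderiv).mono fun r' hr' => (hr' r'.1).deriv.symm)

end Family

theorem LieAlgebroid.hasVariation_pullbackTrace [FiniteDimensional ℝ EM]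
    [IsManifold 𝓘(ℝ, EM) ∞ M] [T2Space M] [SigmaCompactSpace M]
    [ContMDiffVectorBundle ∞ F E 𝓘(ℝ, EM)] {A : LieAlgebroid EM M F E}
    (g : ContMDiffRiemannianMetric (𝓡 k) ∞ (EuclideanSpace ℝ (Fin k))
      (TangentSpace (𝓡 k) : N → Type _)) (u : A.Sec) (z : N) : A.HasVariation u
    (fun Φ : BundleMap EM F E k N => Φ.pullbackTrace g (metricFunction G) z)
    (fun Φ => Φ.pullbackTrace g (A.lieDeriv u (metricFunction G)) z) := by
  intro Ψ hΨ
  have hvalue (X : TangentSpace (𝓡 k) z) := hΨ.hasDerivAt (contMDiff_metricFunction G) ⟨z, X⟩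
  simp only [BundleMap.pullbackTrace, metricTrace]
  exact HasDerivAt.fun_sum fun i _ => HasDerivAt.fun_sum fun j _ => HasDerivAt.const_mul _
    ((((hvalue _).sub (hvalue _)).sub (hvalue _)).div_const 2)

end Lagrangian

/-! ### The Riemannian volume -/

section Measures

variable {X : Type*} [MeasurableSpace X] [TopologicalSpace X] [OpensMeasurableSpace X]

theorem finiteAtFilter_withDensity_ofReal {μ : Measure X} [IsLocallyFiniteMeasure μ] {f : X → ℝ}
    {x : X} (hf : ContinuousAt f x) :
    (μ.withDensity fun y => ENNReal.ofReal (f y)).FiniteAtFilter (𝓝 x) := by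
  obtain ⟨U, hU, hfin⟩ := μ.finiteAt_nhds x
  have hbound : {y | f y < f x + 1} ∈ 𝓝 x := hf.eventually (gt_mem_nhds (lt_add_one _))
  obtain ⟨W, hWsub, hWo, hxW⟩ := mem_nhds_iff.1 (Filter.inter_mem hU hbound)
  refine ⟨W, hWo.mem_nhds hxW, ?_⟩
  calc μ.withDensity (fun y => ENNReal.ofReal (f y)) W
      = ∫⁻ y in W, ENNReal.ofReal (f y) ∂μ := withDensity_apply _ hWo.measurableSet
    _ ≤ ∫⁻ _ in W, ENNReal.ofReal (f x + 1) ∂μ :=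
        setLIntegral_mono measurable_const fun y hy =>
          ENNReal.ofReal_le_ofReal (le_of_lt (hWsub hy).2)
    _ = ENNReal.ofReal (f x + 1) * μ W := setLIntegral_const _ _
    _ < ⊤ := ENNReal.mul_lt_top ENNReal.ofReal_lt_top
        ((measure_mono fun y hy => (hWsub hy).1).trans_lt hfin)

theorem withDensity_ofReal_ne_zero {μ : Measure X} [μ.IsOpenPosMeasure] {f : X → ℝ} {O : Set X}
    (hO : IsOpen O) (hne : O.Nonempty) (hf : ContinuousOn f O) (hpos : ∀ y ∈ O, 0 < f y) :
    μ.withDensity (fun y => ENNReal.ofReal (f y)) O ≠ 0 := by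
  rw [withDensity_apply _ hO.measurableSet, Ne,
    lintegral_eq_zero_iff' (hf.aemeasurable hO.measurableSet).ennreal_ofReal]
  intro hzero
  refine (hO.measure_pos μ hne).ne' (measure_eq_zero_iff_ae_notMem.2 ?_)
  filter_upwards [(ae_restrict_iff' hO.measurableSet).1 hzero] with y hy hyO
  exact (ENNReal.ofReal_pos.2 (hpos y hyO)).ne' (hy hyO)

theorem isLocallyFiniteMeasure_sum {ι : Type*} {μ : ι → Measure X}
    [∀ i, IsLocallyFiniteMeasure (μ i)] (h : ∀ x, ∃ U ∈ 𝓝 x, {i | μ i U ≠ 0}.Finite) :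
    IsLocallyFiniteMeasure (Measure.sum μ) where
  finiteAtNhds x := by
    obtain ⟨U, hU, hfin⟩ := h x
    choose W hW hWfin using fun i => (μ i).finiteAt_nhds x
    obtain ⟨S, hSsub, hSo, hxS⟩ := mem_nhds_iff.1
      (Filter.inter_mem hU ((Filter.biInter_finset_mem hfin.toFinset).2 fun i _ => hW i))
    refine ⟨S, hSo.mem_nhds hxS, ?_⟩
    rw [Measure.sum_apply _ hSo.measurableSet, tsum_eq_sum (s := hfin.toFinset) fun i hi => ?_]
    · exact ENNReal.sum_lt_top.2 fun i hi => (measure_mono fun y hy =>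
        mem_iInter₂.1 (hSsub hy).2 i hi).trans_lt (hWfin i)
    · exact measure_mono_null (fun y hy => (hSsub hy).1)
        (not_not.1 fun hne => hi (hfin.mem_toFinset.2 hne))

end Measures

section Volume

variable {k : ℕ} {N : Type*} [TopologicalSpace N] [ChartedSpace (EuclideanSpace ℝ (Fin k)) N]
  [IsManifold (𝓡 k) ∞ N]

/-- The coordinate frame of the chart at `c`, at the point with coordinates `y`; it takes junk
values outside the target of the chart. -/
def chartFrame (c : N) (y : EuclideanSpace ℝ (Fin k)) (i : Fin k) :
    TangentSpace (𝓡 k) ((chartAt (EuclideanSpace ℝ (Fin k)) c).symm y) :=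
  mfderiv (𝓡 k) (𝓡 k) (chartAt (EuclideanSpace ℝ (Fin k)) c).symm y
    (EuclideanSpace.basisFun (Fin k) ℝ i)

theorem contMDiffAt_chartFrame {c : N} {y : EuclideanSpace ℝ (Fin k)}
    (hy : y ∈ (chartAt (EuclideanSpace ℝ (Fin k)) c).target) (i : Fin k) :
    ContMDiffAt (𝓡 k) (𝓡 k).tangent ∞
      (fun y => (⟨(chartAt (EuclideanSpace ℝ (Fin k)) c).symm y, chartFrame c y i⟩ :
        TangentBundle (𝓡 k) N)) y := by
  set φ := chartAt (EuclideanSpace ℝ (Fin k)) c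
  have htangent : ContMDiffOn (𝓡 k).tangent (𝓡 k).tangent ∞
      (tangentMapWithin (𝓡 k) (𝓡 k) φ.symm φ.target) (TotalSpace.proj ⁻¹' φ.target) :=
    ContMDiffOn.contMDiffOn_tangentMapWithin (contMDiffOn_chart_symm (n := ∞)) (by simp)
      φ.open_target.uniqueMDiffOn
  have hconst : ContMDiff (𝓡 k) (𝓡 k).tangent ∞ (fun y : EuclideanSpace ℝ (Fin k) =>
      (⟨y, EuclideanSpace.basisFun (Fin k) ℝ i⟩ :
        TangentBundle (𝓡 k) (EuclideanSpace ℝ (Fin k)))) :=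
    contMDiff_vectorSpace_iff_contDiff.2 contDiff_const
  have hcomp := ((htangent.contMDiffAt ((φ.open_target.preimage
    (FiberBundle.continuous_proj (EuclideanSpace ℝ (Fin k)) _)).mem_nhds hy)).comp y (hconst y) :)
  refine hcomp.congr_of_eventuallyEq ?_
  filter_upwards [φ.open_target.mem_nhds hy] with y' hy'
  exact congrArg (fun L : EuclideanSpace ℝ (Fin k) →L[ℝ] TangentSpace (𝓡 k) (φ.symm y') =>
    TotalSpace.mk (φ.symm y') (L (EuclideanSpace.basisFun (Fin k) ℝ i)))
    (mfderivWithin_of_isOpen φ.open_target hy').symm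

theorem linearIndependent_chartFrame {c : N} {y : EuclideanSpace ℝ (Fin k)}
    (hy : y ∈ (chartAt (EuclideanSpace ℝ (Fin k)) c).target) :
    LinearIndependent ℝ (chartFrame c y) :=
  (EuclideanSpace.basisFun (Fin k) ℝ).toBasis.linearIndependent.map'
    (mfderiv (𝓡 k) (𝓡 k) (chartAt (EuclideanSpace ℝ (Fin k)) c).symm y).toLinearMap
    (LinearMap.ker_eq_bot.2 ((mdifferentiable_chart c).symm.mfderiv_injective hy))

variable (g : ContMDiffRiemannianMetric (𝓡 k) ∞ (EuclideanSpace ℝ (Fin k))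
      (TangentSpace (𝓡 k) : N → Type _))

/-- The density `√(det g_{ij})` of the Riemannian measure in the chart at `c`. -/
def chartDensity (c : N) (y : EuclideanSpace ℝ (Fin k)) : ℝ :=
  Real.sqrt (gramMatrix g ((chartAt (EuclideanSpace ℝ (Fin k)) c).symm y) (chartFrame c y)).det

theorem continuousAt_chartDensity {c : N} {y : EuclideanSpace ℝ (Fin k)}
    (hy : y ∈ (chartAt (EuclideanSpace ℝ (Fin k)) c).target) :
    ContinuousAt (chartDensity g c) y :=
  Real.continuous_sqrt.continuousAt.comp
    ((Continuous.matrix_det continuous_id).continuousAt.comp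
      (continuousAt_gramMatrix g (X := fun i y => chartFrame c y i)
        (contMDiffAt_chartFrame hy)))

theorem chartDensity_pos {c : N} {y : EuclideanSpace ℝ (Fin k)}
    (hy : y ∈ (chartAt (EuclideanSpace ℝ (Fin k)) c).target) : 0 < chartDensity g c y :=
  Real.sqrt_pos.2 (det_gramMatrix_pos g (linearIndependent_chartFrame hy))

variable [MeasurableSpace N] [BorelSpace N]

theorem chartVolume_apply (c : N) {s : Set N} (hs : MeasurableSet s) :
    chartVolume g c s = (volume.withDensity fun y => ENNReal.ofReal (chartDensity g c y))
      ((chartAt (EuclideanSpace ℝ (Fin k)) c).symm ⁻¹' s ∩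
        (chartAt (EuclideanSpace ℝ (Fin k)) c).target) := by
  set φ := chartAt (EuclideanSpace ℝ (Fin k)) c
  have htarget : MeasurableSet φ.target := φ.open_target.measurableSet
  have hmeas : AEMeasurable φ.symm ((volume.restrict φ.target).withDensity
      fun y => ENNReal.ofReal (chartDensity g c y)) :=
    (φ.continuousOn_symm.aemeasurable htarget).mono_ac (withDensity_absolutelyContinuous _ _)
  rw [← Measure.restrict_apply' htarget, restrict_withDensity htarget]
  exact Measure.map_apply_of_aemeasurable hmeas hs

theorem finiteAtFilter_chartVolume {c z : N}
    (hz : z ∈ (chartAt (EuclideanSpace ℝ (Fin k)) c).source) :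
    (chartVolume g c).FiniteAtFilter (𝓝 z) := by
  set φ := chartAt (EuclideanSpace ℝ (Fin k)) c
  obtain ⟨V, hV, hfin⟩ := finiteAtFilter_withDensity_ofReal (μ := volume)
    (continuousAt_chartDensity g (φ.map_source hz))
  obtain ⟨W, hWV, hWo, hzW⟩ := mem_nhds_iff.1 hV
  have hopen : IsOpen (φ.source ∩ φ ⁻¹' W) := φ.isOpen_inter_preimage hWo
  refine ⟨_, hopen.mem_nhds ⟨hz, hzW⟩, ?_⟩
  rw [chartVolume_apply g c hopen.measurableSet]
  refine (measure_mono ?_).trans_lt hfin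
  rintro y ⟨⟨-, hyW⟩, hyt⟩
  rw [mem_preimage, φ.right_inv hyt] at hyW
  exact hWV hyW

theorem chartVolume_ne_zero {c : N} {U : Set N} (hU : IsOpen U)
    (hne : (U ∩ (chartAt (EuclideanSpace ℝ (Fin k)) c).source).Nonempty) :
    chartVolume g c U ≠ 0 := by
  set φ := chartAt (EuclideanSpace ℝ (Fin k)) c
  obtain ⟨z, hzU, hz⟩ := hne
  rw [chartVolume_apply g c hU.measurableSet, inter_comm]
  exact withDensity_ofReal_ne_zero (φ.symm.isOpen_inter_preimage hU)
    ⟨φ z, φ.map_source hz, by rwa [mem_preimage, φ.left_inv hz]⟩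
    (fun y hy => (continuousAt_chartDensity g hy.1).continuousWithinAt)
    fun y hy => chartDensity_pos g hy.1

variable [T2Space N] [SigmaCompactSpace N]

omit [MeasurableSpace N] [BorelSpace N] in
theorem chartPartition_isSubordinate :
    (chartPartition k N).IsSubordinate fun c => (chartAt (EuclideanSpace ℝ (Fin k)) c).source :=
  (SmoothPartitionOfUnity.exists_isSubordinate_chartAt_source (𝓡 k) N).choose_spec

/-- The summand of the Riemannian volume that is supported in the chart at `c`. -/
def localizedVolume (c : N) : Measure N :=
  (chartVolume g c).withDensity fun z => ENNReal.ofReal (chartPartition k N c z)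

theorem localizedVolume_eq_zero_iff (c : N) (s : Set N) :
    localizedVolume g c s = 0 ↔ chartVolume g c ({z | chartPartition k N c z ≠ 0} ∩ s) = 0 := by
  have hne (z : N) : ENNReal.ofReal (chartPartition k N c z) ≠ 0 ↔ chartPartition k N c z ≠ 0 := by
    rw [Ne, ENNReal.ofReal_eq_zero, not_le, ((chartPartition k N).nonneg c z).lt_iff_ne']
  rw [localizedVolume, withDensity_apply_eq_zero'
    (chartPartition k N c).contMDiff.continuous.measurable.ennreal_ofReal.aemeasurable]
  simp only [hne]

omit [BorelSpace N] in
theorem localizedVolume_le_chartVolume (c : N) : localizedVolume g c ≤ chartVolume g c :=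
  (withDensity_mono (Filter.Eventually.of_forall fun z =>
    ENNReal.ofReal_le_one.2 ((chartPartition k N).le_one c z))).trans_eq withDensity_one

instance isLocallyFiniteMeasure_localizedVolume (c : N) :
    IsLocallyFiniteMeasure (localizedVolume g c) where
  finiteAtNhds z := by
    by_cases hz : z ∈ tsupport (chartPartition k N c)
    · obtain ⟨W, hW, hfin⟩ :=
        finiteAtFilter_chartVolume g (chartPartition_isSubordinate (k := k) c hz)
      exact ⟨W, hW, (localizedVolume_le_chartVolume g c W).trans_lt hfin⟩
    · refine ⟨_, (isClosed_tsupport _).isOpen_compl.mem_nhds hz, lt_of_eq_of_lt ?_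
        ENNReal.zero_lt_top⟩
      refine (localizedVolume_eq_zero_iff g c _).2 (measure_mono_null ?_ measure_empty)
      exact fun y hy => hy.2 (subset_tsupport _ hy.1)

instance isLocallyFiniteMeasure_riemannianVolume :
    IsLocallyFiniteMeasure (riemannianVolume g) := by
  refine isLocallyFiniteMeasure_sum (μ := localizedVolume g) fun z => ?_
  obtain ⟨U, hU, hfin⟩ := (chartPartition k N).locallyFinite z
  refine ⟨U, hU, hfin.subset fun c hc => ?_⟩
  by_contra hdisj
  refine hc ((localizedVolume_eq_zero_iff g c U).2 (measure_mono_null ?_ measure_empty))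
  exact fun y hy => hdisj ⟨y, hy⟩

instance isOpenPosMeasure_riemannianVolume : (riemannianVolume g).IsOpenPosMeasure where
  open_pos U hU hne hzero := by
    obtain ⟨z, hz⟩ := hne
    obtain ⟨c, hc⟩ := (chartPartition k N).exists_pos_of_mem (mem_univ z)
    have hlocal : localizedVolume g c U = 0 :=
      le_zero_iff.1 ((Measure.le_sum (localizedVolume g) c U).trans_eq hzero)
    have hsupp : IsOpen {z | chartPartition k N c z ≠ 0} :=
      isOpen_ne_fun (chartPartition k N c).contMDiff.continuous continuous_const
    exact chartVolume_ne_zero g (hsupp.inter hU) ⟨z, ⟨hc.ne', hz⟩,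
      chartPartition_isSubordinate (k := k) c (subset_tsupport _ hc.ne')⟩
      ((localizedVolume_eq_zero_iff g c U).1 hlocal)

end Volume

/-! ### The first variation of the action -/

section Action

variable {EM : Type*} [NormedAddCommGroup EM] [NormedSpace ℝ EM]
  {M : Type*} [TopologicalSpace M] [ChartedSpace EM M]
  {F : Type*} [NormedAddCommGroup F] [NormedSpace ℝ F]
  {E : M → Type*} [∀ x, AddCommGroup (E x)] [∀ x, Module ℝ (E x)]
  [∀ x, TopologicalSpace (E x)] [TopologicalSpace (TotalSpace F E)]
  [FiberBundle F E] [VectorBundle ℝ F E]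
  {k : ℕ} {N : Type*} [TopologicalSpace N] [ChartedSpace (EuclideanSpace ℝ (Fin k)) N]
  [IsManifold (𝓡 k) ∞ N]
  (g : ContMDiffRiemannianMetric (𝓡 k) ∞ (EuclideanSpace ℝ (Fin k))
      (TangentSpace (𝓡 k) : N → Type _))

theorem metricTrace_zero (z : N) : metricTrace g z (fun _ => 0) = 0 := by
  simp [metricTrace]

omit [VectorBundle ℝ F E] in
theorem BundleMap.pullbackTrace_eq_zero {Φ : BundleMap EM F E k N} {z : N} (hΦ : Φ.fiber z = 0)
    {q : TotalSpace F E → ℝ} (hq : ∀ x, q ⟨x, 0⟩ = 0) : Φ.pullbackTrace g q z = 0 := by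
  have hvanish : (fun X => q (Φ.toMap ⟨z, X⟩)) = fun _ => 0 := funext fun X => by
    simp only [toMap, hΦ, LinearMap.zero_apply, hq]
  exact (congrArg (metricTrace g z) hvanish).trans (metricTrace_zero g z)

variable [∀ x, IsTopologicalAddGroup (E x)] [∀ x, ContinuousConstSMul ℝ (E x)]
  (G : ContMDiffRiemannianMetric 𝓘(ℝ, EM) ∞ F E)

theorem metricFunction_zero (x : M) : metricFunction G (⟨x, 0⟩ : TotalSpace F E) = 0 := by
  simp [metricFunction]

variable [T2Space N] [SigmaCompactSpace N] [MeasurableSpace N] [BorelSpace N]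

theorem hasDerivAt_action_of_subset_isCompact {Ψ : ℝ → BundleMap EM F E k N}
    (hΨ : ContMDiff (𝓘(ℝ, ℝ).prod (𝓡 k).tangent) (𝓘(ℝ, EM).prod 𝓘(ℝ, F)) ∞
      (fun r : ℝ × TangentBundle (𝓡 k) N => (Ψ r.1).toMap r.2))
    {D K : Set N} (hD : MeasurableSet D) (hK : IsCompact K) (hDK : D ⊆ K) :
    HasDerivAt (fun t => (Ψ t).action g G D)
      (∫ z in D, deriv (fun s => (Ψ s).pullbackTrace g (metricFunction G) z) 0
        ∂(riemannianVolume g)) 0 := by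
  have hdensity := continuous_pullbackTrace_family G g hΨ
  have hderiv := continuous_deriv_pullbackTrace_family G g hΨ
  obtain ⟨b, hb⟩ := ((isCompact_Icc (a := (-1 : ℝ)) (b := 1)).prod hK).exists_bound_of_continuousOn
    hderiv.continuousOn
  have hvolume : riemannianVolume g D < ⊤ := (measure_mono hDK).trans_lt hK.measure_lt_top
  refine (hasDerivAt_integral_of_dominated_loc_of_deriv_le
    (F := fun t z => (Ψ t).pullbackTrace g (metricFunction G) z)
    (F' := fun t z => deriv (fun s => (Ψ s).pullbackTrace g (metricFunction G) z) t)
    (μ := (riemannianVolume g).restrict D) (bound := fun _ => b)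
    (Icc_mem_nhds (by norm_num : (-1 : ℝ) < 0) (by norm_num : (0 : ℝ) < 1))
    (Filter.Eventually.of_forall fun t => ?_) ?_ ?_ ?_ ?_ ?_).2
  · exact (hdensity.comp (continuous_const.prodMk continuous_id)).aestronglyMeasurable
  · exact ((hdensity.comp (continuous_const.prodMk
      continuous_id)).continuousOn.integrableOn_compact hK).mono_set hDK
  · exact (hderiv.comp (continuous_const.prodMk continuous_id)).aestronglyMeasurable
  · exact (ae_restrict_iff' hD).2 (Filter.Eventually.of_forall fun z hz t ht =>
      hb (t, z) ⟨ht, hDK hz⟩)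
  · exact integrableOn_const hvolume.ne
  · exact Filter.Eventually.of_forall fun z t _ =>
      (differentiableAt_pullbackTrace_family G g hΨ t z).hasDerivAt

namespace LieAlgebroid

variable [FiniteDimensional ℝ EM] [IsManifold 𝓘(ℝ, EM) ∞ M] [T2Space M] [SigmaCompactSpace M]
  [FiniteDimensional ℝ F] [ContMDiffVectorBundle ∞ F E 𝓘(ℝ, EM)] {A : LieAlgebroid EM M F E}

theorem lieDeriv_metricFunction_zero (u : A.Sec) (x : M) :
    A.lieDeriv u (metricFunction G) (⟨x, 0⟩ : TotalSpace F E) = 0 := by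
  simpa using lieDeriv_metricFunction_smul G u 0 (⟨x, 0⟩ : TotalSpace F E)

theorem IsRedefinitionFamily.hasDerivAt_action {u : A.Sec} {Ψ : ℝ → BundleMap EM F E k N}
    (hΨ : A.IsRedefinitionFamily u Ψ) {D C : Set N} (hD : MeasurableSet D) (hC : IsCompact C)
    (hvanish : ∀ t, ∀ z ∈ D \ C, (Ψ t).fiber z = 0) :
    HasDerivAt (fun t => (Ψ t).action g G D)
      (∫ z in D, (Ψ 0).pullbackTrace g (A.lieDeriv u (metricFunction G)) z
        ∂(riemannianVolume g)) 0 := by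
  have hintegral (Φ : BundleMap EM F E k N) (hΦ : ∀ z ∈ D \ C, Φ.fiber z = 0)
      {q : TotalSpace F E → ℝ} (hq : ∀ x, q ⟨x, 0⟩ = 0) :
      ∫ z in D, Φ.pullbackTrace g q z ∂(riemannianVolume g) =
        ∫ z in D ∩ C, Φ.pullbackTrace g q z ∂(riemannianVolume g) :=
    setIntegral_eq_of_subset_of_forall_sdiff_eq_zero hD inter_subset_left fun z hz =>
      BundleMap.pullbackTrace_eq_zero g (hΦ z ⟨hz.1, fun hzC => hz.2 ⟨hz.1, hzC⟩⟩) hq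
  have haction : (fun t => (Ψ t).action g G D) = fun t => (Ψ t).action g G (D ∩ C) :=
    funext fun t => hintegral (Ψ t) (hvanish t) (metricFunction_zero G)
  rw [haction, hintegral (Ψ 0) (hvanish 0) (lieDeriv_metricFunction_zero G u)]
  simpa only [(hasVariation_pullbackTrace G g u _ Ψ hΨ).deriv] using
    hasDerivAt_action_of_subset_isCompact g G hΨ.1 (hD.inter hC.measurableSet) hC
      inter_subset_right

theorem hasVariation_action (u : A.Sec) {D : Set N} (hD : IsCompact D) : A.HasVariation u
    (fun Φ : BundleMap EM F E k N => Φ.action g G D)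
    (fun Φ => ∫ z in D, Φ.pullbackTrace g (A.lieDeriv u (metricFunction G)) z
      ∂(riemannianVolume g)) := fun _ hΨ =>
  hΨ.hasDerivAt_action g G hD.measurableSet hD fun _ _ hz => absurd hz.1 hz.2

theorem IsKilling.leavesActionInvariant {u : A.Sec} (hu : A.IsKilling G u) {D : Set N}
    (hD : MeasurableSet D) : A.LeavesActionInvariant g G D u := by
  rintro Ψ hΨ - ⟨C, hC, hvanish⟩
  refine (hΨ.hasDerivAt_action g G hD hC hvanish).congr_deriv ?_
  have hlie : A.lieDeriv u (metricFunction G) = fun _ => 0 := funext hu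
  have htrace (z) : (Ψ 0).pullbackTrace g (fun _ => 0) z = 0 := metricTrace_zero g z
  simp only [hlie, htrace, integral_zero]

end LieAlgebroid

end Action

/-! ### Smooth integral curves and small functions -/

section Curves

variable {V H P : Type*} [NormedAddCommGroup V] [NormedSpace ℝ V] [TopologicalSpace H]
  {I : ModelWithCorners ℝ V H} [TopologicalSpace P] [ChartedSpace H P] [I.Boundaryless]

theorem hasDerivAt_extChartAt_comp_curve [IsManifold I 1 P] {Z : ∀ p : P, TangentSpace I p}
    {γ : ℝ → P} {s : ℝ} {p₀ : P} (hs : γ s ∈ (extChartAt I p₀).source)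
    (hγ : HasMFDerivAt 𝓘(ℝ, ℝ) I γ s ((1 : ℝ →L[ℝ] ℝ).smulRight (Z (γ s)))) :
    HasDerivAt (fun r => extChartAt I p₀ (γ r))
      (fieldInChart I p₀ Z (extChartAt I p₀ (γ s))) s := by
  have hchart := (mdifferentiableAt_extChartAt (I := I)
    (by simpa only [extChartAt_source] using hs)).hasMFDerivAt
  let L : ℝ →L[ℝ] V := (mfderiv I 𝓘(ℝ, V) (extChartAt I p₀) (γ s)).comp
    ((1 : ℝ →L[ℝ] ℝ).smulRight (Z (γ s)))
  have hL : HasFDerivAt (fun r => extChartAt I p₀ (γ r)) L s := (hchart.comp s hγ).hasFDerivAt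
  have hsmul := congrArg (mfderiv I 𝓘(ℝ, V) (extChartAt I p₀) (γ s)) (one_smul ℝ (Z (γ s)))
  exact hL.hasDerivAt.congr_deriv (hsmul.trans (fieldInChart_extChartAt hs Z).symm)

theorem contMDiffAt_of_isMIntegralCurveAt [IsManifold I ∞ P] [CompleteSpace V]
    {Z : ∀ p : P, TangentSpace I p}
    (hZ : ContMDiff I I.tangent ∞ (fun p => (⟨p, Z p⟩ : TangentBundle I P))) {γ : ℝ → P} {s : ℝ}
    (hγ : IsMIntegralCurveAt γ Z s) :
    ContMDiffAt 𝓘(ℝ, ℝ) I ∞ γ s := by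
  have : IsManifold I 1 P := IsManifold.of_le (n := ∞) (by simp)
  set φ := extChartAt I (γ s)
  have hsource : ∀ᶠ r in 𝓝 s, γ r ∈ φ.source :=
    hγ.self_of_nhds.continuousAt.eventually (extChartAt_source_mem_nhds (γ s))
  obtain ⟨ε, hε, hIcc⟩ := (nhds_basis_Icc_pos s).eventually_iff.1 (hsource.and hγ)
  have hchart : ContDiffOn ℝ ∞ (fun r => φ (γ r)) (Icc (s - ε) (s + ε)) :=
    ODE.contDiffOn_enat_Icc_of_hasDerivWithinAt (n := ⊤) (f := fun _ => fieldInChart I (γ s) Z)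
      (u := φ.target) ((contDiffOn_fieldInChart hZ (γ s)).comp contDiffOn_snd fun _ hr => hr.2)
      (fun r hr => (hasDerivAt_extChartAt_comp_curve (hIcc hr).1 (hIcc hr).2).hasDerivWithinAt)
      fun r hr => φ.map_source (hIcc hr).1
  have hchart_at := (hchart.contDiffAt (Icc_mem_nhds (sub_lt_self s hε)
    (lt_add_of_pos_right s hε))).contMDiffAt
  have hsymm : ContMDiffAt 𝓘(ℝ, V) I ∞ φ.symm (φ (γ s)) :=
    contMDiffAt_extChartAt_symm (φ.map_source hsource.self_of_nhds)
  refine (hsymm.comp s hchart_at).congr_of_eventuallyEq ?_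
  filter_upwards [hsource] with r hr using (φ.left_inv hr).symm

theorem exists_smooth_integralCurve [IsManifold I ∞ P] [CompleteSpace V]
    {Z : ∀ p : P, TangentSpace I p}
    (hZ : ContMDiff I I.tangent ∞ (fun p => (⟨p, Z p⟩ : TangentBundle I P))) (p₀ : P) :
    ∃ γ : ℝ → P, γ 0 = p₀ ∧ ∀ᶠ s in 𝓝 (0 : ℝ), ContMDiffAt 𝓘(ℝ, ℝ) I ∞ γ s ∧
      mfderiv 𝓘(ℝ, ℝ) I γ s (1 : ℝ) = Z (γ s) := by
  have : IsManifold I 1 P := IsManifold.of_le (n := ∞) (by simp)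
  obtain ⟨γ, hγ₀, hγ⟩ := exists_isMIntegralCurveAt_of_contMDiffAt_boundaryless (t₀ := 0)
    ((hZ p₀).of_le (by simp))
  refine ⟨γ, hγ₀, hγ.eventually_nhds.mono fun s hs =>
    ⟨contMDiffAt_of_isMIntegralCurveAt hZ hs, ?_⟩⟩
  exact (DFunLike.congr_fun hs.self_of_nhds.mfderiv (1 : ℝ)).trans (one_smul ℝ (Z (γ s)))

theorem exists_hasCompactSupport_dirDeriv_ne_zero [IsManifold I ∞ P] [T2Space P]
    [FiniteDimensional ℝ V] {x : P} {X : TangentSpace I x} (hX : X ≠ 0) :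
    ∃ f : C^∞⟮I, P; ℝ⟯, HasCompactSupport f ∧ dirDeriv I f x X ≠ 0 := by
  obtain ⟨f, hf⟩ : ∃ f : C^∞⟮I, P; ℝ⟯, dirDeriv I f x X ≠ 0 := by
    by_contra! hzero
    exact hX (tangentSpace_ext_dirDeriv fun f => (hzero f).trans (dirDeriv_apply_zero f x).symm)
  obtain ⟨χ⟩ : Nonempty (SmoothBumpFunction I x) := inferInstance
  refine ⟨⟨fun y => χ y * f y, χ.contMDiff.mul f.contMDiff⟩, χ.hasCompactSupport.mul_right,
    ne_of_eq_of_ne (dirDeriv_congr ?_ X) hf⟩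
  filter_upwards [χ.eventuallyEq_one] with y hy
  change χ y * f y = f y
  rw [hy, Pi.one_apply, one_mul]

theorem exists_mem_nhds_zero_dirDeriv_ne_zero [IsManifold I ∞ P] [T2Space P]
    [FiniteDimensional ℝ V] {x : P} {X : TangentSpace I x} (hX : X ≠ 0) {U : Set ℝ}
    (hU : U ∈ 𝓝 0) :
    ∃ h : C^∞⟮I, P; ℝ⟯, HasCompactSupport h ∧ (∀ y, h y ∈ U) ∧ dirDeriv I h x X ≠ 0 := by
  obtain ⟨ε, hε, hball⟩ := Metric.mem_nhds_iff.1 hU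
  obtain ⟨f, hcompact, hf⟩ := exists_hasCompactSupport_dirDeriv_ne_zero hX
  obtain ⟨b, hb⟩ := hcompact.exists_bound_of_continuous f.contMDiff.continuous
  have hb_pos : 0 < |b| + 1 := by positivity
  refine ⟨⟨fun y => ε / (|b| + 1) * f y, contMDiff_const.mul f.contMDiff⟩, hcompact.mul_left,
    fun y => hball (mem_ball_zero_iff.2 ?_), ?_⟩
  · calc ‖ε / (|b| + 1) * f y‖ = ε / (|b| + 1) * ‖f y‖ := by
          rw [norm_mul, Real.norm_of_nonneg (by positivity)]
      _ < ε / (|b| + 1) * (|b| + 1) :=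
          mul_lt_mul_of_pos_left (by linarith [hb y, le_abs_self b]) (by positivity)
      _ = ε := div_mul_cancel₀ ε hb_pos.ne'
  · refine ne_of_eq_of_ne (dirDeriv_const_mul (f.contMDiff.mdifferentiableAt (by simp)) _ X) ?_
    exact mul_ne_zero (by positivity) hf

end Curves

/-! ### Fields of rank one, and the converse -/

section RankOne

variable {EM : Type*} [NormedAddCommGroup EM] [NormedSpace ℝ EM]
  {M : Type*} [TopologicalSpace M] [ChartedSpace EM M]
  {F : Type*} [NormedAddCommGroup F] [NormedSpace ℝ F]
  {E : M → Type*} [∀ x, AddCommGroup (E x)] [∀ x, Module ℝ (E x)]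
  [∀ x, TopologicalSpace (E x)] [TopologicalSpace (TotalSpace F E)]
  [FiberBundle F E] [VectorBundle ℝ F E]
  {k : ℕ} {N : Type*} [TopologicalSpace N] [ChartedSpace (EuclideanSpace ℝ (Fin k)) N]
  [IsManifold (𝓡 k) ∞ N]

/-- The bundle map `X ↦ dh(X) w(z)`, `X ∈ T_z N`, of rank at most one that is built from a function
`h` on `N` and a map `w` into the total space of `E`, whose base points form the base map. -/
def BundleMap.rankOne (h : C^∞⟮𝓡 k, N; ℝ⟯) (w : N → TotalSpace F E)
    (hw : ContMDiff (𝓡 k) (𝓘(ℝ, EM).prod 𝓘(ℝ, F)) ∞ w) : BundleMap EM F E k N where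
  base z := (w z).1
  fiber z :=
    { toFun := fun X => dirDeriv (𝓡 k) h z X • (w z).2
      map_add' := fun X Y => by rw [dirDeriv_apply_add, add_smul]
      map_smul' := fun c X => by rw [dirDeriv_apply_smul, mul_smul, RingHom.id_apply] }
  contMDiff := fun p => contMDiffAt_totalSpace_smul
    (b := fun p : TangentBundle (𝓡 k) N => (w p.1).1) (s := fun p => (w p.1).2)
    (contMDiff_dirDeriv h.contMDiff contMDiff_id p)
    ((hw.comp (contMDiff_proj (TangentSpace (𝓡 k)))) p)

omit [IsManifold (𝓡 k) ∞ N] in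
theorem dirDeriv_eq_zero_of_notMem_tsupport {h : N → ℝ} {z : N} (hz : z ∉ tsupport h)
    (X : TangentSpace (𝓡 k) z) : dirDeriv (𝓡 k) h z X = 0 := by
  rw [dirDeriv_congr (notMem_tsupport_iff_eventuallyEq.1 hz)]
  exact dirDeriv_const 0 z X

theorem BundleMap.rankOne_fiber_eq_zero {h : C^∞⟮𝓡 k, N; ℝ⟯} {w : N → TotalSpace F E}
    (hw : ContMDiff (𝓡 k) (𝓘(ℝ, EM).prod 𝓘(ℝ, F)) ∞ w) {z : N} (hz : z ∉ tsupport h) :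
    (rankOne h w hw).fiber z = 0 :=
  LinearMap.ext fun X => (congrArg (· • (w z).2)
    (dirDeriv_eq_zero_of_notMem_tsupport hz X)).trans (zero_smul ℝ _)

variable [IsManifold 𝓘(ℝ, EM) ∞ M] {A : LieAlgebroid EM M F E}

namespace LieAlgebroid

section Curve

variable {h : C^∞⟮𝓡 k, N; ℝ⟯} {v : A.Sec} {γ : ℝ → M}
  (hγ : ∀ z, ContMDiffAt 𝓘(ℝ, ℝ) 𝓘(ℝ, EM) ∞ γ (h z))
  (hγ' : ∀ z, mfderiv 𝓘(ℝ, ℝ) 𝓘(ℝ, EM) γ (h z) (1 : ℝ) = A.anchor (γ (h z)) (v (γ (h z))))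
include hγ hγ'

omit [IsManifold (𝓡 k) ∞ N] in
theorem dirDeriv_comp_integralCurve (f : C^∞⟮𝓘(ℝ, EM), M; ℝ⟯) (z : N) (X : TangentSpace (𝓡 k) z) :
    dirDeriv (𝓡 k) (fun y => f (γ (h y))) z X =
      dirDeriv (𝓡 k) h z X * anchorDeriv v f (γ (h z)) := by
  have hfγ : MDifferentiableAt 𝓘(ℝ, ℝ) 𝓘(ℝ, ℝ) (fun s => f (γ s)) (h z) :=
    (f.contMDiff.contMDiffAt.comp (h z) (hγ z)).mdifferentiableAt (by simp)
  have hderiv : deriv (fun s => f (γ s)) (h z) = anchorDeriv v f (γ (h z)) :=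
    (hasDerivAt_comp_curve (f.contMDiff.mdifferentiableAt (by simp))
      ((hγ z).mdifferentiableAt (by simp))).deriv.trans
      (congrArg (dirDeriv 𝓘(ℝ, EM) f (γ (h z))) (hγ' z))
  rw [← hderiv]
  exact (dirDeriv_comp hfγ (h.contMDiff.mdifferentiableAt (by simp)) X).trans (dirDeriv_real _ _ _)

variable {α : ∀ x, E x →ₗ[ℝ] ℝ} (hα : IsOneForm (EM := EM) (F := F) α)

theorem dirDeriv_oneForm_smul_integralCurve
    (Y : Cₛ^∞⟮𝓡 k; EuclideanSpace ℝ (Fin k), (TangentSpace (𝓡 k) : N → Type _)⟯) (z : N)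
    (X : TangentSpace (𝓡 k) z) :
    dirDeriv (𝓡 k) (fun y => α (γ (h y)) (dirDeriv (𝓡 k) h y (Y y) • v (γ (h y)))) z X =
      dirDeriv (𝓡 k) h z (Y z) *
          (dirDeriv (𝓡 k) h z X * anchorDeriv v (pairing hα v) (γ (h z)))
        + pairing hα v (γ (h z)) * dirDeriv (𝓡 k) (fun y => dirDeriv (𝓡 k) h y (Y y)) z X := by
  have hY : ContMDiff (𝓡 k) 𝓘(ℝ, ℝ) ∞ fun y => dirDeriv (𝓡 k) h y (Y y) :=
    contMDiff_dirDeriv h.contMDiff Y.contMDiff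
  have hpairing : ContMDiffAt (𝓡 k) 𝓘(ℝ, ℝ) ∞ (fun y => pairing hα v (γ (h y))) z :=
    (pairing hα v).contMDiff.contMDiffAt.comp z ((hγ z).comp z h.contMDiff.contMDiffAt)
  have hfactor : (fun y => α (γ (h y)) (dirDeriv (𝓡 k) h y (Y y) • v (γ (h y)))) =
      fun y => dirDeriv (𝓡 k) h y (Y y) * pairing hα v (γ (h y)) :=
    funext fun y => map_smul (α (γ (h y))) _ _
  rw [hfactor, ← dirDeriv_comp_integralCurve hγ hγ' (pairing hα v) z X]
  exact dirDeriv_mul (hY.mdifferentiableAt (by simp)) (hpairing.mdifferentiableAt (by simp)) X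

end Curve

variable [FiniteDimensional ℝ EM] [T2Space M] [SigmaCompactSpace M] [FiniteDimensional ℝ F]
  [ContMDiffVectorBundle ∞ F E 𝓘(ℝ, EM)]

theorem dOneForm_smul_smul_self {α : ∀ x, E x →ₗ[ℝ] ℝ} (hα : IsOneForm (EM := EM) (F := F) α)
    (x : M) (c d : ℝ) (a : E x) : A.dOneForm α x (c • a) (d • a) = 0 := by
  have hself : A.dOneForm α x a a = 0 := by linarith [dOneForm_skew (A := A) hα x a a]
  have hright (b : E x) (r : ℝ) : A.dOneForm α x b (r • a) = r * A.dOneForm α x b a :=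
    map_smul (dOneFormRight (A := A) hα x b) r a
  rw [hright, dOneForm_skew hα, hright, hself]
  ring

/-- Both `d(Φ^* α)` and `Φ^* (d_E α)` vanish for `Φ = dh ⊗ v`: the first is proportional to
`dh ∧ dh`. -/
theorem isLieAlgebroidMorphism_rankOne {h : C^∞⟮𝓡 k, N; ℝ⟯} {v : A.Sec} {γ : ℝ → M}
    (hγ : ∀ z, ContMDiffAt 𝓘(ℝ, ℝ) 𝓘(ℝ, EM) ∞ γ (h z))
    (hγ' : ∀ z, mfderiv 𝓘(ℝ, ℝ) 𝓘(ℝ, EM) γ (h z) (1 : ℝ) = A.anchor (γ (h z)) (v (γ (h z))))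
    {w : N → TotalSpace F E} (hw : ContMDiff (𝓡 k) (𝓘(ℝ, EM).prod 𝓘(ℝ, F)) ∞ w)
    (hwγ : w = fun z => ⟨γ (h z), v (γ (h z))⟩) :
    (BundleMap.rankOne h w hw).IsLieAlgebroidMorphism A := by
  subst hwγ
  constructor
  · intro f z X
    refine sub_eq_zero.2 ((dirDeriv_comp_integralCurve hγ hγ' f z X).trans ?_)
    exact (map_smul (A.dFunction f (γ (h z))) (dirDeriv (𝓡 k) h z X) (v (γ (h z)))).symm
  · intro α X Y z hα
    have hbracket := dirDeriv_mlieBracket (h.contMDiff.of_le (by norm_cast))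
      (X.contMDiff.mdifferentiableAt (x := z) (by simp))
      (Y.contMDiff.mdifferentiableAt (x := z) (by simp))
    have hα_bracket := map_smul (α (γ (h z)))
      (dirDeriv (𝓡 k) h z (VectorField.mlieBracket (𝓡 k) X Y z)) (v (γ (h z)))
    have hdα := dOneForm_smul_smul_self (A := A) hα (γ (h z)) (dirDeriv (𝓡 k) h z (X z))
      (dirDeriv (𝓡 k) h z (Y z)) (v (γ (h z)))
    have hdefect := congrArg₂ (· - ·) (congrArg₂ (· - ·) (congrArg₂ (· - ·)
      (dirDeriv_oneForm_smul_integralCurve hγ hγ' hα Y z (X z))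
      (dirDeriv_oneForm_smul_integralCurve hγ hγ' hα X z (Y z))) hα_bracket) hdα
    refine Eq.trans hdefect ?_
    change _ - _ - dirDeriv (𝓡 k) h z _ * pairing hα v (γ (h z)) - 0 = 0
    rw [hbracket]
    ring

theorem isRedefinitionFamily_rankOne (u : A.Sec) (h : C^∞⟮𝓡 k, N; ℝ⟯)
    {W : ℝ → N → TotalSpace F E} (hW : ContMDiff (𝓘(ℝ, ℝ).prod (𝓡 k)) (𝓘(ℝ, EM).prod 𝓘(ℝ, F)) ∞
      (fun r : ℝ × N => W r.1 r.2))
    (hWt : ∀ t, ContMDiff (𝓡 k) (𝓘(ℝ, EM).prod 𝓘(ℝ, F)) ∞ (W t))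
    (hvelocity : ∀ z, mfderiv 𝓘(ℝ, ℝ) (𝓘(ℝ, EM).prod 𝓘(ℝ, F)) (fun t => W t z) 0 (1 : ℝ) =
      A.tangentLift u (W 0 z)) :
    A.IsRedefinitionFamily u fun t => BundleMap.rankOne h (W t) (hWt t) := by
  refine ⟨fun r => ?_, fun p => ?_⟩
  · have hWproj : ContMDiff (𝓘(ℝ, ℝ).prod (𝓡 k).tangent) (𝓘(ℝ, EM).prod 𝓘(ℝ, F)) ∞
        (fun r : ℝ × TangentBundle (𝓡 k) N => W r.1 r.2.1) :=
      hW.comp (contMDiff_fst.prodMk ((contMDiff_proj (TangentSpace (𝓡 k))).comp contMDiff_snd))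
    exact contMDiffAt_totalSpace_smul
      (b := fun r : ℝ × TangentBundle (𝓡 k) N => (W r.1 r.2.1).1) (s := fun r => (W r.1 r.2.1).2)
      (contMDiff_dirDeriv h.contMDiff contMDiff_snd r) (hWproj r)
  · have hcurve : MDifferentiableAt 𝓘(ℝ, ℝ) (𝓘(ℝ, EM).prod 𝓘(ℝ, F)) (fun t => W t p.1) 0 :=
      (hW.comp (contMDiff_id.prodMk contMDiff_const)).mdifferentiableAt (by simp)
    have hscale := (contMDiff_totalSpace_const_smul (EM := EM) (F := F) (E := E)
      (dirDeriv (𝓡 k) h p.1 p.2)).mdifferentiableAt (x := W 0 p.1) (by simp)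
    refine Eq.trans (DFunLike.congr_fun (mfderiv_comp (0 : ℝ) hscale hcurve) (1 : ℝ)) ?_
    refine Eq.trans (congrArg (mfderiv (𝓘(ℝ, EM).prod 𝓘(ℝ, F)) (𝓘(ℝ, EM).prod 𝓘(ℝ, F))
      (fun e : TotalSpace F E => (⟨e.1, dirDeriv (𝓡 k) h p.1 p.2 • e.2⟩ : TotalSpace F E))
      (W 0 p.1)) (hvelocity p.1)) ?_
    exact (tangentLift_const_smul u _ _).symm

end LieAlgebroid

end RankOne

section Converse

variable {EM : Type*} [NormedAddCommGroup EM] [NormedSpace ℝ EM]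
  {M : Type*} [TopologicalSpace M] [ChartedSpace EM M] [IsManifold 𝓘(ℝ, EM) ∞ M]
  {F : Type*} [NormedAddCommGroup F] [NormedSpace ℝ F]
  {E : M → Type*} [∀ x, AddCommGroup (E x)] [∀ x, Module ℝ (E x)]
  [∀ x, TopologicalSpace (E x)] [TopologicalSpace (TotalSpace F E)]
  [FiberBundle F E] [VectorBundle ℝ F E] [ContMDiffVectorBundle ∞ F E 𝓘(ℝ, EM)]
  {A : LieAlgebroid EM M F E}
  {k : ℕ} {N : Type*} [TopologicalSpace N] [ChartedSpace (EuclideanSpace ℝ (Fin k)) N]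
  [IsManifold (𝓡 k) ∞ N]
  (g : ContMDiffRiemannianMetric (𝓡 k) ∞ (EuclideanSpace ℝ (Fin k))
      (TangentSpace (𝓡 k) : N → Type _))

/-- The differential of a real function at a point of `N`, as a linear form. -/
def dirDerivForm (h : N → ℝ) (z : N) : TangentSpace (𝓡 k) z →ₗ[ℝ] ℝ where
  toFun := dirDeriv (𝓡 k) h z
  map_add' := dirDeriv_apply_add h z
  map_smul' := dirDeriv_apply_smul h z

theorem metricTrace_dirDeriv_mul_self_pos {h : N → ℝ} {z : N} {X : TangentSpace (𝓡 k) z}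
    (hX : dirDeriv (𝓡 k) h z X ≠ 0) :
    0 < metricTrace g z fun X => dirDeriv (𝓡 k) h z X * dirDeriv (𝓡 k) h z X :=
  metricTrace_mul_self_pos g (dirDerivForm h z) fun hzero => hX (LinearMap.congr_fun hzero X)

theorem metricTrace_dirDeriv_mul_self_eq_zero {h : N → ℝ} {z : N}
    (hzero : ∀ X : TangentSpace (𝓡 k) z, dirDeriv (𝓡 k) h z X = 0) :
    metricTrace g z (fun X => dirDeriv (𝓡 k) h z X * dirDeriv (𝓡 k) h z X) = 0 := by
  simp only [hzero, mul_zero]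
  exact metricTrace_zero g z

theorem metricTrace_dirDeriv_mul_self_nonneg (h : N → ℝ) (z : N) :
    0 ≤ metricTrace g z fun X => dirDeriv (𝓡 k) h z X * dirDeriv (𝓡 k) h z X := by
  by_cases hzero : ∀ X : TangentSpace (𝓡 k) z, dirDeriv (𝓡 k) h z X = 0
  · exact (metricTrace_dirDeriv_mul_self_eq_zero g hzero).ge
  · obtain ⟨X, hX⟩ := not_forall.1 hzero
    exact (metricTrace_dirDeriv_mul_self_pos g hX).le

theorem integral_metricTrace_dirDeriv_mul_pos [T2Space N] [SigmaCompactSpace N]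
    [MeasurableSpace N] [BorelSpace N] {h q : N → ℝ}
    (hcompact : HasCompactSupport h) {z₀ : N} {X₀ : TangentSpace (𝓡 k) z₀}
    (hX₀ : dirDeriv (𝓡 k) h z₀ X₀ ≠ 0) (hq : ∀ z, 0 < q z)
    (hcont : Continuous fun z =>
      metricTrace g z (fun X => dirDeriv (𝓡 k) h z X * dirDeriv (𝓡 k) h z X) * q z) :
    0 < ∫ z, metricTrace g z (fun X => dirDeriv (𝓡 k) h z X * dirDeriv (𝓡 k) h z X) * q z
      ∂(riemannianVolume g) := by
  refine hcont.integral_pos_of_hasCompactSupport_nonneg_nonzero (x := z₀)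
    (HasCompactSupport.intro hcompact fun z hz => ?_)
    (fun z => mul_nonneg (metricTrace_dirDeriv_mul_self_nonneg g h z) (hq z).le)
    (mul_pos (metricTrace_dirDeriv_mul_self_pos g hX₀) (hq z₀)).ne'
  rw [metricTrace_dirDeriv_mul_self_eq_zero g (dirDeriv_eq_zero_of_notMem_tsupport hz), zero_mul]

variable [FiniteDimensional ℝ EM] [T2Space M] [SigmaCompactSpace M] [FiniteDimensional ℝ F]

namespace LieAlgebroid

/-- The fields are `dh ⊗ R_t(v(γ(h)))`, where `v` is a section through `e₀`, `γ` an integral curve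
of `ρ(v)` and `R_t` a family of local maps of `E` with velocity `d_T(u)`. -/
theorem exists_isRedefinitionFamily_rankOne (u : A.Sec) (e₀ : TotalSpace F E) :
    ∃ c : ℝ → TotalSpace F E, c 0 = e₀ ∧ ContinuousAt c 0 ∧ ∃ U ∈ 𝓝 (0 : ℝ),
      ∀ h : C^∞⟮𝓡 k, N; ℝ⟯, (∀ z, h z ∈ U) → ∃ (W : ℝ → N → TotalSpace F E)
        (hW : ∀ t, ContMDiff (𝓡 k) (𝓘(ℝ, EM).prod 𝓘(ℝ, F)) ∞ (W t)),
        W 0 = (fun z => c (h z)) ∧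
        A.IsRedefinitionFamily u (fun t => BundleMap.rankOne h (W t) (hW t)) ∧
        (BundleMap.rankOne h (W 0) (hW 0)).IsLieAlgebroidMorphism A := by
  obtain ⟨v, hv⟩ : ∃ v : A.Sec, v e₀.1 = e₀.2 := A.exists_sec e₀
  obtain ⟨R, hR⟩ := exists_smooth_family_mfderiv_eq (contMDiff_tangentLift u) e₀
  obtain ⟨γ, hγ₀, hγ⟩ := exists_smooth_integralCurve (contMDiff_anchor_sec v) e₀.1
  set c : ℝ → TotalSpace F E := fun s => ⟨γ s, v (γ s)⟩
  have hc_smooth (s : ℝ) (hs : ContMDiffAt 𝓘(ℝ, ℝ) 𝓘(ℝ, EM) ∞ γ s) :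
      ContMDiffAt 𝓘(ℝ, ℝ) (𝓘(ℝ, EM).prod 𝓘(ℝ, F)) ∞ c s := (contMDiff_sec v).contMDiffAt.comp s hs
  have hc₀ : c 0 = e₀ :=
    (congrArg (fun x => (⟨x, v x⟩ : TotalSpace F E)) hγ₀).trans (congrArg (TotalSpace.mk e₀.1) hv)
  have hc_cont : ContinuousAt c 0 := (hc_smooth 0 hγ.self_of_nhds.1).continuousAt
  have hRc : ∀ᶠ s in 𝓝 (0 : ℝ), _ := hc_cont.eventually (hc₀.symm ▸ hR)
  refine ⟨c, hc₀, hc_cont, _, Filter.inter_mem hγ hRc, fun h hU => ?_⟩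
  have hch : ContMDiff (𝓡 k) (𝓘(ℝ, EM).prod 𝓘(ℝ, F)) ∞ fun z => c (h z) := fun z =>
    (hc_smooth _ (hU z).1.1).comp z h.contMDiff.contMDiffAt
  have hW : ContMDiff (𝓘(ℝ, ℝ).prod (𝓡 k)) (𝓘(ℝ, EM).prod 𝓘(ℝ, F)) ∞
      fun r : ℝ × N => R r.1 (c (h r.2)) := fun r =>
    ((hU r.2).2.1 r.1).comp r (contMDiffAt_fst.prodMk (hch.contMDiffAt.comp r contMDiffAt_snd))
  have hWt (t : ℝ) : ContMDiff (𝓡 k) (𝓘(ℝ, EM).prod 𝓘(ℝ, F)) ∞ fun z => R t (c (h z)) :=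
    hW.comp (contMDiff_const.prodMk contMDiff_id)
  have hW₀ : (fun z => R 0 (c (h z))) = fun z => c (h z) := funext fun z => (hU z).2.2.1
  refine ⟨fun t z => R t (c (h z)), hWt, hW₀, isRedefinitionFamily_rankOne u h hW hWt fun z => ?_,
    isLieAlgebroidMorphism_rankOne (fun z => (hU z).1.1) (fun z => (hU z).1.2) _ hW₀⟩
  let D : TotalSpace F E → EM × F := fun e => A.tangentLift u e
  exact (hU z).2.2.2.trans (congrArg D (congrFun hW₀ z)).symm

variable [∀ x, IsTopologicalAddGroup (E x)] [∀ x, ContinuousConstSMul ℝ (E x)]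
  (G : ContMDiffRiemannianMetric 𝓘(ℝ, EM) ∞ F E)

theorem pullbackTrace_lieDeriv_rankOne (u : A.Sec) (h : C^∞⟮𝓡 k, N; ℝ⟯) {w : N → TotalSpace F E}
    (hw : ContMDiff (𝓡 k) (𝓘(ℝ, EM).prod 𝓘(ℝ, F)) ∞ w) (z : N) :
    (BundleMap.rankOne h w hw).pullbackTrace g (A.lieDeriv u (metricFunction G)) z =
      metricTrace g z (fun X => dirDeriv (𝓡 k) h z X * dirDeriv (𝓡 k) h z X) *
        A.lieDeriv u (metricFunction G) (w z) := by
  have hsquare : (fun X => A.lieDeriv u (metricFunction G)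
      ((BundleMap.rankOne h w hw).toMap ⟨z, X⟩)) = fun X =>
        dirDeriv (𝓡 k) h z X * dirDeriv (𝓡 k) h z X * A.lieDeriv u (metricFunction G) (w z) :=
    funext fun X => by
      rw [← pow_two]
      exact lieDeriv_metricFunction_smul G u (dirDeriv (𝓡 k) h z X) (w z)
  refine (congrArg (metricTrace g z) hsquare).trans ?_
  simp only [metricTrace, Finset.sum_mul]
  refine Finset.sum_congr rfl fun i _ => Finset.sum_congr rfl fun j _ => ?_
  ring

variable [T2Space N] [SigmaCompactSpace N]

omit [FiniteDimensional ℝ F] in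
theorem IsRedefinitionFamily.continuous_pullbackTrace_lieDeriv {u : A.Sec}
    {Ψ : ℝ → BundleMap EM F E k N} (hΨ : A.IsRedefinitionFamily u Ψ) :
    Continuous fun z => (Ψ 0).pullbackTrace g (A.lieDeriv u (metricFunction G)) z :=
  ((continuous_deriv_pullbackTrace_family G g hΨ.1).comp
    (continuous_const.prodMk continuous_id)).congr fun z =>
      (hasVariation_pullbackTrace G g u z Ψ hΨ).deriv

variable [MeasurableSpace N] [BorelSpace N]

variable {G} in
theorem integral_pullbackTrace_rankOne_eq_zero {u : A.Sec}
    (hu : A.LeavesActionInvariant g G (univ : Set N) u) {h : C^∞⟮𝓡 k, N; ℝ⟯}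
    (hcompact : HasCompactSupport h) {W : ℝ → N → TotalSpace F E}
    {hW : ∀ t, ContMDiff (𝓡 k) (𝓘(ℝ, EM).prod 𝓘(ℝ, F)) ∞ (W t)}
    (hΨ : A.IsRedefinitionFamily u fun t => BundleMap.rankOne h (W t) (hW t))
    (hmorphism : (BundleMap.rankOne h (W 0) (hW 0)).IsLieAlgebroidMorphism A) :
    ∫ z, (BundleMap.rankOne h (W 0) (hW 0)).pullbackTrace g (A.lieDeriv u (metricFunction G)) z
      ∂(riemannianVolume g) = 0 := by
  have hvanish (t : ℝ) (z : N) (hz : z ∈ univ \ tsupport h) :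
      (BundleMap.rankOne h (W t) (hW t)).fiber z = 0 :=
    BundleMap.rankOne_fiber_eq_zero (hW t) hz.2
  have hvariation := (hΨ.hasDerivAt_action g G MeasurableSet.univ hcompact hvanish).unique
    (hu _ hΨ hmorphism ⟨_, hcompact, hvanish⟩)
  rwa [Measure.restrict_univ] at hvariation

variable {G} in
theorem isKilling_of_leavesActionInvariant (hk : 0 < k) [Nonempty N] {u : A.Sec}
    (hu : A.LeavesActionInvariant g G (univ : Set N) u) : A.IsKilling G u := by
  intro e₀
  by_contra hne
  set L : TotalSpace F E → ℝ := A.lieDeriv u (metricFunction G)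
  have hL : Continuous L := (contMDiff_lieDeriv u (contMDiff_metricFunction G)).continuous
  obtain ⟨c, rfl, hc, U, hU, hfields⟩ := exists_isRedefinitionFamily_rankOne (k := k) (N := N) u e₀
  have hsign : {s | 0 < L (c 0) * L (c s)} ∈ 𝓝 0 :=
    (continuousAt_const.mul (hL.continuousAt.comp hc)).eventually
      (lt_mem_nhds (mul_self_pos.2 hne))
  obtain ⟨z₀⟩ := ‹Nonempty N›
  obtain ⟨h, hcompact, hmem, hdh⟩ := exists_mem_nhds_zero_dirDeriv_ne_zero
    ((coordBasis z₀).ne_zero ⟨0, hk⟩) (Filter.inter_mem hU hsign)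
  obtain ⟨W, hW, hW₀, hΨ, hmorphism⟩ := hfields h fun z => (hmem z).1
  have hdensity (z : N) : L (c 0) * (BundleMap.rankOne h (W 0) (hW 0)).pullbackTrace g L z =
      metricTrace g z (fun X => dirDeriv (𝓡 k) h z X * dirDeriv (𝓡 k) h z X) *
        (L (c 0) * L (c (h z))) := by
    rw [pullbackTrace_lieDeriv_rankOne, congrFun hW₀ z]
    ring
  have hpos := integral_metricTrace_dirDeriv_mul_pos g hcompact hdh (fun z => (hmem z).2)
    ((continuous_const.mul (hΨ.continuous_pullbackTrace_lieDeriv g G)).congr hdensity)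
  simp only [← hdensity, integral_const_mul] at hpos
  rw [integral_pullbackTrace_rankOne_eq_zero g hu hcompact hΨ hmorphism, mul_zero] at hpos
  exact lt_irrefl 0 hpos

variable {G} in
theorem tfae_isKilling (hk : 0 < k) [Nonempty N] (u : A.Sec) : List.TFAE
    [A.IsKilling G u, A.IsInternalSymmetry g G u,
      A.LeavesActionInvariant g G (univ : Set N) u] := by
  tfae_have 1 → 2 := fun h => ⟨preservesMorphisms u, fun D hD => h.leavesActionInvariant g G hD⟩
  tfae_have 2 → 3 := fun h => h.2 univ MeasurableSet.univ
  tfae_have 3 → 1 := isKilling_of_leavesActionInvariant g hk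
  tfae_finish

end LieAlgebroid

end Converse

end

theorem mainTheorem7
    -- the target: a Lie algebroid `E → M` with a Riemannian metric `G`
    {EM : Type*} [NormedAddCommGroup EM] [NormedSpace ℝ EM] [FiniteDimensional ℝ EM]
    {M : Type*} [TopologicalSpace M] [ChartedSpace EM M] [IsManifold 𝓘(ℝ, EM) ∞ M]
    [T2Space M] [SigmaCompactSpace M]
    {F : Type*} [NormedAddCommGroup F] [NormedSpace ℝ F] [FiniteDimensional ℝ F]
    {E : M → Type*} [∀ x, AddCommGroup (E x)] [∀ x, Module ℝ (E x)]
    [∀ x, TopologicalSpace (E x)] [∀ x, IsTopologicalAddGroup (E x)]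
    [∀ x, ContinuousConstSMul ℝ (E x)] [TopologicalSpace (TotalSpace F E)]
    [FiberBundle F E] [VectorBundle ℝ F E] [ContMDiffVectorBundle ∞ F E 𝓘(ℝ, EM)]
    (A : LieAlgebroid EM M F E) (G : ContMDiffRiemannianMetric 𝓘(ℝ, EM) ∞ F E)
    -- the source: a Riemannian manifold `(N, g)` of positive dimension, without boundary
    {k : ℕ} (hk : 0 < k) {N : Type*} [TopologicalSpace N]
    [ChartedSpace (EuclideanSpace ℝ (Fin k)) N] [IsManifold (𝓡 k) ∞ N]
    [T2Space N] [SigmaCompactSpace N] [MeasurableSpace N] [BorelSpace N] [Nonempty N]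
    (g : ContMDiffRiemannianMetric (𝓡 k) ∞ (EuclideanSpace ℝ (Fin k))
      (TangentSpace (𝓡 k) : N → Type _)) :
    -- the tangent lift is given by its defining formula on every section `v` of `E`
    (∀ (u v : A.Sec) (x : M), A.tangentLift u ⟨x, v x⟩ =
      mfderiv 𝓘(ℝ, EM) (𝓘(ℝ, EM).prod 𝓘(ℝ, F)) (fun y => (⟨y, v y⟩ : TotalSpace F E)) x
          (A.anchor x (u x))
        - LieAlgebroid.verticalLift (⟨x, v x⟩ : TotalSpace F E) (⁅u, v⁆ x)) ∧
    -- first variation of the Lagrangian and of the action over compact regions, at any field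
    (∀ (u : A.Sec) (z : N), A.HasVariation u
      (fun Φ : BundleMap EM F E k N => Φ.pullbackTrace g (metricFunction G) z)
      (fun Φ => Φ.pullbackTrace g (A.lieDeriv u (metricFunction G)) z)) ∧
    (∀ (u : A.Sec) (D : Set N), IsCompact D → A.HasVariation u
      (fun Φ : BundleMap EM F E k N => Φ.action g G D)
      (fun Φ => ∫ z in D, Φ.pullbackTrace g (A.lieDeriv u (metricFunction G)) z
        ∂(riemannianVolume g))) ∧
    -- field redefinitions are tangent to the space of Lie algebroid morphisms
    (∀ u : A.Sec, A.PreservesMorphisms k N u) ∧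
    -- the sections inducing internal symmetries are exactly the Killing sections
    (∀ u : A.Sec, List.TFAE [A.IsKilling G u, A.IsInternalSymmetry g G u,
      A.LeavesActionInvariant g G (univ : Set N) u]) ∧
    -- `δ` is the Lie algebra morphism `u ↦ d_T(u)` and `iso` is the Lie algebra of Killing sections
    ∃ (δ : A.Sec →ₗ⁅ℝ⁆ Derivation ℝ C^∞⟮𝓘(ℝ, EM).prod 𝓘(ℝ, F), TotalSpace F E; ℝ⟯
          C^∞⟮𝓘(ℝ, EM).prod 𝓘(ℝ, F), TotalSpace F E; ℝ⟯)
      (iso : LieSubalgebra ℝ A.Sec),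
      (∀ u f e, δ u f e = A.lieDeriv u f e) ∧
      (∀ u, u ∈ iso ↔ A.IsKilling G u) ∧
      -- the field redefinitions close off-shell: `[δ_u, δ_v] = δ_[u, v]` on arbitrary fields
      (∀ (u v : A.Sec) (f : C^∞⟮𝓘(ℝ, EM).prod 𝓘(ℝ, F), TotalSpace F E; ℝ⟯)
        (p : TangentBundle (𝓡 k) N),
        A.HasVariation v (fun Φ : BundleMap EM F E k N => f (Φ.toMap p))
          (fun Φ => δ v f (Φ.toMap p)) ∧
        A.HasVariation u (fun Φ : BundleMap EM F E k N => δ v f (Φ.toMap p))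
          (fun Φ => δ u (δ v f) (Φ.toMap p)) ∧
        A.HasVariation ⁅u, v⁆ (fun Φ : BundleMap EM F E k N => f (Φ.toMap p))
          (fun Φ => δ u (δ v f) (Φ.toMap p) - δ v (δ u f) (Φ.toMap p))) ∧
      -- the Lie algebra of internal symmetries is the image of `iso` under `δ`, and only central
      -- sections induce the trivial redefinition
      (∀ X, X ∈ iso.map δ ↔ ∃ u, A.IsInternalSymmetry g G u ∧ δ u = X) ∧
      (∀ u : A.Sec, δ u = 0 ↔ ∀ v : A.Sec, ⁅u, v⁆ = 0) := by
  refine ⟨LieAlgebroid.tangentLift_eq, LieAlgebroid.hasVariation_pullbackTrace G g,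
    fun u D hD => LieAlgebroid.hasVariation_action g G u hD, LieAlgebroid.preservesMorphisms,
    LieAlgebroid.tfae_isKilling g hk, A.lieHom, A.killing G, LieAlgebroid.lieHom_apply,
    LieAlgebroid.mem_killing G, fun u v f p => ⟨LieAlgebroid.hasVariation_eval v f.contMDiff p,
      LieAlgebroid.hasVariation_eval u (A.lieHom v f).contMDiff p,
      LieAlgebroid.hasVariation_eval_lie u v f.contMDiff p⟩, fun X => ?_,
    LieAlgebroid.lieHom_eq_zero_iff⟩
  have hiff (u : A.Sec) : A.IsInternalSymmetry g G u ↔ A.IsKilling G u :=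
    (LieAlgebroid.tfae_isKilling g hk u).out 1 0
  simp only [LieSubalgebra.mem_map, LieAlgebroid.mem_killing, hiff]
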